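/- Let $n,m\ge 1$ be integers, $q\in(1,2)$ and $pq=2$. For $\psi:\mathbb{R}^n\to\mathbb{C}$ and $\lambda>0$ put $\psi_\lambda(x)=\lambda^{-n/2}\psi(\lambda^{-1}x)$, and for $f\in L^q(\mathbb{R}^n)$ (complex-valued) define $$S^m_{\mathrm{cont},q}f(\lambda_1,\dots,\lambda_m)=\big\|\,|\cdots||f*\psi_{\lambda_1}|*\psi_{\lambda_2}|*\cdots|*\psi_{\lambda_m}\big\|_{L^q(\mathbb{R}^n)}^q,\qquad (\lambda_1,\dots,\lambda_m)\in\mathbb{R}_+^m=(0,\infty)^m .$$ Let $L^p(\mathbb{R}_+^m)$ be taken with respect to the measure $\frac{d\lambda_1}{\lambda_1^{n+1}}\cdots\frac{d\lambda_m}{\lambda_m^{n+1}}$, and for $c\in\mathbb{R}$ let $\tau(x)=cx$ and $L_\tau f(x)=f(x-\tau(x))=f((1-c)x)$. Let $A\in\mathbb{R}$ and $\alpha,\beta,\kappa>0$. Then there is a constant $K>0$, depending only on $n,m,q$ and on $A,\alpha,\beta,\kappa$, such that the following holds. Let $\psi\in L^1(\mathbb{R}^n)\cap L^2(\mathbb{R}^n)$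 be any wavelet (that is, $\int_{\mathbb{R}^n}\psi=0$) which is twice differentiable and satisfies, for all $x\in\mathbb{R}^n$, $$|\psi(x)|\le\frac{A}{(1+|x|)^{n+1+\alpha}},\qquad |\nabla\psi(x)|\le\frac{A}{(1+|x|)^{n+1+\beta}},\qquad \|D^2\psi(x)\|_\infty\le\frac{A}{(1+|x|)^{n+1+\kappa}},$$ where $|\nabla\psi(x)|$ is the norm of the differential of $\psi$ at $x$ and $\|D^2\psi(x)\|_\infty$ is the largest modulus of a second-order partial derivative at $x$. Then for every real $c<\frac1{2n}$ and every $f\in L^q(\mathbb{R}^n)$, the values $S^m_{\mathrm{cont},q}f(\lambda)$ and $S^m_{\mathrm{cont},q}L_\tau f(\lambda)$ are finite for all $\lambda\in\mathbb{R}_+^m$, their difference belongs to $L^p(\mathbb{R}_+^m)$, and $$\big\|S^m_{\mathrm{cont},q}f-S^m_{\mathrm{cont},q}L_\tau f\big\|_{L^p(\mathbb{R}_+^m)}\le |c|\,K\,\|f\|_q^q .$$ -/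

import Mathlib

noncomputable section

namespace WaveletScattering

open MeasureTheory

/-- A wavelet on `ℝⁿ`: a complex-valued function in `L¹ ∩ L²` with zero average. -/
structure IsWavelet {n : ℕ} (ψ : EuclideanSpace ℝ (Fin n) → ℂ) : Prop where
  memLp_one : MemLp ψ 1 volume
  memLp_two : MemLp ψ 2 volume
  integral_eq_zero : ∫ x, ψ x = 0

/-- The function `ψ` is twice differentiable, and `ψ`, its gradient and its Hessian decay
(with constant `A`) faster than the power `n + 1` of `1 + |x|`.
The operator norm of the differential is `|∇ψ|` (for complex-valued `ψ` it is at most the Euclidean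
norm of the vector of partial derivatives), and `‖D²ψ‖_∞` is the largest modulus of a second order
partial derivative. -/
structure HasDecay {n : ℕ} (A α β κ : ℝ) (ψ : EuclideanSpace ℝ (Fin n) → ℂ) : Prop where
  differentiable : Differentiable ℝ ψ
  differentiable_fderiv : Differentiable ℝ (fderiv ℝ ψ)
  decay : ∀ x, ‖ψ x‖ ≤ A / (1 + ‖x‖) ^ ((n : ℝ) + 1 + α)
  decay_grad : ∀ x, ‖fderiv ℝ ψ x‖ ≤ A / (1 + ‖x‖) ^ ((n : ℝ) + 1 + β)
  decay_hess : ∀ x, ∀ i j : Fin n,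
    ‖fderiv ℝ (fderiv ℝ ψ) x (EuclideanSpace.single i 1) (EuclideanSpace.single j 1)‖
      ≤ A / (1 + ‖x‖) ^ ((n : ℝ) + 1 + κ)

/-- The `L²`-normalized dilation `ψ_λ(x) = λ^{-n/2} ψ(λ⁻¹ x)`. -/
def dilate {n : ℕ} (ψ : EuclideanSpace ℝ (Fin n) → ℂ) (lam : ℝ) :
    EuclideanSpace ℝ (Fin n) → ℂ :=
  fun x => ((lam ^ (-(n : ℝ) / 2) : ℝ) : ℂ) * ψ (lam⁻¹ • x)

/-- The wavelet transform at scale `λ`: the convolution `f ∗ ψ_λ`. -/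
def waveletTransform {n : ℕ} (ψ : EuclideanSpace ℝ (Fin n) → ℂ) (lam : ℝ)
    (f : EuclideanSpace ℝ (Fin n) → ℂ) : EuclideanSpace ℝ (Fin n) → ℂ :=
  MeasureTheory.convolution f (dilate ψ lam) (ContinuousLinearMap.mul ℂ ℂ) volume

/-- The cascade `|…||f ∗ ψ_{λ₁}| ∗ ψ_{λ₂}| ∗ ⋯ ∗ ψ_{λ_m}|`. -/
def cascade {n : ℕ} (ψ : EuclideanSpace ℝ (Fin n) → ℂ) :
    (m : ℕ) → (Fin m → ℝ) → (EuclideanSpace ℝ (Fin n) → ℂ) → EuclideanSpace ℝ (Fin n) → ℂ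
  | 0, _, f => f
  | m + 1, lam, f => fun x =>
      ((‖waveletTransform ψ (lam (Fin.last m)) (cascade ψ m (Fin.init lam) f) x‖ : ℝ) : ℂ)

/-- The `m`-layer scattering transform `S^m_{cont,q} f (λ₁, …, λ_m)`, the `q`-th power of the
`L^q` norm of the cascade (the outermost modulus in the cascade does not affect this norm). -/
def scattering {n : ℕ} (ψ : EuclideanSpace ℝ (Fin n) → ℂ) (q : ℝ) (m : ℕ)
    (f : EuclideanSpace ℝ (Fin n) → ℂ) (lam : Fin m → ℝ) : ℝ :=
  ∫ x, ‖cascade ψ m lam f x‖ ^ q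

/-- The measure `dλ / λ^{n+1}` on `(0, ∞)`. -/
def scaleMeasure (n : ℕ) : Measure ℝ :=
  (volume.restrict (Set.Ioi 0)).withDensity (fun lam => ENNReal.ofReal ((lam ^ (n + 1))⁻¹))

/-- The measure `dλ₁ / λ₁^{n+1} ⋯ dλ_m / λ_m^{n+1}` on `(0, ∞)^m`. -/
def scaleMeasurePi (n m : ℕ) : Measure (Fin m → ℝ) :=
  Measure.pi (fun _ => scaleMeasure n)

/-- The operator `L_τ f(x) = f(x - τ(x))`. -/
def deform {n : ℕ} (τ : EuclideanSpace ℝ (Fin n) → EuclideanSpace ℝ (Fin n))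
    (f : EuclideanSpace ℝ (Fin n) → ℂ) : EuclideanSpace ℝ (Fin n) → ℂ :=
  fun x => f (x - τ x)

end WaveletScattering

end

noncomputable section

namespace WaveletScattering

open MeasureTheory Set
open scoped ENNReal

/-! Put $s=1-c>0$ and $\mu=s^{-1}$. Substituting $y=sx$ in each convolution moves the dilation from
$f$ to the wavelet: $S_\psi L_\tau f=s^{-n}S_{\psi'}f$ with $\psi'=\mu^n\psi(\mu\,\cdot)$
(`scattering_comp_smul`). One function is thus analysed by two wavelets. For $|c|\le 1/2$ the kernel
$\psi-\psi'$ again has mean zero, decay and Lipschitz bounds, now with constants $O(|c|)$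
(`HasDecay.isLPKernel_sub_rescale`). For $c\le-1/2$ a factor $|c|$ costs nothing, and boundedness of
the transform suffices.

The analytic core is the estimate $\int\|f*\varphi_\lambda\|_q^2\,d\lambda/\lambda^{n+1}\le
C\|f\|_q^2$ for $1<q<2$, with $C$ quadratic in the size of the kernel
(`IsLPKernel.lintegral_eLpNorm_conv_sq_le`). Because the $L^q$ norm stands inside the integral over
scales, singular integral theory can be avoided. The averages of $f$ over dyadic cubes form a
martingale, and uniform convexity of $|\cdot|^q$ bounds the sum of the squared $L^q$ norms of its
increments (`tsum_eLpNorm_gridDiff_sq_le`). A kernel at scale $2^j$ acts on the increment at scale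
$2^k$ with a gain $r^{|k-j|}$, $r<1$ (`IsLPKernel.eLpNorm_conv_gridDiff_le`), and Young's inequality
on $\mathbb Z$ sums these interactions.

Applied layer by layer, the estimate bounds the cascade in $L^2$ of the scales with values in $L^q$.
Since the modulus is 1-Lipschitz, exchanging the kernels layer by layer bounds the difference of the
two cascades by $O(|c|)$ in the same norm (`IsLPKernel.lintegral_eLpNorm_cascade_sub_sq_le`).
Finally $|a^q-wb^q|$ is a first-order difference times $(a+b)^{q-1}$, and Hölder's inequality, where
$p=2/q$ is exactly the right exponent, leaves a product of such $L^2$ norms, homogeneous of degree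
$q$ in $f$ (`eLpNorm_le_of_le_mul_rpow`). -/

/-- Euclidean space of dimension `n`. -/
abbrev Euc (n : ℕ) := EuclideanSpace ℝ (Fin n)

/-! ### A weighted Jensen inequality -/

/-- Hölder's inequality for the factorisation $wh=(wh^q)^{1/q}\,w^{1-1/q}$. The weight is not
normalised, so that cube averages and convolution kernels are covered alike. -/
theorem rpow_lintegral_mul_le {X : Type*} [MeasurableSpace X] {μ : Measure X} {q : ℝ}
    (hq : 1 ≤ q) {w h : X → ℝ≥0∞} (hw : AEMeasurable w μ) (hh : AEMeasurable h μ) :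
    (∫⁻ x, w x * h x ∂μ) ^ q ≤ (∫⁻ x, w x ∂μ) ^ (q - 1) * ∫⁻ x, w x * h x ^ q ∂μ := by
  have hq0 : 0 < q := by linarith
  have h1 : (∫⁻ x, w x * h x ∂μ)
      ≤ (∫⁻ x, w x * h x ^ q ∂μ) ^ (1 / q) * (∫⁻ x, w x ∂μ) ^ (1 - 1 / q) := by
    have hle : 1 / q ≤ 1 := by rw [div_le_one hq0]; exact hq
    have := ENNReal.lintegral_mul_norm_pow_le (μ := μ) (f := fun x => w x * h x ^ q) (g := w)
      (hw.mul (hh.pow_const q)) hw (p := 1 / q) (q := 1 - 1 / q) (by positivity)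
      (by linarith) (by ring)
    refine le_trans (le_of_eq ?_) this
    refine lintegral_congr fun x => ?_
    rw [ENNReal.mul_rpow_of_nonneg _ _ (by positivity), ← ENNReal.rpow_mul,
      mul_one_div_cancel hq0.ne', ENNReal.rpow_one, mul_right_comm,
      ← ENNReal.rpow_add_of_nonneg _ _ (by positivity) (by linarith)]
    simp
  calc (∫⁻ x, w x * h x ∂μ) ^ q
      ≤ ((∫⁻ x, w x * h x ^ q ∂μ) ^ (1 / q) * (∫⁻ x, w x ∂μ) ^ (1 - 1 / q)) ^ q := by gcongr
    _ = _ := by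
        rw [ENNReal.mul_rpow_of_nonneg _ _ hq0.le, ← ENNReal.rpow_mul, ← ENNReal.rpow_mul,
          one_div_mul_cancel hq0.ne', ENNReal.rpow_one, mul_comm]
        congr 2
        field_simp

/-! ### Grid cubes -/

variable {n : ℕ}

/-- The cube of side `ℓ` of the grid `ℓ ℤⁿ` that contains `x`. -/
def gridCube (ℓ : ℝ) (x : Euc n) : Set (Euc n) := {z | ∀ i, ⌊z i / ℓ⌋ = ⌊x i / ℓ⌋}

theorem mem_gridCube {ℓ : ℝ} {x z : Euc n} : z ∈ gridCube ℓ x ↔ ∀ i, ⌊z i / ℓ⌋ = ⌊x i / ℓ⌋ :=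
  Iff.rfl

theorem mem_gridCube_comm {ℓ : ℝ} {x z : Euc n} : z ∈ gridCube ℓ x ↔ x ∈ gridCube ℓ z := by
  simp only [mem_gridCube, eq_comm]

theorem gridCube_eq_of_mem {ℓ : ℝ} {x z : Euc n} (h : z ∈ gridCube ℓ x) :
    gridCube ℓ z = gridCube ℓ x := by
  ext w
  simp only [mem_gridCube] at *
  simp [h]

theorem measurableSet_gridCube_prod (ℓ : ℝ) :
    MeasurableSet {p : Euc n × Euc n | p.2 ∈ gridCube ℓ p.1} := by
  simp only [mem_gridCube, ofPred_forall]
  refine MeasurableSet.iInter fun i => ?_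
  refine measurableSet_eq_fun ?_ ?_ <;> fun_prop

theorem measurableSet_gridCube (ℓ : ℝ) (x : Euc n) : MeasurableSet (gridCube ℓ x) :=
  measurable_prodMk_left (measurableSet_gridCube_prod ℓ)

theorem volume_box (s : Fin n → Set ℝ) :
    volume {z : Euc n | ∀ i, z i ∈ s i} = ∏ i, volume (s i) := by
  have h : {z : Euc n | ∀ i, z i ∈ s i}
      = (MeasurableEquiv.toLp 2 (Fin n → ℝ)).symm ⁻¹' (univ.pi s) := by
    ext z
    simp
  have hp := EuclideanSpace.volume_preserving_symm_measurableEquiv_toLp (Fin n)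
  rw [h, ← volume_pi_pi]
  exact hp.measure_preimage_equiv (univ.pi s)

theorem floor_div_eq_iff {ℓ : ℝ} (hℓ : 0 < ℓ) {t : ℝ} {k : ℤ} :
    ⌊t / ℓ⌋ = k ↔ t ∈ Ico (k * ℓ) ((k + 1) * ℓ) := by
  rw [Int.floor_eq_iff, le_div_iff₀ hℓ, div_lt_iff₀ hℓ, mem_Ico]

theorem volume_gridCube {ℓ : ℝ} (hℓ : 0 < ℓ) (x : Euc n) :
    volume (gridCube ℓ x) = ENNReal.ofReal ℓ ^ n := by
  have : gridCube ℓ x = {z : Euc n | ∀ i, z i ∈ Ico (⌊x i / ℓ⌋ * ℓ) ((⌊x i / ℓ⌋ + 1) * ℓ)} := by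
    ext z
    simp only [mem_gridCube, floor_div_eq_iff hℓ, mem_ofPred_eq]
  rw [this, volume_box]
  simp [Real.volume_Ico, add_mul]

/-- Halving is compatible with the floor, $\lfloor t/2\rfloor=\lfloor\lfloor t\rfloor/2\rfloor$.
This nesting makes the averages over sides $2^k$ a martingale. -/
theorem gridCube_subset_two_mul {ℓ : ℝ} (x : Euc n) :
    gridCube ℓ x ⊆ gridCube (2 * ℓ) x := by
  intro z hz i
  have h (t : ℝ) : ⌊t / (2 * ℓ)⌋ = ⌊t / ℓ⌋ / 2 := by
    have := Int.floor_div_natCast (t / ℓ) 2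
    rw [← Nat.cast_ofNat (R := ℤ), ← this, mul_comm, ← div_div]
    simp
  rw [h, h, hz i]

/-! ### Averages over grid cubes -/

/-- The average of `f` over the grid cube of side `ℓ` containing the point. -/
def gridAvg (ℓ : ℝ) (f : Euc n → ℂ) (x : Euc n) : ℂ :=
  (((ℓ ^ n)⁻¹ : ℝ) : ℂ) * ∫ z in gridCube ℓ x, f z

/-- The average of a nonnegative function over the grid cube of side `ℓ` containing the point. -/
def gridLavg (ℓ : ℝ) (h : Euc n → ℝ≥0∞) (x : Euc n) : ℝ≥0∞ :=
  (ENNReal.ofReal ℓ ^ n)⁻¹ * ∫⁻ z in gridCube ℓ x, h z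

theorem gridAvg_eq_of_mem {ℓ : ℝ} {x z : Euc n} (f : Euc n → ℂ) (h : z ∈ gridCube ℓ x) :
    gridAvg ℓ f z = gridAvg ℓ f x := by
  rw [gridAvg, gridAvg, gridCube_eq_of_mem h]

theorem integral_gridCube_eq (ℓ : ℝ) (f : Euc n → ℂ) (x : Euc n) :
    ∫ z in gridCube ℓ x, f z
      = ∫ z, {p : Euc n × Euc n | p.2 ∈ gridCube ℓ p.1}.indicator (fun p => f p.2) (x, z) := by
  rw [← integral_indicator (measurableSet_gridCube ℓ x)]
  rfl

theorem lintegral_gridCube_eq (ℓ : ℝ) (h : Euc n → ℝ≥0∞) (x : Euc n) :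
    ∫⁻ z in gridCube ℓ x, h z
      = ∫⁻ z, {p : Euc n × Euc n | p.2 ∈ gridCube ℓ p.1}.indicator (fun p => h p.2) (x, z) := by
  rw [← lintegral_indicator (measurableSet_gridCube ℓ x)]
  rfl

theorem measurable_gridAvg (ℓ : ℝ) {f : Euc n → ℂ} (hf : Measurable f) :
    Measurable (gridAvg ℓ f) := by
  refine measurable_const.mul ?_
  simp_rw [integral_gridCube_eq]
  refine StronglyMeasurable.measurable ?_
  refine StronglyMeasurable.integral_prod_right (f := fun x z => {p : Euc n × Euc n | p.2 ∈ gridCube ℓ p.1}.indicator (fun p => f p.2) (x, z)) ?_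
  exact ((hf.comp measurable_snd).indicator (measurableSet_gridCube_prod ℓ)).stronglyMeasurable

theorem measurable_gridLavg (ℓ : ℝ) {h : Euc n → ℝ≥0∞} (hh : Measurable h) :
    Measurable (gridLavg ℓ h) := by
  refine measurable_const.mul ?_
  simp_rw [lintegral_gridCube_eq]
  exact ((hh.comp measurable_snd).indicator (measurableSet_gridCube_prod ℓ)).lintegral_prod_right'

theorem volume_gridCube_ne_zero {ℓ : ℝ} (hℓ : 0 < ℓ) : ENNReal.ofReal ℓ ^ n ≠ 0 :=
  pow_ne_zero _ (by simpa using hℓ)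

theorem volume_gridCube_ne_top (ℓ : ℝ) : ENNReal.ofReal ℓ ^ n ≠ ∞ :=
  ENNReal.pow_ne_top ENNReal.ofReal_ne_top

/-- Lying in a common cube is a symmetric relation, so by Tonelli each point is counted with total
weight $\ell^{-n}\ell^n=1$. -/
theorem lintegral_gridLavg {ℓ : ℝ} (hℓ : 0 < ℓ) {h : Euc n → ℝ≥0∞} (hh : Measurable h) :
    ∫⁻ x, gridLavg ℓ h x = ∫⁻ x, h x := by
  have hm : Measurable fun x : Euc n => ∫⁻ z in gridCube ℓ x, h z := by
    simp_rw [lintegral_gridCube_eq]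
    exact ((hh.comp measurable_snd).indicator
      (measurableSet_gridCube_prod ℓ)).lintegral_prod_right'
  simp only [gridLavg]
  rw [lintegral_const_mul _ hm]
  simp_rw [lintegral_gridCube_eq]
  rw [lintegral_lintegral_swap (f := fun x z => {p : Euc n × Euc n | p.2 ∈ gridCube ℓ p.1}.indicator
    (fun p => h p.2) (x, z)) ((hh.comp measurable_snd).indicator (measurableSet_gridCube_prod ℓ)).aemeasurable]
  have (y : Euc n) : ∫⁻ x, {p : Euc n × Euc n | p.2 ∈ gridCube ℓ p.1}.indicator
      (fun p => h p.2) (x, y) = ENNReal.ofReal ℓ ^ n * h y := by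
    rw [← volume_gridCube hℓ y, mul_comm, ← setLIntegral_const,
      ← lintegral_indicator (measurableSet_gridCube ℓ y)]
    refine lintegral_congr fun x => ?_
    simp only [indicator, mem_ofPred_eq]
    exact @if_congr _ _ _ (_) (_) _ _ _ _ mem_gridCube_comm rfl rfl
  simp_rw [this]
  rw [lintegral_const_mul _ hh, ← mul_assoc, ENNReal.inv_mul_cancel
    (volume_gridCube_ne_zero hℓ) (volume_gridCube_ne_top ℓ), one_mul]

theorem gridLavg_rpow_le {ℓ : ℝ} (hℓ : 0 < ℓ) {q : ℝ} (hq : 1 ≤ q) {h : Euc n → ℝ≥0∞}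
    (hh : Measurable h) (x : Euc n) :
    gridLavg ℓ h x ^ q ≤ gridLavg ℓ (fun z => h z ^ q) x := by
  have := rpow_lintegral_mul_le (μ := volume.restrict (gridCube ℓ x)) hq
    (w := fun _ => (ENNReal.ofReal ℓ ^ n)⁻¹) (h := h) aemeasurable_const hh.aemeasurable
  rw [lintegral_const_mul _ hh, lintegral_const_mul _ (hh.pow_const q), lintegral_const,
    Measure.restrict_apply_univ, volume_gridCube hℓ, ENNReal.inv_mul_cancel
    (volume_gridCube_ne_zero hℓ) (volume_gridCube_ne_top ℓ), ENNReal.one_rpow, one_mul] at this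
  exact this

theorem enorm_gridAvg_le {ℓ : ℝ} (hℓ : 0 < ℓ) (f : Euc n → ℂ) (x : Euc n) :
    ‖gridAvg ℓ f x‖ₑ ≤ gridLavg ℓ (fun z => ‖f z‖ₑ) x := by
  rw [gridAvg, gridLavg, enorm_mul]
  gcongr
  · rw [← ofReal_norm, Complex.norm_real, Real.norm_of_nonneg (by positivity),
      ENNReal.ofReal_inv_of_pos (by positivity), ENNReal.ofReal_pow hℓ.le]
  · exact enorm_integral_le_lintegral_enorm _

theorem lintegral_enorm_gridAvg_rpow_le {ℓ : ℝ} (hℓ : 0 < ℓ) {q : ℝ} (hq : 1 ≤ q)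
    {f : Euc n → ℂ} (hf : Measurable f) :
    ∫⁻ x, ‖gridAvg ℓ f x‖ₑ ^ q ≤ ∫⁻ x, ‖f x‖ₑ ^ q := by
  rw [← lintegral_gridLavg hℓ (hf.enorm.pow_const q)]
  refine lintegral_mono fun x => ?_
  refine le_trans ?_ (gridLavg_rpow_le hℓ hq hf.enorm x)
  gcongr
  exact enorm_gridAvg_le hℓ f x

theorem integrableOn_gridCube {ℓ : ℝ} (hℓ : 0 < ℓ) {p : ℝ≥0∞} (hp : 1 ≤ p) {f : Euc n → ℂ}
    (hf : MemLp f p) (x : Euc n) : IntegrableOn f (gridCube ℓ x) := by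
  have : IsFiniteMeasure (volume.restrict (gridCube ℓ x)) :=
    ⟨by rw [Measure.restrict_apply_univ, volume_gridCube hℓ]
        exact (volume_gridCube_ne_top ℓ).lt_top⟩
  exact (hf.restrict (gridCube ℓ x)).integrable hp

theorem gridAvg_add {ℓ : ℝ} (hℓ : 0 < ℓ) {p : ℝ≥0∞} (hp : 1 ≤ p) {f g : Euc n → ℂ}
    (hf : MemLp f p) (hg : MemLp g p) (x : Euc n) :
    gridAvg ℓ (fun y => f y + g y) x = gridAvg ℓ f x + gridAvg ℓ g x := by
  rw [gridAvg, integral_add (integrableOn_gridCube hℓ hp hf x) (integrableOn_gridCube hℓ hp hg x),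
    mul_add]
  rfl

theorem gridAvg_sub {ℓ : ℝ} (hℓ : 0 < ℓ) {p : ℝ≥0∞} (hp : 1 ≤ p) {f g : Euc n → ℂ}
    (hf : MemLp f p) (hg : MemLp g p) (x : Euc n) :
    gridAvg ℓ (fun y => f y - g y) x = gridAvg ℓ f x - gridAvg ℓ g x := by
  rw [gridAvg, integral_sub (integrableOn_gridCube hℓ hp hf x) (integrableOn_gridCube hℓ hp hg x),
    mul_sub]
  rfl

theorem gridAvg_const_mul (ℓ : ℝ) (c : ℂ) (f : Euc n → ℂ) (x : Euc n) :
    gridAvg ℓ (fun y => c * f y) x = c * gridAvg ℓ f x := by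
  rw [gridAvg, integral_const_mul, gridAvg]
  ring

/-- The tower property of averages over nested grids. -/
theorem gridAvg_gridAvg {a b : ℝ} (ha : 0 < a) (hb : 0 < b)
    (hab : ∀ x : Euc n, gridCube a x ⊆ gridCube b x) {p : ℝ≥0∞} (hp : 1 ≤ p)
    {f : Euc n → ℂ} (hf : MemLp f p) (x : Euc n) :
    gridAvg b (gridAvg a f) x = gridAvg b f x := by
  -- Everything happens inside one large cube, which has finite measure and on which `f` is
  -- integrable; this makes Fubini available.
  set ν := volume.restrict (gridCube b x) with hν
  have : IsFiniteMeasure ν :=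
    ⟨by rw [Measure.restrict_apply_univ, volume_gridCube hb]
        exact (volume_gridCube_ne_top b).lt_top⟩
  set F : Euc n → Euc n → ℂ := fun z w =>
    {p : Euc n × Euc n | p.2 ∈ gridCube a p.1}.indicator (fun p => f p.2) (z, w) with hF
  have hint : Integrable f ν := integrableOn_gridCube hb hp hf x
  have hFint : Integrable (Function.uncurry F) (ν.prod ν) :=
    (hint.comp_snd ν).indicator (measurableSet_gridCube_prod a)
  have h1 : ∫ z, gridAvg a f z ∂ν = (((a ^ n)⁻¹ : ℝ) : ℂ) * ∫ z, ∫ w, F z w ∂ν ∂ν := by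
    rw [← integral_const_mul]
    refine setIntegral_congr_fun (measurableSet_gridCube b x) fun z hz => ?_
    have hsub : gridCube a z ⊆ gridCube b x := (hab z).trans (gridCube_eq_of_mem hz).subset
    simp only [gridAvg]
    congr 1
    calc ∫ w in gridCube a z, f w = ∫ w in gridCube b x ∩ gridCube a z, f w := by
          rw [inter_eq_right.2 hsub]
      _ = ∫ w in gridCube b x, (gridCube a z).indicator f w := by
          rw [setIntegral_indicator (measurableSet_gridCube a z)]
      _ = _ := rfl
  have h2 : ∫ z, ∫ w, F z w ∂ν ∂ν = ((a ^ n : ℝ) : ℂ) * ∫ w, f w ∂ν := by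
    rw [integral_integral_swap hFint, ← integral_const_mul]
    refine setIntegral_congr_fun (measurableSet_gridCube b x) fun w hw => ?_
    have hsub : gridCube a w ⊆ gridCube b x := (hab w).trans (gridCube_eq_of_mem hw).subset
    have h3 : ∀ z, F z w = (gridCube a w).indicator (fun _ => f w) z := by
      intro z
      simp only [hF, indicator, mem_ofPred_eq]
      exact @if_congr _ _ _ (_) (_) _ _ _ _ mem_gridCube_comm rfl rfl
    simp only [h3]
    rw [hν, setIntegral_indicator (measurableSet_gridCube a w), inter_eq_right.2 hsub,
      setIntegral_const, Measure.real, volume_gridCube ha]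
    simp [ha.le]
  have hne : (((a ^ n : ℝ)) : ℂ) ≠ 0 := by exact_mod_cast (pow_pos ha n).ne'
  change (((b ^ n)⁻¹ : ℝ) : ℂ) * ∫ z, gridAvg a f z ∂ν = _
  rw [h1, h2, ← mul_assoc (((a ^ n)⁻¹ : ℝ) : ℂ), ← Complex.ofReal_mul,
    inv_mul_cancel₀ (pow_pos ha n).ne', Complex.ofReal_one, one_mul]
  rfl

/-! ### Uniform convexity -/

/-- Since $q<2$, the second derivative $q(q-1)r^{q-2}$ is at least its value at $R$ on all of
$(0,R)$, so a quadratic with that second derivative can be subtracted without losing convexity. -/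
theorem convexOn_rpow_sub_sq {q R : ℝ} (hq₁ : 1 < q) (hq₂ : q < 2) :
    ConvexOn ℝ (Icc 0 R) (fun r : ℝ => r ^ q - q * (q - 1) / 2 * R ^ (q - 2) * r ^ 2) := by
  refine convexOn_of_hasDerivWithinAt2_nonneg (convex_Icc 0 R)
    (f' := fun r => q * r ^ (q - 1) - q * (q - 1) / 2 * R ^ (q - 2) * (2 * r))
    (f'' := fun r => q * ((q - 1) * r ^ (q - 2)) - q * (q - 1) / 2 * R ^ (q - 2) * 2) ?_ ?_ ?_ ?_
  · refine ContinuousOn.sub ?_ (by fun_prop)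
    exact (Real.continuous_rpow_const (by linarith)).continuousOn
  · intro x hx
    rw [interior_Icc] at hx
    have h1 := Real.hasDerivAt_rpow_const (x := x) (p := q) (Or.inl hx.1.ne')
    have h2 := (hasDerivAt_pow 2 x).const_mul (q * (q - 1) / 2 * R ^ (q - 2))
    refine (h1.sub h2).hasDerivWithinAt.congr_deriv ?_
    simp
  · intro x hx
    rw [interior_Icc] at hx
    have h1 := (Real.hasDerivAt_rpow_const (x := x) (p := q - 1) (Or.inl hx.1.ne')).const_mul q
    have h2 := ((hasDerivAt_id x).const_mul 2).const_mul (q * (q - 1) / 2 * R ^ (q - 2))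
    refine (h1.sub h2).hasDerivWithinAt.congr_deriv ?_
    rw [show q - 1 - 1 = q - 2 by ring]
    simp
  · intro x hx
    rw [interior_Icc] at hx
    have h : R ^ (q - 2) ≤ x ^ (q - 2) :=
      Real.rpow_le_rpow_of_nonpos hx.1 hx.2.le (by linarith)
    have h3 : 0 ≤ q * (q - 1) := mul_nonneg (by linarith) (by linarith)
    nlinarith [mul_le_mul_of_nonneg_left h h3]

/-- Convexity handles the midpoint of the moduli, whereas the modulus of the midpoint may be
smaller; monotonicity bridges the two. -/
theorem monotoneOn_rpow_sub_sq {q R : ℝ} (hq₁ : 1 < q) (hq₂ : q < 2) :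
    MonotoneOn (fun r : ℝ => r ^ q - q * (q - 1) / 2 * R ^ (q - 2) * r ^ 2) (Icc 0 R) := by
  refine monotoneOn_of_hasDerivWithinAt_nonneg (convex_Icc 0 R)
    (f' := fun r => q * r ^ (q - 1) - q * (q - 1) / 2 * R ^ (q - 2) * (2 * r)) ?_ ?_ ?_
  · refine ContinuousOn.sub ?_ (by fun_prop)
    exact (Real.continuous_rpow_const (by linarith)).continuousOn
  · intro x hx
    rw [interior_Icc] at hx
    have h1 := Real.hasDerivAt_rpow_const (x := x) (p := q) (Or.inl hx.1.ne')
    have h2 := (hasDerivAt_pow 2 x).const_mul (q * (q - 1) / 2 * R ^ (q - 2))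
    refine (h1.sub h2).hasDerivWithinAt.congr_deriv ?_
    simp
  · intro x hx
    rw [interior_Icc] at hx
    have h : R ^ (q - 2) ≤ x ^ (q - 2) :=
      Real.rpow_le_rpow_of_nonpos hx.1 hx.2.le (by linarith)
    have h2 : x ^ (q - 1) = x ^ (q - 2) * x := by
      rw [← Real.rpow_add_one hx.1.ne']
      congr 1
      ring
    have h3 : R ^ (q - 2) * x ≤ x ^ (q - 1) := by
      rw [h2]
      exact mul_le_mul_of_nonneg_right h hx.1.le
    have h5 : 0 ≤ x ^ (q - 1) := Real.rpow_nonneg hx.1.le _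
    have h6 : (q - 1) * (R ^ (q - 2) * x) ≤ x ^ (q - 1) := by
      have := mul_le_mul_of_nonneg_left h3 (by linarith : 0 ≤ q - 1)
      nlinarith
    have h7 := mul_le_mul_of_nonneg_left h6 (by linarith : 0 ≤ q)
    linarith

/-- Uniform convexity of `|·| ^ q` for `1 < q < 2`. -/
theorem norm_midpoint_rpow_add_le {q : ℝ} (hq₁ : 1 < q) (hq₂ : q < 2) (a b : ℂ) :
    ‖(a + b) / 2‖ ^ q + q * (q - 1) / 8 * (‖a - b‖ ^ 2 * (‖a‖ + ‖b‖) ^ (q - 2))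
      ≤ (‖a‖ ^ q + ‖b‖ ^ q) / 2 := by
  set R := ‖a‖ + ‖b‖ with hR
  have ha := norm_nonneg a
  have hb := norm_nonneg b
  have h2 : ‖(a + b) / 2‖ ≤ (‖a‖ + ‖b‖) / 2 := by
    rw [norm_div]
    simpa using div_le_div_of_nonneg_right (norm_add_le a b) (by norm_num : (0 : ℝ) ≤ 2)
  have hmono := monotoneOn_rpow_sub_sq (R := R) hq₁ hq₂ (a := ‖(a + b) / 2‖)
    (b := (‖a‖ + ‖b‖) / 2) ⟨norm_nonneg _, by linarith⟩ ⟨by linarith, by linarith⟩ h2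
  obtain ⟨-, hcv⟩ := convexOn_rpow_sub_sq (R := R) hq₁ hq₂
  have hconv := hcv (show ‖a‖ ∈ Icc 0 R from ⟨ha, by linarith⟩)
    (show ‖b‖ ∈ Icc 0 R from ⟨hb, by linarith⟩) (by norm_num : (0 : ℝ) ≤ 1 / 2)
    (by norm_num : (0 : ℝ) ≤ 1 / 2) (by norm_num)
  -- The parallelogram law turns the subtracted squares into the gain: the coefficient
  -- $\tfrac{q(q-1)}2$ times $\tfrac14$ is the $\tfrac{q(q-1)}8$ of the statement.
  have hpar : ‖(a + b) / 2‖ ^ 2 = (‖a‖ ^ 2 + ‖b‖ ^ 2) / 2 - ‖a - b‖ ^ 2 / 4 := by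
    have h := parallelogram_law_with_norm ℝ a b
    rw [norm_div, div_pow]
    simp only [Complex.norm_ofNat]
    linarith
  simp only [smul_eq_mul] at hmono hconv
  rw [show 1 / 2 * ‖a‖ + 1 / 2 * ‖b‖ = (‖a‖ + ‖b‖) / 2 by ring] at hconv
  have h := hmono.trans hconv
  rw [hpar] at h
  linarith

/-! ### Integrals of powers and `L^q` norms -/

theorem eLpNorm_ofReal_eq {X : Type*} [MeasurableSpace X] {μ : Measure X} {F : Type*}
    [NormedAddCommGroup F] {q : ℝ} (hq : 0 < q) (f : X → F) :
    eLpNorm f (ENNReal.ofReal q) μ = (∫⁻ x, ‖f x‖ₑ ^ q ∂μ) ^ (1 / q) := by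
  rw [eLpNorm_eq_lintegral_rpow_enorm_toReal (by simpa using hq) ENNReal.ofReal_ne_top,
    ENNReal.toReal_ofReal hq.le]

theorem eLpNorm_ofReal_rpow {X : Type*} [MeasurableSpace X] {μ : Measure X} {F : Type*}
    [NormedAddCommGroup F] {q : ℝ} (hq : 0 < q) (f : X → F) :
    eLpNorm f (ENNReal.ofReal q) μ ^ q = ∫⁻ x, ‖f x‖ₑ ^ q ∂μ := by
  rw [eLpNorm_ofReal_eq hq, ← ENNReal.rpow_mul, one_div_mul_cancel hq.ne', ENNReal.rpow_one]

/-! ### The square function of the grid averages -/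

/-- Prepares Hölder's inequality with exponents $2/q$ and $2/(2-q)$: the first factor carries the
convexity gain, and the powers of $\|a\|+\|b\|$ cancel because $(q-2)\tfrac q2+q(1-\tfrac q2)=0$.
The case $a=b=0$ is separate because $q-2$ is negative. -/
theorem ofReal_sq_mul_rpow_rpow {q : ℝ} (hq₁ : 1 < q) (hq₂ : q < 2) (a b : ℂ) :
    ‖a - b‖ₑ ^ q = ENNReal.ofReal (‖a - b‖ ^ 2 * (‖a‖ + ‖b‖) ^ (q - 2)) ^ (q / 2)
      * ((‖a‖ₑ + ‖b‖ₑ) ^ q) ^ (1 - q / 2) := by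
  have hR : ‖a‖ₑ + ‖b‖ₑ = ENNReal.ofReal (‖a‖ + ‖b‖) := by
    rw [ENNReal.ofReal_add (norm_nonneg _) (norm_nonneg _), ofReal_norm, ofReal_norm]
  have hq2 : 0 ≤ 1 - q / 2 := by linarith
  have hd : ‖a - b‖ ≤ ‖a‖ + ‖b‖ := norm_sub_le a b
  rcases (add_nonneg (norm_nonneg a) (norm_nonneg b)).eq_or_lt with h | h
  · have : ‖a - b‖ = 0 := le_antisymm (by linarith) (norm_nonneg _)
    have h0 : ‖a - b‖ₑ = 0 := by rw [← ofReal_norm, this, ENNReal.ofReal_zero]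
    rw [h0, this]
    simp [ENNReal.zero_rpow_of_pos (by linarith : 0 < q),
      ENNReal.zero_rpow_of_pos (by linarith : 0 < q / 2)]
  · rw [hR, ← ofReal_norm, ENNReal.ofReal_rpow_of_nonneg (norm_nonneg _) (by linarith),
      ENNReal.ofReal_rpow_of_nonneg (by positivity) (by linarith),
      ENNReal.ofReal_rpow_of_nonneg (by positivity) (by linarith),
      ENNReal.ofReal_rpow_of_nonneg (by positivity) (by linarith),
      ← ENNReal.ofReal_mul (by positivity)]
    congr 1
    rw [Real.mul_rpow (by positivity) (by positivity), ← Real.rpow_natCast, ← Real.rpow_mul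
      (norm_nonneg _), ← Real.rpow_mul h.le, ← Real.rpow_mul h.le, mul_assoc,
      ← Real.rpow_add h]
    rw [show (q - 2) * (q / 2) + q * (1 - q / 2) = 0 by ring, Real.rpow_zero, mul_one]
    congr 1
    push_cast
    ring

theorem lintegral_rpow_midpoint_add_le {q : ℝ} (hq₁ : 1 < q) (hq₂ : q < 2) {a b : Euc n → ℂ}
    (ha : Measurable a) (hb : Measurable b) :
    2 * (∫⁻ x, ‖(a x + b x) / 2‖ₑ ^ q) + ENNReal.ofReal (q * (q - 1) / 4) *
      (∫⁻ x, ENNReal.ofReal (‖a x - b x‖ ^ 2 * (‖a x‖ + ‖b x‖) ^ (q - 2)))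
      ≤ (∫⁻ x, ‖a x‖ₑ ^ q) + ∫⁻ x, ‖b x‖ₑ ^ q := by
  have hc : 0 ≤ q * (q - 1) := mul_nonneg (by linarith) (by linarith)
  have hW : Measurable fun x =>
      ENNReal.ofReal (‖a x - b x‖ ^ 2 * (‖a x‖ + ‖b x‖) ^ (q - 2)) := by fun_prop
  rw [← lintegral_const_mul _ hW, ← lintegral_const_mul _ (by fun_prop),
    ← lintegral_add_left (by fun_prop), ← lintegral_add_left (by fun_prop)]
  refine lintegral_mono fun x => ?_
  have h := norm_midpoint_rpow_add_le hq₁ hq₂ (a x) (b x)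
  simp only [← ofReal_norm]
  rw [ENNReal.ofReal_rpow_of_nonneg (norm_nonneg _) (by linarith),
    ENNReal.ofReal_rpow_of_nonneg (norm_nonneg _) (by linarith),
    ENNReal.ofReal_rpow_of_nonneg (norm_nonneg _) (by linarith),
    ← ENNReal.ofReal_mul (by linarith), ← ENNReal.ofReal_add (by positivity) (by positivity),
    ← ENNReal.ofReal_ofNat 2, ← ENNReal.ofReal_mul (by norm_num), ← ENNReal.ofReal_add
    (by positivity) (mul_nonneg (by linarith) (by positivity))]
  refine ENNReal.ofReal_le_ofReal ?_
  linarith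

theorem eLpNorm_gridAvg_le {ℓ : ℝ} (hℓ : 0 < ℓ) {q : ℝ} (hq : 1 ≤ q)
    {f : Euc n → ℂ} (hf : Measurable f) :
    eLpNorm (gridAvg ℓ f) (ENNReal.ofReal q) volume ≤ eLpNorm f (ENNReal.ofReal q) volume := by
  rw [eLpNorm_ofReal_eq (by linarith), eLpNorm_ofReal_eq (by linarith)]
  refine ENNReal.rpow_le_rpow ?_ (by positivity)
  exact lintegral_enorm_gridAvg_rpow_le hℓ hq hf

theorem memLp_gridAvg {ℓ : ℝ} (hℓ : 0 < ℓ) {q : ℝ} (hq : 1 ≤ q)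
    {f : Euc n → ℂ} (hf : Measurable f) (hfq : MemLp f (ENNReal.ofReal q)) :
    MemLp (gridAvg ℓ f) (ENNReal.ofReal q) :=
  ⟨(measurable_gridAvg ℓ hf).aestronglyMeasurable,
    (eLpNorm_gridAvg_le hℓ hq hf).trans_lt hfq.2⟩

/-- The energy gained when passing from the grid average of side `2 ℓ` to that of side `ℓ`. -/
theorem energy_gridAvg_add_le {q : ℝ} (hq₁ : 1 < q) (hq₂ : q < 2) {ℓ : ℝ} (hℓ : 0 < ℓ)
    {f : Euc n → ℂ} (hf : Measurable f) (hfq : MemLp f (ENNReal.ofReal q)) :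
    ENNReal.ofReal (q * (q - 1) / 4) * (∫⁻ x, ENNReal.ofReal
        (‖gridAvg ℓ f x - gridAvg (2 * ℓ) f x‖ ^ 2 *
          (‖gridAvg ℓ f x‖ + ‖gridAvg (2 * ℓ) f x‖) ^ (q - 2)))
      + ∫⁻ x, ‖gridAvg (2 * ℓ) f x‖ₑ ^ q ≤ ∫⁻ x, ‖gridAvg ℓ f x‖ₑ ^ q := by
  have h2ℓ : 0 < 2 * ℓ := by linarith
  have hq1 : 1 ≤ ENNReal.ofReal q := by simpa using hq₁.le
  have ha := measurable_gridAvg ℓ hf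
  have hb := measurable_gridAvg (2 * ℓ) hf
  have haL := memLp_gridAvg hℓ hq₁.le hf hfq
  have hbL := memLp_gridAvg h2ℓ hq₁.le hf hfq
  have h := lintegral_rpow_midpoint_add_le hq₁ hq₂ ha hb
  -- Coarse averaging maps the fine average to the coarse one and fixes the coarse one, hence maps
  -- their midpoint to the coarse average. As it contracts $L^q$, the midpoint has at least the
  -- coarse energy, one copy of which can then be cancelled.
  have hmid (x : Euc n) : gridAvg (2 * ℓ) (fun y => (1 / 2 : ℂ) *
      (gridAvg ℓ f y + gridAvg (2 * ℓ) f y)) x = gridAvg (2 * ℓ) f x := by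
    rw [gridAvg_const_mul, gridAvg_add h2ℓ hq1 haL hbL,
      gridAvg_gridAvg hℓ h2ℓ gridCube_subset_two_mul hq1 hfq,
      gridAvg_gridAvg h2ℓ h2ℓ (fun _ => subset_rfl) hq1 hfq]
    ring
  have hcontr := lintegral_enorm_gridAvg_rpow_le h2ℓ hq₁.le (f := fun y => (1 / 2 : ℂ) *
      (gridAvg ℓ f y + gridAvg (2 * ℓ) f y)) (by fun_prop)
  simp_rw [hmid] at hcontr
  simp_rw [show ∀ z : ℂ, 1 / 2 * z = z / 2 from fun z => by ring] at hcontr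
  have hfin : ∫⁻ x, ‖gridAvg (2 * ℓ) f x‖ₑ ^ q ≠ ∞ := by
    rw [← eLpNorm_ofReal_rpow (by linarith)]
    exact ENNReal.rpow_ne_top_of_nonneg (by linarith) hbL.2.ne
  refine (ENNReal.add_le_add_iff_right hfin).1 ?_
  refine le_trans ?_ h
  rw [add_assoc, ← two_mul, add_comm]
  gcongr

/-- Hölder converts the weighted quadratic gain into a squared $L^q$ norm; the complementary factor
is a power of the norm of the sum of two averages, each bounded by $f$. -/
theorem eLpNorm_gridAvg_sub_sq_le {q : ℝ} (hq₁ : 1 < q) (hq₂ : q < 2) {ℓ : ℝ} (hℓ : 0 < ℓ)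
    {f : Euc n → ℂ} (hf : Measurable f) :
    eLpNorm (fun x => gridAvg ℓ f x - gridAvg (2 * ℓ) f x) (ENNReal.ofReal q) volume ^ 2
      ≤ (∫⁻ x, ENNReal.ofReal (‖gridAvg ℓ f x - gridAvg (2 * ℓ) f x‖ ^ 2 *
          (‖gridAvg ℓ f x‖ + ‖gridAvg (2 * ℓ) f x‖) ^ (q - 2)))
        * (2 * eLpNorm f (ENNReal.ofReal q) volume) ^ (2 - q) := by
  have hq0 : 0 < q := by linarith
  have ha := measurable_gridAvg ℓ hf
  have hb := measurable_gridAvg (2 * ℓ) hf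
  set W := ∫⁻ x, ENNReal.ofReal (‖gridAvg ℓ f x - gridAvg (2 * ℓ) f x‖ ^ 2 *
          (‖gridAvg ℓ f x‖ + ‖gridAvg (2 * ℓ) f x‖) ^ (q - 2)) with hW
  have h1 : ∫⁻ x, ‖gridAvg ℓ f x - gridAvg (2 * ℓ) f x‖ₑ ^ q
      ≤ W ^ (q / 2) * (∫⁻ x, (‖gridAvg ℓ f x‖ₑ + ‖gridAvg (2 * ℓ) f x‖ₑ) ^ q) ^ (1 - q / 2) := by
    simp_rw [ofReal_sq_mul_rpow_rpow hq₁ hq₂]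
    exact ENNReal.lintegral_mul_norm_pow_le (by fun_prop) (by fun_prop) (by linarith)
      (by linarith) (by ring)
  have h2 : ∫⁻ x, (‖gridAvg ℓ f x‖ₑ + ‖gridAvg (2 * ℓ) f x‖ₑ) ^ q
      ≤ (2 * eLpNorm f (ENNReal.ofReal q) volume) ^ q := by
    have h3 := ENNReal.lintegral_Lp_add_le (μ := volume) ha.enorm.aemeasurable
      hb.enorm.aemeasurable hq₁.le
    rw [← eLpNorm_ofReal_eq hq0, ← eLpNorm_ofReal_eq hq0] at h3
    have h4 := h3.trans (add_le_add (eLpNorm_gridAvg_le hℓ hq₁.le hf)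
      (eLpNorm_gridAvg_le (by linarith : 0 < 2 * ℓ) hq₁.le hf))
    rw [← two_mul] at h4
    have h5 := ENNReal.rpow_le_rpow h4 hq0.le
    rw [← ENNReal.rpow_mul, one_div_mul_cancel hq0.ne', ENNReal.rpow_one] at h5
    exact h5
  calc eLpNorm (fun x => gridAvg ℓ f x - gridAvg (2 * ℓ) f x) (ENNReal.ofReal q) volume ^ 2
      = (∫⁻ x, ‖gridAvg ℓ f x - gridAvg (2 * ℓ) f x‖ₑ ^ q) ^ (2 / q) := by
        rw [eLpNorm_ofReal_eq hq0, ← ENNReal.rpow_natCast, ← ENNReal.rpow_mul]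
        congr 1
        push_cast
        ring
    _ ≤ (W ^ (q / 2) * ((2 * eLpNorm f (ENNReal.ofReal q) volume) ^ q) ^ (1 - q / 2)) ^ (2 / q) := by
        gcongr
        refine h1.trans ?_
        gcongr
        linarith
    _ = _ := by
        rw [ENNReal.mul_rpow_of_nonneg _ _ (by positivity), ← ENNReal.rpow_mul,
          ← ENNReal.rpow_mul, ← ENNReal.rpow_mul, show q / 2 * (2 / q) = 1 by field_simp,
          ENNReal.rpow_one, show q * ((1 - q / 2) * (2 / q)) = 2 - q by field_simp]

/-- The increment of the grid averages from side `2 ^ (k + 1)` to side `2 ^ k`. -/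
def gridDiff (k : ℤ) (f : Euc n → ℂ) (x : Euc n) : ℂ :=
  gridAvg (2 ^ k) f x - gridAvg (2 * 2 ^ k) f x

/-- The gains telescope: each is paid for by the drop of the energy $\int|\cdot|^q$ on passing to
the next coarser grid, and the total drop is at most the energy of `f`. -/
theorem sum_energy_gridDiff_le {q : ℝ} (hq₁ : 1 < q) (hq₂ : q < 2)
    {f : Euc n → ℂ} (hf : Measurable f) (hfq : MemLp f (ENNReal.ofReal q)) (M : ℤ) (N : ℕ) :
    ENNReal.ofReal (q * (q - 1) / 4) * (∑ i ∈ Finset.range N, ∫⁻ x, ENNReal.ofReal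
        (‖gridDiff (M + i) f x‖ ^ 2 *
          (‖gridAvg (2 ^ (M + i)) f x‖ + ‖gridAvg (2 * 2 ^ (M + i)) f x‖) ^ (q - 2)))
      + ∫⁻ x, ‖gridAvg (2 ^ (M + N)) f x‖ₑ ^ q ≤ ∫⁻ x, ‖f x‖ₑ ^ q := by
  induction N with
  | zero => simpa using lintegral_enorm_gridAvg_rpow_le (by positivity) hq₁.le hf
  | succ N ih =>
    refine le_trans ?_ ih
    rw [Finset.sum_range_succ, mul_add, add_assoc]
    gcongr
    have h := energy_gridAvg_add_le hq₁ hq₂ (ℓ := 2 ^ (M + N)) (by positivity) hf hfq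
    have h2 : (2 : ℝ) * 2 ^ (M + N) = 2 ^ (M + ((N + 1 : ℕ) : ℤ)) := by
      rw [Nat.cast_add, Nat.cast_one, ← add_assoc, zpow_add_one₀ two_ne_zero, mul_comm]
    rw [← h2]
    exact h

/-- The constant of the square function estimate. -/
def squareConst (q : ℝ) : ℝ≥0∞ := (ENNReal.ofReal (q * (q - 1) / 4))⁻¹ * 2 ^ (2 - q)

theorem squareConst_ne_top {q : ℝ} (hq₁ : 1 < q) : squareConst q ≠ ∞ := by
  refine ENNReal.mul_ne_top ?_ ?_
  · rw [ENNReal.inv_ne_top]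
    have : 0 < q * (q - 1) / 4 := by nlinarith
    simpa using this
  · exact ENNReal.rpow_ne_top_of_ne_zero (by simp) (by simp)

theorem sum_eLpNorm_gridDiff_sq_le {q : ℝ} (hq₁ : 1 < q) (hq₂ : q < 2)
    {f : Euc n → ℂ} (hf : Measurable f) (hfq : MemLp f (ENNReal.ofReal q)) (M : ℤ) (N : ℕ) :
    ∑ i ∈ Finset.range N, eLpNorm (gridDiff (M + i) f) (ENNReal.ofReal q) volume ^ 2
      ≤ squareConst q * eLpNorm f (ENNReal.ofReal q) volume ^ 2 := by
  have hq0 : 0 < q := by linarith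
  have hc : 0 < q * (q - 1) / 4 := by nlinarith
  set c := ENNReal.ofReal (q * (q - 1) / 4) with hcdef
  have hc0 : c ≠ 0 := by simpa [hcdef] using hc
  set S := ∑ i ∈ Finset.range N, ∫⁻ x, ENNReal.ofReal
        (‖gridDiff (M + i) f x‖ ^ 2 *
          (‖gridAvg (2 ^ (M + i)) f x‖ + ‖gridAvg (2 * 2 ^ (M + i)) f x‖) ^ (q - 2)) with hS
  have h1 : S ≤ c⁻¹ * ∫⁻ x, ‖f x‖ₑ ^ q := by
    have h := (le_self_add).trans (sum_energy_gridDiff_le hq₁ hq₂ hf hfq M N)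
    rw [← hcdef, ← hS] at h
    calc S = c⁻¹ * (c * S) := by
          rw [← mul_assoc, ENNReal.inv_mul_cancel hc0 ENNReal.ofReal_ne_top, one_mul]
      _ ≤ _ := by gcongr
  calc ∑ i ∈ Finset.range N, eLpNorm (gridDiff (M + i) f) (ENNReal.ofReal q) volume ^ 2
      ≤ S * (2 * eLpNorm f (ENNReal.ofReal q) volume) ^ (2 - q) := by
        rw [hS, Finset.sum_mul]
        exact Finset.sum_le_sum fun i _ =>
          eLpNorm_gridAvg_sub_sq_le hq₁ hq₂ (ℓ := 2 ^ (M + i)) (by positivity) hf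
    _ ≤ (c⁻¹ * eLpNorm f (ENNReal.ofReal q) volume ^ q)
          * (2 * eLpNorm f (ENNReal.ofReal q) volume) ^ (2 - q) := by
        rw [eLpNorm_ofReal_rpow hq0]
        gcongr
    _ = _ := by
        rw [ENNReal.mul_rpow_of_nonneg _ _ (by linarith), squareConst, ← hcdef]
        have : eLpNorm f (ENNReal.ofReal q) volume ^ 2
            = eLpNorm f (ENNReal.ofReal q) volume ^ q
              * eLpNorm f (ENNReal.ofReal q) volume ^ (2 - q) := by
          rw [← ENNReal.rpow_add_of_nonneg _ _ hq0.le (by linarith), ← ENNReal.rpow_natCast]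
          congr 1
          push_cast
          ring
        rw [this]
        ring

theorem tsum_eLpNorm_gridDiff_sq_le {q : ℝ} (hq₁ : 1 < q) (hq₂ : q < 2)
    {f : Euc n → ℂ} (hf : Measurable f) (hfq : MemLp f (ENNReal.ofReal q)) :
    ∑' k : ℤ, eLpNorm (gridDiff k f) (ENNReal.ofReal q) volume ^ 2
      ≤ squareConst q * eLpNorm f (ENNReal.ofReal q) volume ^ 2 := by
  rw [ENNReal.tsum_eq_iSup_sum]
  refine iSup_le fun s => ?_
  -- The bound for consecutive increments depends neither on where they start nor on their number,
  -- so each finite set of indices may be enlarged to an interval.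
  obtain ⟨M, N, hs⟩ : ∃ (M : ℤ) (N : ℕ), s ⊆ (Finset.range N).image (fun i : ℕ => M + i) := by
    obtain ⟨a, ha⟩ := s.bddBelow
    obtain ⟨b, hb⟩ := s.bddAbove
    refine ⟨a, (b - a + 1).toNat, fun k hk => ?_⟩
    have h1 : a ≤ k := ha hk
    have h2 : k ≤ b := hb hk
    refine Finset.mem_image.2 ⟨(k - a).toNat, Finset.mem_range.2 (by omega), by omega⟩
  refine (Finset.sum_le_sum_of_subset hs).trans ?_
  rw [Finset.sum_image (by intro i _ j _ h; simpa using h)]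
  exact sum_eLpNorm_gridDiff_sq_le hq₁ hq₂ hf hfq M N

/-! ### Schur's test and Young's inequality -/

/-- Jensen with weight $K(x,\cdot)$ uses the row bound $q-1$ times, and Tonelli then uses the column
bound once. A general measure is allowed so that counting measure on $\mathbb Z$ is included. -/
theorem lintegral_rpow_kernel_le {X : Type*} [MeasurableSpace X] {μ : Measure X} [SFinite μ]
    {q : ℝ} (hq : 1 ≤ q) {K : X → X → ℝ≥0∞} (hK : Measurable (Function.uncurry K))
    {h : X → ℝ≥0∞} (hh : Measurable h) {a : ℝ≥0∞}
    (hrow : ∀ x, ∫⁻ t, K x t ∂μ ≤ a) (hcol : ∀ t, ∫⁻ x, K x t ∂μ ≤ a) :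
    ∫⁻ x, (∫⁻ t, K x t * h t ∂μ) ^ q ∂μ ≤ a ^ q * ∫⁻ t, h t ^ q ∂μ := by
  have hKx (x : X) : Measurable (K x) := hK.comp measurable_prodMk_left
  have hKt (t : X) : Measurable fun x => K x t := hK.comp measurable_prodMk_right
  have hm : Measurable (Function.uncurry fun x t => K x t * h t ^ q) :=
    hK.mul ((hh.comp measurable_snd).pow_const q)
  have hm2 : Measurable fun x => ∫⁻ t, K x t * h t ^ q ∂μ := hm.lintegral_prod_right'
  calc ∫⁻ x, (∫⁻ t, K x t * h t ∂μ) ^ q ∂μ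
      ≤ ∫⁻ x, a ^ (q - 1) * ∫⁻ t, K x t * h t ^ q ∂μ ∂μ := by
        refine lintegral_mono fun x => ?_
        refine (rpow_lintegral_mul_le hq (hKx x).aemeasurable hh.aemeasurable).trans ?_
        refine mul_le_mul_left ?_ _
        exact ENNReal.rpow_le_rpow (hrow x) (by linarith)
    _ = a ^ (q - 1) * ∫⁻ t, (∫⁻ x, K x t ∂μ) * h t ^ q ∂μ := by
        rw [lintegral_const_mul _ hm2, lintegral_lintegral_swap hm.aemeasurable]
        simp_rw [lintegral_mul_const _ (hKt _)]
    _ ≤ a ^ (q - 1) * ∫⁻ t, a * h t ^ q ∂μ := by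
        gcongr with t
        exact hcol t
    _ = _ := by
        rw [lintegral_const_mul _ (hh.pow_const q), ← mul_assoc]
        congr 1
        nth_rw 2 [← ENNReal.rpow_one a]
        rw [← ENNReal.rpow_add_of_nonneg _ _ (by linarith) (by norm_num)]
        congr 1
        ring

theorem eLpNorm_le_of_kernel {q : ℝ} (hq : 1 ≤ q) {K : Euc n → Euc n → ℝ≥0∞}
    (hK : Measurable (Function.uncurry K)) {g u : Euc n → ℂ} (hg : Measurable g) {a : ℝ≥0∞}
    (hrow : ∀ x, ∫⁻ t, K x t ≤ a) (hcol : ∀ t, ∫⁻ x, K x t ≤ a)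
    (hu : ∀ x, ‖u x‖ₑ ≤ ∫⁻ t, K x t * ‖g t‖ₑ) :
    eLpNorm u (ENNReal.ofReal q) volume ≤ a * eLpNorm g (ENNReal.ofReal q) volume := by
  have hq0 : 0 < q := by linarith
  rw [eLpNorm_ofReal_eq hq0, eLpNorm_ofReal_eq hq0]
  have h := lintegral_rpow_kernel_le hq hK hg.enorm hrow hcol
  calc (∫⁻ x, ‖u x‖ₑ ^ q) ^ (1 / q)
      ≤ (a ^ q * ∫⁻ t, ‖g t‖ₑ ^ q) ^ (1 / q) := by
        refine ENNReal.rpow_le_rpow (le_trans (lintegral_mono fun x => ?_) h) (by positivity)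
        exact ENNReal.rpow_le_rpow (hu x) hq0.le
    _ = _ := by
        rw [ENNReal.mul_rpow_of_nonneg _ _ (by positivity), ← ENNReal.rpow_mul,
          mul_one_div_cancel hq0.ne', ENNReal.rpow_one]

/-- The convolution of complex-valued functions. -/
abbrev conv (g Φ : Euc n → ℂ) : Euc n → ℂ :=
  MeasureTheory.convolution g Φ (ContinuousLinearMap.mul ℂ ℂ) volume

theorem conv_apply (g Φ : Euc n → ℂ) (x : Euc n) : conv g Φ x = ∫ t, g t * Φ (x - t) := rfl

theorem conv_apply' (g Φ : Euc n → ℂ) (x : Euc n) : conv g Φ x = ∫ t, g (x - t) * Φ t := by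
  rw [conv_apply, ← integral_sub_left_eq_self _ volume x]
  simp

theorem measurable_uncurry_enorm_sub {Φ : Euc n → ℂ} (hΦ : Measurable Φ) :
    Measurable (Function.uncurry fun x t : Euc n => ‖Φ (x - t)‖ₑ) :=
  (hΦ.comp (measurable_fst.sub measurable_snd)).enorm

/-- A bounded integrable weight pairs finitely with every $L^q$ function. Hence the convolutions
below converge absolutely at every point, not merely almost everywhere. -/
theorem lintegral_enorm_mul_lt_top {q : ℝ} (hq : 1 ≤ q) {g : Euc n → ℂ} (hg : Measurable g)
    (hgq : MemLp g (ENNReal.ofReal q)) {H : Euc n → ℝ≥0∞} (hH : Measurable H)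
    (hH1 : ∫⁻ t, H t ≠ ∞) {M : ℝ≥0∞} (hM : M ≠ ∞) (hHM : ∀ t, H t ≤ M) :
    ∫⁻ t, H t * ‖g t‖ₑ < ∞ := by
  have hq0 : 0 < q := by linarith
  have h := rpow_lintegral_mul_le (μ := volume) hq hH.aemeasurable hg.enorm.aemeasurable
  have h2 : ∫⁻ t, H t * ‖g t‖ₑ ^ q ≤ M * eLpNorm g (ENNReal.ofReal q) volume ^ q := by
    rw [eLpNorm_ofReal_rpow hq0, ← lintegral_const_mul _ (by fun_prop)]
    exact lintegral_mono fun t => by gcongr; exact hHM t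
  have h3 : (∫⁻ t, H t * ‖g t‖ₑ) ^ q < ∞ := by
    refine h.trans_lt (ENNReal.mul_lt_top (ENNReal.rpow_lt_top_of_nonneg (by linarith) hH1) ?_)
    exact h2.trans_lt (ENNReal.mul_lt_top hM.lt_top
      (ENNReal.rpow_lt_top_of_nonneg hq0.le hgq.2.ne))
  exact (ENNReal.rpow_lt_top_iff_of_pos hq0).1 h3

theorem integrable_conv {q : ℝ} (hq : 1 ≤ q) {g Φ : Euc n → ℂ} (hg : Measurable g)
    (hgq : MemLp g (ENNReal.ofReal q)) (hΦ : Measurable Φ) (hΦ1 : ∫⁻ t, ‖Φ t‖ₑ ≠ ∞)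
    {M : ℝ≥0∞} (hM : M ≠ ∞) (hΦM : ∀ t, ‖Φ t‖ₑ ≤ M) (x : Euc n) :
    Integrable fun t => g t * Φ (x - t) := by
  refine ⟨by fun_prop, ?_⟩
  have h := lintegral_enorm_mul_lt_top hq hg hgq (H := fun t => ‖Φ (x - t)‖ₑ) (by fun_prop)
    (by rwa [lintegral_sub_left_eq_self (fun t => ‖Φ t‖ₑ) x]) hM (fun t => hΦM _)
  simpa [HasFiniteIntegral, enorm_mul, mul_comm] using h

/-- Young's inequality for the convolution with an integrable kernel. -/
theorem eLpNorm_conv_le {q : ℝ} (hq : 1 ≤ q) {g Φ : Euc n → ℂ} (hg : Measurable g)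
    (hΦ : Measurable Φ) :
    eLpNorm (conv g Φ) (ENNReal.ofReal q) volume
      ≤ (∫⁻ t, ‖Φ t‖ₑ) * eLpNorm g (ENNReal.ofReal q) volume := by
  refine eLpNorm_le_of_kernel hq (measurable_uncurry_enorm_sub hΦ) hg (fun x => ?_)
    (fun t => ?_) fun x => ?_
  · rw [lintegral_sub_left_eq_self (fun t => ‖Φ t‖ₑ) x]
  · rw [lintegral_sub_right_eq_self (fun t => ‖Φ t‖ₑ) t]
  · rw [conv_apply]
    refine (enorm_integral_le_lintegral_enorm _).trans (le_of_eq ?_)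
    simp_rw [enorm_mul, mul_comm]

/-! ### Convolution of functions of vanishing grid averages -/

/-- Averaging over grid cubes is self-adjoint, by Fubini and the symmetry of lying in a common cube;
`hfin` is the absolute convergence that Fubini requires. -/
theorem integral_gridAvg_mul {ℓ : ℝ} (hℓ : 0 < ℓ) {g h : Euc n → ℂ} (hg : Measurable g)
    (hh : Measurable h) (hfin : ∫⁻ t, gridLavg ℓ (fun y => ‖h y‖ₑ) t * ‖g t‖ₑ < ∞) :
    ∫ t, gridAvg ℓ g t * h t = ∫ t, g t * gridAvg ℓ h t := by
  set F : Euc n → Euc n → ℂ := fun y t =>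
    (((ℓ ^ n)⁻¹ : ℝ) : ℂ) * {p : Euc n × Euc n | p.2 ∈ gridCube ℓ p.1}.indicator
      (fun p => g p.2 * h p.1) (y, t) with hF
  have hFm : Measurable (Function.uncurry F) :=
    measurable_const.mul (((hg.comp measurable_snd).mul (hh.comp measurable_fst)).indicator
      (measurableSet_gridCube_prod ℓ))
  have hFc (y t : Euc n) : F y t = (((ℓ ^ n)⁻¹ : ℝ) : ℂ) *
      (gridCube ℓ t).indicator (fun y => g t * h y) y := by
    simp only [hF, indicator, mem_ofPred_eq]
    congr 1
    exact @if_congr _ _ _ (_) (_) _ _ _ _ mem_gridCube_comm rfl rfl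
  have hcol (t : Euc n) : ∫ y, F y t = g t * gridAvg ℓ h t := by
    simp_rw [hFc]
    rw [integral_const_mul, integral_indicator (measurableSet_gridCube ℓ t), integral_const_mul,
      gridAvg]
    ring
  have hrow (y : Euc n) : ∫ t, F y t = gridAvg ℓ g y * h y := by
    have : ∀ t, F y t = (((ℓ ^ n)⁻¹ : ℝ) : ℂ) *
      (gridCube ℓ y).indicator (fun t => g t * h y) t := fun t => rfl
    simp_rw [this]
    rw [integral_const_mul, integral_indicator (measurableSet_gridCube ℓ y), integral_mul_const,
      gridAvg]
    ring
  have hint : Integrable (Function.uncurry F) (volume.prod volume) := by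
    refine ⟨hFm.aestronglyMeasurable, ?_⟩
    rw [HasFiniteIntegral, lintegral_prod_symm' _ hFm.enorm]
    refine lt_of_le_of_lt (lintegral_mono fun t => le_of_eq ?_) hfin
    have hc : ‖(((ℓ ^ n)⁻¹ : ℝ) : ℂ)‖ₑ = (ENNReal.ofReal ℓ ^ n)⁻¹ := by
      rw [← ofReal_norm, Complex.norm_real, Real.norm_of_nonneg (by positivity),
        ENNReal.ofReal_inv_of_pos (by positivity), ENNReal.ofReal_pow hℓ.le]
    simp_rw [Function.uncurry_apply_pair, hFc, enorm_mul, hc, enorm_indicator_eq_indicator_enorm]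
    rw [lintegral_const_mul _ ((by fun_prop : Measurable fun y => ‖g t * h y‖ₑ).indicator
      (measurableSet_gridCube ℓ t)), lintegral_indicator (measurableSet_gridCube ℓ t), gridLavg]
    simp_rw [enorm_mul]
    rw [lintegral_const_mul _ hh.enorm]
    ring
  simp_rw [← hrow, ← hcol]
  exact integral_integral_swap hint

theorem gridAvg_const {ℓ : ℝ} (hℓ : 0 < ℓ) (c : ℂ) (x : Euc n) :
    gridAvg ℓ (fun _ => c) x = c := by
  have hne : ((ℓ : ℝ) : ℂ) ≠ 0 := by exact_mod_cast hℓ.ne'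
  rw [gridAvg, setIntegral_const, Measure.real, volume_gridCube hℓ]
  simp [hℓ.le]
  field_simp

theorem measurable_gridLavg_translate (ℓ : ℝ) {Φ : Euc n → ℂ} (hΦ : Measurable Φ) :
    Measurable (Function.uncurry fun x t : Euc n =>
      gridLavg ℓ (fun y => ‖Φ (x - t) - Φ (x - y)‖ₑ) t) := by
  refine measurable_const.mul ?_
  have : ∀ p : Euc n × Euc n, ∫⁻ y in gridCube ℓ p.2, ‖Φ (p.1 - p.2) - Φ (p.1 - y)‖ₑ
      = ∫⁻ y, {r : (Euc n × Euc n) × Euc n | r.2 ∈ gridCube ℓ r.1.2}.indicator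
        (fun r => ‖Φ (r.1.1 - r.1.2) - Φ (r.1.1 - r.2)‖ₑ) (p, y) := by
    intro p
    rw [← lintegral_indicator (measurableSet_gridCube ℓ p.2)]
    rfl
  simp_rw [this]
  refine Measurable.lintegral_prod_right' (Measurable.indicator (by fun_prop) ?_)
  exact (measurableSet_gridCube_prod ℓ).preimage
    (f := fun r : (Euc n × Euc n) × Euc n => (r.1.2, r.2)) (by fun_prop)

theorem gridLavg_le_of_forall_le {ℓ : ℝ} (hℓ : 0 < ℓ) {h : Euc n → ℝ≥0∞} {M : ℝ≥0∞} {x : Euc n}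
    (hM : ∀ y ∈ gridCube ℓ x, h y ≤ M) : gridLavg ℓ h x ≤ M := by
  have : ∫⁻ y in gridCube ℓ x, h y ≤ ENNReal.ofReal ℓ ^ n * M := by
    refine (setLIntegral_mono measurable_const hM).trans (le_of_eq ?_)
    rw [setLIntegral_const, volume_gridCube hℓ, mul_comm]
  calc gridLavg ℓ h x ≤ (ENNReal.ofReal ℓ ^ n)⁻¹ * (ENNReal.ofReal ℓ ^ n * M) := by
        rw [gridLavg]; gcongr
    _ = M := by
        rw [← mul_assoc, ENNReal.inv_mul_cancel (volume_gridCube_ne_zero hℓ)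
          (volume_gridCube_ne_top ℓ), one_mul]

theorem abs_sub_lt_of_mem_gridCube {ℓ : ℝ} (hℓ : 0 < ℓ) {x z : Euc n} (h : z ∈ gridCube ℓ x)
    (i : Fin n) : |(z - x) i| < ℓ := by
  have h1 := (floor_div_eq_iff hℓ).1 (h i)
  have h2 := (floor_div_eq_iff hℓ).1 (rfl : ⌊x i / ℓ⌋ = ⌊x i / ℓ⌋)
  rw [mem_Ico] at h1 h2
  rw [PiLp.sub_apply, abs_lt]
  constructor <;> linarith [h1.1, h1.2, h2.1, h2.2]

/-- Here the cube moves with the integration variable, so it is replaced by the fixed box of all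
possible differences $y-t$. The volume of that box is $2^n$ times that of a cube, which is the
factor lost. -/
theorem lintegral_gridLavg_translate_row {ℓ : ℝ} (hℓ : 0 < ℓ) {Φ : Euc n → ℂ}
    (hΦ : Measurable Φ) {ω : ℝ≥0∞}
    (hω : ∀ v : Euc n, (∀ i, |v i| < ℓ) → ∫⁻ s, ‖Φ s - Φ (s - v)‖ₑ ≤ ω) (x : Euc n) :
    ∫⁻ t, gridLavg ℓ (fun y => ‖Φ (x - t) - Φ (x - y)‖ₑ) t ≤ 2 ^ n * ω := by
  set V : Set (Euc n) := {v | ∀ i, v i ∈ Ioo (-ℓ) ℓ} with hV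
  have hVm : MeasurableSet V := by
    simp only [hV, ofPred_forall]
    exact MeasurableSet.iInter fun i => measurableSet_Ioo.preimage (by fun_prop)
  have hVv : volume V = (2 * ENNReal.ofReal ℓ) ^ n := by
    rw [hV, volume_box]
    simp only [Real.volume_Ioo, Finset.prod_const, Finset.card_univ, Fintype.card_fin]
    rw [sub_neg_eq_add, ← two_mul, ENNReal.ofReal_mul (by norm_num), ENNReal.ofReal_ofNat]
  have h1 (t : Euc n) : ∫⁻ y in gridCube ℓ t, ‖Φ (x - t) - Φ (x - y)‖ₑ
      ≤ ∫⁻ v in V, ‖Φ (x - t) - Φ (x - t - v)‖ₑ := by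
    rw [← lintegral_indicator (measurableSet_gridCube ℓ t), ← lintegral_indicator hVm,
      ← lintegral_add_left_eq_self _ t]
    refine lintegral_mono fun v => ?_
    by_cases hv : t + v ∈ gridCube ℓ t
    · have hvV : v ∈ V := fun i => by
        have := abs_sub_lt_of_mem_gridCube hℓ hv i
        rwa [add_sub_cancel_left, abs_lt] at this
      rw [indicator_of_mem hv, indicator_of_mem hvV, sub_sub]
    · rw [indicator_of_notMem hv]
      exact zero_le
  have hm : Measurable (Function.uncurry fun t v : Euc n => ‖Φ (x - t) - Φ (x - t - v)‖ₑ) := by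
    unfold Function.uncurry
    fun_prop
  have h2 : ∫⁻ t, ∫⁻ v in V, ‖Φ (x - t) - Φ (x - t - v)‖ₑ
      ≤ (2 * ENNReal.ofReal ℓ) ^ n * ω := by
    rw [lintegral_lintegral_swap hm.aemeasurable, ← hVv, mul_comm, ← setLIntegral_const]
    refine setLIntegral_mono measurable_const fun v hv => ?_
    rw [lintegral_sub_left_eq_self (fun s => ‖Φ s - Φ (s - v)‖ₑ) x]
    exact hω v fun i => abs_lt.2 (hv i)
  have hm2 : Measurable fun t => ∫⁻ v in V, ‖Φ (x - t) - Φ (x - t - v)‖ₑ :=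
    hm.lintegral_prod_right'
  calc ∫⁻ t, gridLavg ℓ (fun y => ‖Φ (x - t) - Φ (x - y)‖ₑ) t
      ≤ ∫⁻ t, (ENNReal.ofReal ℓ ^ n)⁻¹ * ∫⁻ v in V, ‖Φ (x - t) - Φ (x - t - v)‖ₑ := by
        refine lintegral_mono fun t => ?_
        rw [gridLavg]
        exact mul_le_mul' le_rfl (h1 t)
    _ ≤ (ENNReal.ofReal ℓ ^ n)⁻¹ * ((2 * ENNReal.ofReal ℓ) ^ n * ω) := by
        rw [lintegral_const_mul _ hm2]
        gcongr
    _ = _ := by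
        rw [mul_pow, mul_comm ((2 : ℝ≥0∞) ^ n), mul_assoc, ← mul_assoc, ENNReal.inv_mul_cancel
          (volume_gridCube_ne_zero hℓ) (volume_gridCube_ne_top ℓ), one_mul]

/-- Now the cube is fixed, so each $y$ in it contributes one fixed translation of the kernel and
averaging over $y$ loses nothing. -/
theorem lintegral_gridLavg_translate_col {ℓ : ℝ} (hℓ : 0 < ℓ) {Φ : Euc n → ℂ}
    (hΦ : Measurable Φ) {ω : ℝ≥0∞}
    (hω : ∀ v : Euc n, (∀ i, |v i| < ℓ) → ∫⁻ s, ‖Φ s - Φ (s - v)‖ₑ ≤ ω) (t : Euc n) :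
    ∫⁻ x, gridLavg ℓ (fun y => ‖Φ (x - t) - Φ (x - y)‖ₑ) t ≤ ω := by
  have hm : Measurable (Function.uncurry fun x y : Euc n => ‖Φ (x - t) - Φ (x - y)‖ₑ) := by
    unfold Function.uncurry
    fun_prop
  have hm2 : Measurable fun x => ∫⁻ y in gridCube ℓ t, ‖Φ (x - t) - Φ (x - y)‖ₑ :=
    hm.lintegral_prod_right'
  simp only [gridLavg]
  rw [lintegral_const_mul _ hm2, lintegral_lintegral_swap hm.aemeasurable]
  refine gridLavg_le_of_forall_le hℓ
    (h := fun y => ∫⁻ x, ‖Φ (x - t) - Φ (x - y)‖ₑ) fun y hy => ?_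
  refine le_trans (le_of_eq ?_) (hω (y - t) fun i => abs_sub_lt_of_mem_gridCube hℓ hy i)
  rw [← lintegral_sub_right_eq_self (fun s => ‖Φ s - Φ (s - (y - t))‖ₑ) t]
  simp

/-- If `g` has vanishing grid averages subtracted, its convolution with a kernel is controlled by
the `L¹` modulus of continuity of the kernel. -/
theorem eLpNorm_conv_sub_gridAvg_le {q : ℝ} (hq : 1 ≤ q) {ℓ : ℝ} (hℓ : 0 < ℓ) {g Φ : Euc n → ℂ}
    (hg : Measurable g) (hgq : MemLp g (ENNReal.ofReal q)) (hΦ : Measurable Φ)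
    (hΦ1 : ∫⁻ t, ‖Φ t‖ₑ ≠ ∞) {M : ℝ≥0∞} (hM : M ≠ ∞) (hΦM : ∀ t, ‖Φ t‖ₑ ≤ M) {ω : ℝ≥0∞}
    (hω : ∀ v : Euc n, (∀ i, |v i| < ℓ) → ∫⁻ s, ‖Φ s - Φ (s - v)‖ₑ ≤ ω) :
    eLpNorm (conv (fun x => g x - gridAvg ℓ g x) Φ) (ENNReal.ofReal q) volume
      ≤ 2 ^ n * ω * eLpNorm g (ENNReal.ofReal q) volume := by
  refine eLpNorm_le_of_kernel hq (measurable_gridLavg_translate ℓ hΦ) hg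
    (lintegral_gridLavg_translate_row hℓ hΦ hω)
    (fun t => (lintegral_gridLavg_translate_col hℓ hΦ hω t).trans ?_) fun x => ?_
  · exact le_mul_of_one_le_left (zero_le) (one_le_pow₀ (by norm_num))
  have hΦx : Measurable fun t => Φ (x - t) := by fun_prop
  have hΦx1 : ∫⁻ t, ‖Φ (x - t)‖ₑ ≠ ∞ := by
    rwa [lintegral_sub_left_eq_self (fun t => ‖Φ t‖ₑ) x]
  have hΦL : MemLp (fun t => Φ (x - t)) 1 :=
    memLp_one_iff_integrable.2 ⟨hΦx.aestronglyMeasurable, hΦx1.lt_top⟩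
  have hfin : ∫⁻ t, gridLavg ℓ (fun y => ‖Φ (x - y)‖ₑ) t * ‖g t‖ₑ < ∞ :=
    lintegral_enorm_mul_lt_top hq hg hgq (measurable_gridLavg ℓ hΦx.enorm)
      (by rwa [lintegral_gridLavg hℓ hΦx.enorm]) hM
      (fun t => gridLavg_le_of_forall_le hℓ fun y _ => hΦM _)
  have hint2 : Integrable fun t => g t * gridAvg ℓ (fun y => Φ (x - y)) t := by
    refine ⟨(hg.mul (measurable_gridAvg ℓ hΦx)).aestronglyMeasurable, lt_of_le_of_lt ?_ hfin⟩
    refine lintegral_mono fun t => ?_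
    rw [enorm_mul, mul_comm]
    gcongr
    exact enorm_gridAvg_le hℓ _ t
  have hgA := memLp_gridAvg hℓ hq hg hgq
  -- Self-adjointness moves the averaging from `g` to the kernel, where the oscillation of `Φ` over
  -- a cube appears.
  have hconv : conv (fun x => g x - gridAvg ℓ g x) Φ x
      = ∫ t, g t * gridAvg ℓ (fun y => Φ (x - t) - Φ (x - y)) t := by
    rw [conv_apply]
    simp_rw [sub_mul]
    rw [integral_sub (integrable_conv hq hg hgq hΦ hΦ1 hM hΦM x)
      (integrable_conv hq (measurable_gridAvg ℓ hg) hgA hΦ hΦ1 hM hΦM x),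
      integral_gridAvg_mul hℓ hg hΦx hfin, ← integral_sub
      (integrable_conv hq hg hgq hΦ hΦ1 hM hΦM x) hint2]
    refine integral_congr_ae (Filter.Eventually.of_forall fun t => ?_)
    have hc : gridAvg ℓ (fun y => Φ (x - t) - Φ (x - y)) t
        = Φ (x - t) - gridAvg ℓ (fun y => Φ (x - y)) t := by
      have : IsFiniteMeasure (volume.restrict (gridCube ℓ t)) :=
        ⟨by rw [Measure.restrict_apply_univ, volume_gridCube hℓ]
            exact (volume_gridCube_ne_top ℓ).lt_top⟩
      nth_rw 2 [← gridAvg_const hℓ (Φ (x - t)) t]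
      simp only [gridAvg]
      rw [integral_sub (integrable_const _) (integrableOn_gridCube hℓ le_rfl hΦL t), mul_sub]
    simp only [hc]
    ring
  rw [hconv]
  refine (enorm_integral_le_lintegral_enorm _).trans (lintegral_mono fun t => ?_)
  rw [enorm_mul, mul_comm]
  gcongr
  exact enorm_gridAvg_le hℓ _ t

/-! ### Translates of functions that are constant on grid cubes -/

/-- The points that leave an interval under translation by $y$ lie within $|y|$ of one of its ends,
the sign of $y$ deciding which. -/
theorem volume_floor_add_ne_le {ℓ : ℝ} (hℓ : 0 < ℓ) (y : ℝ) (k : ℤ) :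
    volume {t : ℝ | ⌊t / ℓ⌋ = k ∧ ⌊(t + y) / ℓ⌋ ≠ k} ≤ ENNReal.ofReal |y| := by
  have hsub : {t : ℝ | ⌊t / ℓ⌋ = k ∧ ⌊(t + y) / ℓ⌋ ≠ k}
      ⊆ if 0 ≤ y then Ico ((k + 1) * ℓ - y) ((k + 1) * ℓ) else Ico (k * ℓ) (k * ℓ - y) := by
    rintro t ⟨h1, h2⟩
    rw [floor_div_eq_iff hℓ] at h1
    rw [Ne, floor_div_eq_iff hℓ, mem_Ico, not_and_or, not_le, not_lt] at h2
    split_ifs with hy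
    · rcases h2 with h2 | h2
      · linarith [h1.1]
      · exact ⟨by linarith, h1.2⟩
    · rcases h2 with h2 | h2
      · exact ⟨h1.1, by linarith⟩
      · linarith [h1.2]
  refine (measure_mono hsub).trans ?_
  split_ifs with hy
  · rw [Real.volume_Ico, abs_of_nonneg hy, sub_sub_cancel]
  · rw [Real.volume_Ico, abs_of_neg (not_le.1 hy), sub_sub_cancel_left]

/-- Leaving the cube means leaving it in some coordinate; the union bound over coordinates produces
the factor $n$. -/
theorem volume_gridCube_leave_le {ℓ : ℝ} (hℓ : 0 < ℓ) (x y : Euc n) :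
    volume {z | z ∈ gridCube ℓ x ∧ z + y ∉ gridCube ℓ x}
      ≤ ENNReal.ofReal ℓ ^ n * ENNReal.ofReal (n * ‖y‖ / ℓ) := by
  have hsub : {z | z ∈ gridCube ℓ x ∧ z + y ∉ gridCube ℓ x} ⊆ ⋃ i : Fin n, {z : Euc n | ∀ j,
      z j ∈ if j = i then {t : ℝ | ⌊t / ℓ⌋ = ⌊x i / ℓ⌋ ∧ ⌊(t + y i) / ℓ⌋ ≠ ⌊x i / ℓ⌋}
        else Ico (⌊x j / ℓ⌋ * ℓ) ((⌊x j / ℓ⌋ + 1) * ℓ)} := by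
    rintro z ⟨h1, h2⟩
    rw [mem_gridCube, not_forall] at h2
    obtain ⟨i, hi⟩ := h2
    refine mem_iUnion.2 ⟨i, fun j => ?_⟩
    split_ifs with hj
    · subst hj
      exact ⟨h1 j, hi⟩
    · exact (floor_div_eq_iff hℓ).1 (h1 j)
  refine (measure_mono hsub).trans ((measure_iUnion_le _).trans ?_)
  rw [tsum_fintype]
  have hi (i : Fin n) : volume {z : Euc n | ∀ j,
      z j ∈ if j = i then {t : ℝ | ⌊t / ℓ⌋ = ⌊x i / ℓ⌋ ∧ ⌊(t + y i) / ℓ⌋ ≠ ⌊x i / ℓ⌋}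
        else Ico (⌊x j / ℓ⌋ * ℓ) ((⌊x j / ℓ⌋ + 1) * ℓ)}
      ≤ ENNReal.ofReal ℓ ^ n * ENNReal.ofReal (‖y‖ / ℓ) := by
    rw [volume_box, ← Finset.mul_prod_erase _ _ (Finset.mem_univ i), if_pos rfl]
    have h1 : ∏ j ∈ Finset.univ.erase i, volume (if j = i then
        {t : ℝ | ⌊t / ℓ⌋ = ⌊x i / ℓ⌋ ∧ ⌊(t + y i) / ℓ⌋ ≠ ⌊x i / ℓ⌋}
        else Ico (⌊x j / ℓ⌋ * ℓ) ((⌊x j / ℓ⌋ + 1) * ℓ)) = ENNReal.ofReal ℓ ^ (n - 1) := by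
      rw [Finset.prod_congr rfl (g := fun _ => ENNReal.ofReal ℓ)]
      · simp [Finset.card_erase_of_mem]
      · intro j hj
        rw [if_neg (Finset.ne_of_mem_erase hj), Real.volume_Ico]
        congr 1
        ring
    have hn : n - 1 + 1 = n := Nat.succ_pred_eq_of_pos i.pos
    rw [h1]
    calc _ ≤ ENNReal.ofReal ‖y‖ * ENNReal.ofReal ℓ ^ (n - 1) := by
          gcongr
          refine (volume_floor_add_ne_le hℓ (y i) _).trans (ENNReal.ofReal_le_ofReal ?_)
          exact PiLp.norm_apply_le y i
      _ = ENNReal.ofReal ℓ ^ (n - 1 + 1) * ENNReal.ofReal (‖y‖ / ℓ) := by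
          rw [pow_succ, mul_assoc, ← ENNReal.ofReal_mul hℓ.le, mul_div_cancel₀ _ hℓ.ne', mul_comm]
      _ = _ := by rw [hn]
  refine (Finset.sum_le_sum fun i _ => hi i).trans (le_of_eq ?_)
  rw [Finset.sum_const, Finset.card_univ, Fintype.card_fin, nsmul_eq_mul, mul_div_assoc,
    ENNReal.ofReal_mul (by positivity), ENNReal.ofReal_natCast]
  ring

theorem measurableSet_leave (ℓ : ℝ) (y : Euc n) :
    MeasurableSet {x : Euc n | x + y ∉ gridCube ℓ x} := by
  have : Measurable fun x : Euc n => (x, x + y) := by fun_prop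
  exact ((measurableSet_gridCube_prod ℓ).preimage this).compl

/-- As `h` is constant on cubes, averaging its restriction to the leaving points multiplies `h` by
the proportion of the cube that leaves. -/
theorem lintegral_indicator_leave_le {ℓ : ℝ} (hℓ : 0 < ℓ) {h : Euc n → ℝ≥0∞} (hh : Measurable h)
    (hc : ∀ x, ∀ z ∈ gridCube ℓ x, h z = h x) (y : Euc n) :
    ∫⁻ x, {x | x + y ∉ gridCube ℓ x}.indicator h x
      ≤ ENNReal.ofReal (n * ‖y‖ / ℓ) * ∫⁻ x, h x := by
  rw [← lintegral_gridLavg hℓ (hh.indicator (measurableSet_leave ℓ y)), ← lintegral_const_mul _ hh]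
  refine lintegral_mono fun x => ?_
  have h1 : ∫⁻ z in gridCube ℓ x, {x | x + y ∉ gridCube ℓ x}.indicator h z
      ≤ h x * (ENNReal.ofReal ℓ ^ n * ENNReal.ofReal (n * ‖y‖ / ℓ)) := by
    rw [setLIntegral_indicator (measurableSet_leave ℓ y)]
    calc _ ≤ ∫⁻ z in {x | x + y ∉ gridCube ℓ x} ∩ gridCube ℓ x, h x :=
          setLIntegral_mono measurable_const fun z hz => (hc x z hz.2).le
      _ ≤ _ := by
          rw [setLIntegral_const]
          refine mul_le_mul' le_rfl ((measure_mono ?_).trans (volume_gridCube_leave_le hℓ x y))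
          rintro z ⟨hz1, hz2⟩
          refine ⟨hz2, ?_⟩
          rw [← gridCube_eq_of_mem hz2]
          exact hz1
  calc gridLavg ℓ _ x ≤ (ENNReal.ofReal ℓ ^ n)⁻¹ *
        (h x * (ENNReal.ofReal ℓ ^ n * ENNReal.ofReal (n * ‖y‖ / ℓ))) := mul_le_mul' le_rfl h1
    _ = ((ENNReal.ofReal ℓ ^ n)⁻¹ * ENNReal.ofReal ℓ ^ n) * (ENNReal.ofReal (n * ‖y‖ / ℓ) * h x) := by
        ring
    _ = _ := by
        rw [ENNReal.inv_mul_cancel (volume_gridCube_ne_zero hℓ) (volume_gridCube_ne_top ℓ),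
          one_mul]

/-- Uses $\min(t,1)\le t^\theta$. A small power of $\|y\|$ is wanted because it will be integrated
against kernels that need not have a first moment. -/
theorem lintegral_indicator_leave_le_rpow {ℓ : ℝ} (hℓ : 0 < ℓ) {h : Euc n → ℝ≥0∞}
    (hh : Measurable h) (hc : ∀ x, ∀ z ∈ gridCube ℓ x, h z = h x) (y : Euc n) {θ : ℝ}
    (hθ : 0 < θ) (hθ1 : θ ≤ 1) :
    ∫⁻ x, {x | x + y ∉ gridCube ℓ x}.indicator h x
      ≤ ENNReal.ofReal (n * ‖y‖ / ℓ) ^ θ * ∫⁻ x, h x := by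
  rcases le_total (ENNReal.ofReal (n * ‖y‖ / ℓ)) 1 with h1 | h1
  · refine (lintegral_indicator_leave_le hℓ hh hc y).trans (mul_le_mul' ?_ le_rfl)
    simpa using ENNReal.rpow_le_rpow_of_exponent_ge h1 hθ1
  · refine le_trans (lintegral_mono (indicator_le_self _ _)) ?_
    exact le_mul_of_one_le_left zero_le (ENNReal.one_le_rpow h1 hθ)

/-- Where $x-y$ and $x$ share a cube the difference vanishes. Elsewhere $x-y$ leaves its cube under
$+y$ and $x$ leaves its cube under $-y$, so each of the two terms is an integral over leaving
points. -/
theorem lintegral_enorm_translate_sub_rpow_le {q : ℝ} (hq : 1 ≤ q) {ℓ : ℝ} (hℓ : 0 < ℓ)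
    {g : Euc n → ℂ} (hg : Measurable g) (hc : ∀ x, ∀ z ∈ gridCube ℓ x, g z = g x) (y : Euc n)
    {θ : ℝ} (hθ : 0 < θ) (hθ1 : θ ≤ 1) :
    ∫⁻ x, ‖g (x - y) - g x‖ₑ ^ q
      ≤ 2 ^ q * ENNReal.ofReal (n * ‖y‖ / ℓ) ^ θ * ∫⁻ x, ‖g x‖ₑ ^ q := by
  set h : Euc n → ℝ≥0∞ := fun x => ‖g x‖ₑ ^ q with hdef
  have hh : Measurable h := hg.enorm.pow_const q
  have hhc : ∀ x, ∀ z ∈ gridCube ℓ x, h z = h x := fun x z hz => by simp only [hdef, hc x z hz]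
  have h1 := lintegral_indicator_leave_le_rpow hℓ hh hhc y hθ hθ1
  have h2 := lintegral_indicator_leave_le_rpow hℓ hh hhc (-y) hθ hθ1
  rw [norm_neg] at h2
  rw [← lintegral_sub_right_eq_self _ y] at h1
  have hpt (x : Euc n) : ‖g (x - y) - g x‖ₑ ^ q ≤ 2 ^ (q - 1) *
      ({x | x + y ∉ gridCube ℓ x}.indicator h (x - y)
        + {x | x + -y ∉ gridCube ℓ x}.indicator h x) := by
    by_cases hx : x - y ∈ gridCube ℓ x
    · rw [hc x _ hx]
      simp [ENNReal.zero_rpow_of_pos (by linarith : 0 < q)]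
    · rw [indicator_of_mem, indicator_of_mem]
      · refine le_trans ?_ (ENNReal.rpow_add_le_mul_rpow_add_rpow _ _ hq)
        gcongr
        exact enorm_sub_le
      · simpa [← sub_eq_add_neg] using hx
      · rw [mem_ofPred_eq, sub_add_cancel, mem_gridCube_comm]
        exact hx
  have hm1 : Measurable fun x => {x | x + y ∉ gridCube ℓ x}.indicator h (x - y) :=
    (hh.indicator (measurableSet_leave ℓ y)).comp (measurable_id.sub_const y)
  have hm2 : Measurable fun x => {x | x + -y ∉ gridCube ℓ x}.indicator h x :=
    hh.indicator (measurableSet_leave ℓ (-y))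
  have hm3 : Measurable fun x => {x | x + y ∉ gridCube ℓ x}.indicator h (x - y)
      + {x | x + -y ∉ gridCube ℓ x}.indicator h x := hm1.add hm2
  set I := ∫⁻ x, h x with hI
  calc ∫⁻ x, ‖g (x - y) - g x‖ₑ ^ q
      ≤ 2 ^ (q - 1) * (ENNReal.ofReal (n * ‖y‖ / ℓ) ^ θ * I
          + ENNReal.ofReal (n * ‖y‖ / ℓ) ^ θ * I) := by
        refine (lintegral_mono hpt).trans ?_
        rw [lintegral_const_mul _ hm3, lintegral_add_left hm1]
        gcongr
    _ = (2 ^ (q - 1) * 2) * ENNReal.ofReal (n * ‖y‖ / ℓ) ^ θ * I := by ring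
    _ = _ := by
        congr 2
        nth_rw 2 [← ENNReal.rpow_one 2]
        rw [← ENNReal.rpow_add _ _ (by norm_num) (by norm_num)]
        congr 1
        ring

/-- The convolution of a function that is constant on grid cubes with a kernel of mean zero. -/
theorem lintegral_conv_rpow_le_of_const {q : ℝ} (hq : 1 ≤ q) {ℓ : ℝ} (hℓ : 0 < ℓ)
    {g Φ : Euc n → ℂ} (hg : Measurable g) (hgq : MemLp g (ENNReal.ofReal q))
    (hc : ∀ x, ∀ z ∈ gridCube ℓ x, g z = g x) (hΦ : Measurable Φ) (hΦ0 : ∫ t, Φ t = 0)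
    (hΦ1 : ∫⁻ t, ‖Φ t‖ₑ ≠ ∞) {M : ℝ≥0∞} (hM : M ≠ ∞) (hΦM : ∀ t, ‖Φ t‖ₑ ≤ M)
    {θ : ℝ} (hθ : 0 < θ) (hθ1 : θ ≤ 1) :
    ∫⁻ x, ‖conv g Φ x‖ₑ ^ q ≤ (∫⁻ t, ‖Φ t‖ₑ) ^ (q - 1) * (2 ^ q *
      (∫⁻ t, ‖Φ t‖ₑ * ENNReal.ofReal (n * ‖t‖ / ℓ) ^ θ) * ∫⁻ x, ‖g x‖ₑ ^ q) := by
  have hΦi : Integrable Φ := ⟨hΦ.aestronglyMeasurable, hΦ1.lt_top⟩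
  -- The mean zero of `Φ` allows $g(x)$ to be subtracted.
  have hconv (x : Euc n) : conv g Φ x = ∫ t, Φ t * (g (x - t) - g x) := by
    have hi := (integrable_conv hq hg hgq hΦ hΦ1 hM hΦM x).comp_sub_left x
    simp only [sub_sub_cancel] at hi
    have h : ∀ t, Φ t * (g (x - t) - g x) = g (x - t) * Φ t - Φ t * g x := fun t => by ring
    simp_rw [h]
    rw [integral_sub hi (hΦi.mul_const _), integral_mul_const, hΦ0, zero_mul, sub_zero,
      conv_apply']
  have hpt (x : Euc n) : ‖conv g Φ x‖ₑ ^ q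
      ≤ (∫⁻ t, ‖Φ t‖ₑ) ^ (q - 1) * ∫⁻ t, ‖Φ t‖ₑ * ‖g (x - t) - g x‖ₑ ^ q := by
    refine le_trans ?_ (rpow_lintegral_mul_le hq hΦ.enorm.aemeasurable
      (h := fun t => ‖g (x - t) - g x‖ₑ) (by fun_prop))
    refine ENNReal.rpow_le_rpow ?_ (by linarith)
    rw [hconv]
    refine (enorm_integral_le_lintegral_enorm _).trans (le_of_eq ?_)
    simp_rw [enorm_mul]
  have hm : Measurable (Function.uncurry fun x t : Euc n => ‖Φ t‖ₑ * ‖g (x - t) - g x‖ₑ ^ q) := by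
    unfold Function.uncurry
    fun_prop
  have hm2 : Measurable fun x : Euc n => ∫⁻ t, ‖Φ t‖ₑ * ‖g (x - t) - g x‖ₑ ^ q :=
    hm.lintegral_prod_right'
  refine (lintegral_mono hpt).trans ?_
  rw [lintegral_const_mul _ hm2, lintegral_lintegral_swap hm.aemeasurable]
  refine mul_le_mul' le_rfl ?_
  set I := ∫⁻ x, ‖g x‖ₑ ^ q with hI
  calc ∫⁻ t, ∫⁻ x, ‖Φ t‖ₑ * ‖g (x - t) - g x‖ₑ ^ q
      ≤ ∫⁻ t, (2 ^ q * I) * (‖Φ t‖ₑ * ENNReal.ofReal (n * ‖t‖ / ℓ) ^ θ) := by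
        refine lintegral_mono fun t => ?_
        simp only
        rw [lintegral_const_mul _ (by fun_prop)]
        refine (mul_le_mul' le_rfl
          (lintegral_enorm_translate_sub_rpow_le hq hℓ hg hc t hθ hθ1)).trans (le_of_eq ?_)
        ring
    _ = _ := by
        rw [lintegral_const_mul _ (by fun_prop)]
        ring

/-! ### Littlewood–Paley kernels -/

/-- A continuous kernel of mean zero which decays and is Lipschitz at the rate
`(1 + |x|) ^ (-(n + ε))` with constant `B`. -/
structure IsLPKernel (ε B : ℝ) (φ : Euc n → ℂ) : Prop where
  continuous : Continuous φ
  integral_eq_zero : ∫ x, φ x = 0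
  bound : ∀ x, ‖φ x‖ ≤ B * (1 + ‖x‖) ^ (-((n : ℝ) + ε))
  lipschitz : ∀ x v, ‖v‖ ≤ 1 → ‖φ x - φ (x - v)‖ ≤ B * ‖v‖ * (1 + ‖x‖) ^ (-((n : ℝ) + ε))

/-- The integral of `(1 + |x|) ^ (-(n + ε / 2))`. -/
def decayIntegral (n : ℕ) (ε : ℝ) : ℝ≥0∞ :=
  ∫⁻ x : Euc n, ENNReal.ofReal ((1 + ‖x‖) ^ (-((n : ℝ) + ε / 2)))

theorem decayIntegral_ne_top {ε : ℝ} (hε : 0 < ε) : decayIntegral n ε ≠ ∞ := by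
  refine (finite_integral_one_add_norm ?_).ne
  rw [finrank_euclideanSpace_fin]
  linarith

theorem lintegral_comp_inv_smul {lam : ℝ} (hlam : 0 < lam) {h : Euc n → ℝ≥0∞}
    (hh : Measurable h) :
    ∫⁻ x, h (lam⁻¹ • x) = ENNReal.ofReal lam ^ n * ∫⁻ x, h x := by
  have hne : lam⁻¹ ≠ 0 := inv_ne_zero hlam.ne'
  have hmap := Measure.map_addHaar_smul (volume : Measure (Euc n)) hne
  rw [← lintegral_map hh (measurable_const_smul lam⁻¹), hmap, lintegral_smul_measure,
    finrank_euclideanSpace_fin, smul_eq_mul]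
  congr 1
  rw [inv_pow, inv_inv, abs_of_pos (by positivity), ENNReal.ofReal_pow hlam.le]

namespace IsLPKernel

variable {ε B : ℝ} {φ : Euc n → ℂ}

theorem nonneg (h : IsLPKernel ε B φ) : 0 ≤ B := by
  have := (norm_nonneg _).trans (h.bound 0)
  simpa using this

theorem norm_le (hε : 0 < ε) (h : IsLPKernel ε B φ) (x : Euc n) : ‖φ x‖ ≤ B := by
  refine (h.bound x).trans (mul_le_of_le_one_right h.nonneg ?_)
  exact Real.rpow_le_one_of_one_le_of_nonpos (by linarith [norm_nonneg x])
    (by have : (0 : ℝ) ≤ n := n.cast_nonneg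
        linarith)

/-- Half of the excess decay $\varepsilon$ absorbs the moment $\|x\|^\theta$; the other half keeps
the integral finite, which explains the exponent in `decayIntegral`. -/
theorem lintegral_mul_rpow_le (h : IsLPKernel ε B φ) {θ : ℝ} (hθ : 0 ≤ θ)
    (hθε : θ ≤ ε / 2) :
    ∫⁻ x, ‖φ x‖ₑ * ENNReal.ofReal ‖x‖ ^ θ ≤ ENNReal.ofReal B * decayIntegral n ε := by
  rw [decayIntegral, ← lintegral_const_mul _ (by fun_prop)]
  refine lintegral_mono fun x => ?_
  have h1 : 0 < 1 + ‖x‖ := by positivity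
  rw [← ofReal_norm, ENNReal.ofReal_rpow_of_nonneg (norm_nonneg _) hθ,
    ← ENNReal.ofReal_mul (norm_nonneg _), ← ENNReal.ofReal_mul h.nonneg]
  refine ENNReal.ofReal_le_ofReal ?_
  calc ‖φ x‖ * ‖x‖ ^ θ ≤ B * (1 + ‖x‖) ^ (-((n : ℝ) + ε)) * (1 + ‖x‖) ^ (ε / 2) := by
        refine mul_le_mul (h.bound x) ?_ (by positivity)
          (mul_nonneg h.nonneg (by positivity))
        refine (Real.rpow_le_rpow (norm_nonneg _) (by linarith : ‖x‖ ≤ 1 + ‖x‖) hθ).trans ?_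
        exact Real.rpow_le_rpow_of_exponent_le (by linarith [norm_nonneg x]) hθε
    _ = B * (1 + ‖x‖) ^ (-((n : ℝ) + ε / 2)) := by
        rw [mul_assoc, ← Real.rpow_add h1]
        congr 2
        ring

theorem lintegral_le (hε : 0 < ε) (h : IsLPKernel ε B φ) :
    ∫⁻ x, ‖φ x‖ₑ ≤ ENNReal.ofReal B * decayIntegral n ε := by
  simpa using h.lintegral_mul_rpow_le le_rfl (by positivity)

/-- Short translations use the Lipschitz bound, long ones the triangle inequality; both are
dominated by $\|v\|^\eta$ because $0<\eta\le1$. -/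
theorem lintegral_sub_translate_le (hε : 0 < ε) (h : IsLPKernel ε B φ) {η : ℝ} (hη : 0 < η)
    (hη1 : η ≤ 1) (v : Euc n) :
    ∫⁻ x, ‖φ x - φ (x - v)‖ₑ
      ≤ 2 * (ENNReal.ofReal B * decayIntegral n ε) * ENNReal.ofReal ‖v‖ ^ η := by
  have hφ := h.continuous.measurable
  rcases le_total ‖v‖ 1 with hv | hv
  · have hv' : ENNReal.ofReal ‖v‖ ≤ ENNReal.ofReal ‖v‖ ^ η := by
      simpa using ENNReal.rpow_le_rpow_of_exponent_ge (ENNReal.ofReal_le_one.2 hv) hη1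
    have h1 : ∫⁻ x, ‖φ x - φ (x - v)‖ₑ
        ≤ ∫⁻ x : Euc n, ENNReal.ofReal B * ENNReal.ofReal ‖v‖ *
          ENNReal.ofReal ((1 + ‖x‖) ^ (-((n : ℝ) + ε / 2))) := by
      refine lintegral_mono fun x => ?_
      rw [← ofReal_norm, ← ENNReal.ofReal_mul h.nonneg,
        ← ENNReal.ofReal_mul (mul_nonneg h.nonneg (norm_nonneg _))]
      refine ENNReal.ofReal_le_ofReal ((h.lipschitz x v hv).trans ?_)
      refine mul_le_mul_of_nonneg_left ?_ (mul_nonneg h.nonneg (norm_nonneg _))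
      exact Real.rpow_le_rpow_of_exponent_le (by linarith [norm_nonneg x]) (by linarith)
    rw [lintegral_const_mul _ (by fun_prop)] at h1
    refine h1.trans ?_
    calc ENNReal.ofReal B * ENNReal.ofReal ‖v‖ * decayIntegral n ε
        = 1 * (ENNReal.ofReal B * decayIntegral n ε) * ENNReal.ofReal ‖v‖ := by ring
      _ ≤ _ := by
        gcongr
        norm_num
  · have hv' : 1 ≤ ENNReal.ofReal ‖v‖ ^ η := ENNReal.one_le_rpow (ENNReal.one_le_ofReal.2 hv) hη
    calc ∫⁻ x, ‖φ x - φ (x - v)‖ₑ ≤ ∫⁻ x, (‖φ x‖ₑ + ‖φ (x - v)‖ₑ) :=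
          lintegral_mono fun x => enorm_sub_le
      _ = 2 * ∫⁻ x, ‖φ x‖ₑ := by
          rw [lintegral_add_left (by fun_prop), lintegral_sub_right_eq_self (fun x => ‖φ x‖ₑ) v,
            two_mul]
      _ ≤ 2 * (ENNReal.ofReal B * decayIntegral n ε) * 1 := by
          rw [mul_one]
          gcongr
          exact h.lintegral_le hε
      _ ≤ _ := by gcongr

end IsLPKernel

/-! ### Dilated kernels -/

/-- The `L¹` norm of a dilated kernel grows like this factor. -/
def scaleFactor (n : ℕ) (lam : ℝ) : ℝ≥0∞ := ENNReal.ofReal (lam ^ ((n : ℝ) / 2))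

theorem measurable_dilate {φ : Euc n → ℂ} (hφ : Measurable φ) (lam : ℝ) :
    Measurable (dilate φ lam) :=
  measurable_const.mul (hφ.comp (measurable_const_smul lam⁻¹))

theorem enorm_dilate {φ : Euc n → ℂ} {lam : ℝ} (hlam : 0 < lam) (x : Euc n) :
    ‖dilate φ lam x‖ₑ = ENNReal.ofReal (lam ^ (-(n : ℝ) / 2)) * ‖φ (lam⁻¹ • x)‖ₑ := by
  rw [dilate, enorm_mul, ← ofReal_norm, Complex.norm_real, Real.norm_of_nonneg (by positivity)]

theorem ofReal_rpow_mul_pow {lam : ℝ} (hlam : 0 < lam) :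
    ENNReal.ofReal (lam ^ (-(n : ℝ) / 2)) * ENNReal.ofReal lam ^ n = scaleFactor n lam := by
  rw [scaleFactor, ← ENNReal.ofReal_pow hlam.le, ← ENNReal.ofReal_mul (by positivity),
    ← Real.rpow_natCast, ← Real.rpow_add hlam]
  congr 2
  ring

theorem lintegral_enorm_dilate_mul {φ : Euc n → ℂ} (hφ : Measurable φ) {lam : ℝ} (hlam : 0 < lam)
    {h : Euc n → ℝ≥0∞} (hh : Measurable h) :
    ∫⁻ x, ‖dilate φ lam x‖ₑ * h (lam⁻¹ • x)
      = scaleFactor n lam * ∫⁻ x, ‖φ x‖ₑ * h x := by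
  simp_rw [enorm_dilate hlam, mul_assoc]
  rw [lintegral_const_mul _ (by fun_prop),
    lintegral_comp_inv_smul hlam (h := fun x => ‖φ x‖ₑ * h x) (by fun_prop), ← mul_assoc,
    ofReal_rpow_mul_pow hlam]

theorem lintegral_enorm_dilate {φ : Euc n → ℂ} (hφ : Measurable φ) {lam : ℝ} (hlam : 0 < lam) :
    ∫⁻ x, ‖dilate φ lam x‖ₑ = scaleFactor n lam * ∫⁻ x, ‖φ x‖ₑ := by
  simpa using lintegral_enorm_dilate_mul hφ hlam (h := fun _ => 1) measurable_const

theorem integral_dilate {φ : Euc n → ℂ} (hφ : ∫ x, φ x = 0) (lam : ℝ) :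
    ∫ x, dilate φ lam x = 0 := by
  simp only [dilate]
  rw [integral_const_mul, Measure.integral_comp_smul, hφ, smul_zero, mul_zero]

namespace IsLPKernel

variable {ε B : ℝ} {φ : Euc n → ℂ} {q : ℝ}

theorem lintegral_dilate_ne_top (hε : 0 < ε) (h : IsLPKernel ε B φ) {lam : ℝ} (hlam : 0 < lam) :
    ∫⁻ x, ‖dilate φ lam x‖ₑ ≠ ∞ := by
  rw [lintegral_enorm_dilate h.continuous.measurable hlam]
  exact ENNReal.mul_ne_top ENNReal.ofReal_ne_top (ne_top_of_le_ne_top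
    (ENNReal.mul_ne_top ENNReal.ofReal_ne_top (decayIntegral_ne_top hε)) (h.lintegral_le hε))

theorem enorm_dilate_le (hε : 0 < ε) (h : IsLPKernel ε B φ) {lam : ℝ} (hlam : 0 < lam)
    (x : Euc n) :
    ‖dilate φ lam x‖ₑ ≤ ENNReal.ofReal (lam ^ (-(n : ℝ) / 2)) * ENNReal.ofReal B := by
  rw [enorm_dilate hlam, ← ofReal_norm]
  gcongr
  exact h.norm_le hε _

theorem integrable_conv_dilate (hq : 1 ≤ q) (hε : 0 < ε) (h : IsLPKernel ε B φ) {lam : ℝ}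
    (hlam : 0 < lam) {g : Euc n → ℂ} (hg : Measurable g) (hgq : MemLp g (ENNReal.ofReal q))
    (x : Euc n) : Integrable fun t => g t * dilate φ lam (x - t) :=
  integrable_conv hq hg hgq (measurable_dilate h.continuous.measurable lam)
    (h.lintegral_dilate_ne_top hε hlam) (ENNReal.mul_ne_top ENNReal.ofReal_ne_top
      ENNReal.ofReal_ne_top) (h.enorm_dilate_le hε hlam) x

/-- The gain at small scales against functions that are constant on grid cubes. -/
theorem eLpNorm_conv_dilate_le_of_const (hq : 1 ≤ q) (hε : 0 < ε) (hε1 : ε ≤ 1)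
    (h : IsLPKernel ε B φ) {lam : ℝ} (hlam : 0 < lam) {ℓ : ℝ} (hℓ : 0 < ℓ) {g : Euc n → ℂ}
    (hg : Measurable g) (hgq : MemLp g (ENNReal.ofReal q))
    (hc : ∀ x, ∀ z ∈ gridCube ℓ x, g z = g x) :
    eLpNorm (conv g (dilate φ lam)) (ENNReal.ofReal q) volume
      ≤ scaleFactor n lam * (2 * (ENNReal.ofReal B * decayIntegral n ε)) *
        ENNReal.ofReal (n * lam / ℓ) ^ (ε / (2 * q)) * eLpNorm g (ENNReal.ofReal q) volume := by
  have hq0 : 0 < q := by linarith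
  have hφ := h.continuous.measurable
  set Λ := scaleFactor n lam with hΛ
  set J := ENNReal.ofReal B * decayIntegral n ε with hJ
  have h1 := lintegral_conv_rpow_le_of_const hq hℓ hg hgq hc (measurable_dilate hφ lam)
    (integral_dilate h.integral_eq_zero lam) (h.lintegral_dilate_ne_top hε hlam)
    (ENNReal.mul_ne_top ENNReal.ofReal_ne_top ENNReal.ofReal_ne_top)
    (h.enorm_dilate_le hε hlam) (θ := ε / 2) (by positivity) (by linarith)
  have h2 : ∫⁻ t, ‖dilate φ lam t‖ₑ * ENNReal.ofReal (n * ‖t‖ / ℓ) ^ (ε / 2)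
      ≤ Λ * J * ENNReal.ofReal (n * lam / ℓ) ^ (ε / 2) := by
    have h3 (t : Euc n) : ‖dilate φ lam t‖ₑ * ENNReal.ofReal (n * ‖t‖ / ℓ) ^ (ε / 2)
        = ENNReal.ofReal (n * lam / ℓ) ^ (ε / 2) * (‖dilate φ lam t‖ₑ *
          (fun x : Euc n => ENNReal.ofReal ‖x‖ ^ (ε / 2)) (lam⁻¹ • t)) := by
      simp only
      rw [mul_left_comm, ← ENNReal.mul_rpow_of_nonneg _ _ (by positivity),
        ← ENNReal.ofReal_mul (by positivity), norm_smul, norm_inv, Real.norm_of_nonneg hlam.le]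
      congr 3
      field_simp
    simp_rw [h3]
    have hdm := measurable_dilate hφ lam
    rw [lintegral_const_mul _ (by fun_prop),
      lintegral_enorm_dilate_mul hφ hlam (h := fun x => ENNReal.ofReal ‖x‖ ^ (ε / 2)) (by fun_prop),
      mul_comm]
    gcongr
    exact h.lintegral_mul_rpow_le (by positivity) le_rfl
  have h4 : ∫⁻ t, ‖dilate φ lam t‖ₑ ≤ Λ * J := by
    rw [lintegral_enorm_dilate hφ hlam]
    gcongr
    exact h.lintegral_le hε
  rw [← eLpNorm_ofReal_rpow hq0, ← eLpNorm_ofReal_rpow hq0] at h1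
  refine (ENNReal.rpow_le_rpow_iff hq0).1 (h1.trans ?_)
  clear_value J Λ
  calc _ ≤ (Λ * J) ^ (q - 1) * (2 ^ q * (Λ * J * ENNReal.ofReal (n * lam / ℓ) ^ (ε / 2)) *
        eLpNorm g (ENNReal.ofReal q) volume ^ q) := by
        gcongr
    _ = ((Λ * J) ^ (q - 1) * (Λ * J) ^ (1 : ℝ)) * 2 ^ q *
        ENNReal.ofReal (n * lam / ℓ) ^ (ε / 2) * eLpNorm g (ENNReal.ofReal q) volume ^ q := by
        rw [ENNReal.rpow_one]
        ring
    _ = _ := by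
        rw [← ENNReal.rpow_add_of_nonneg _ _ (by linarith) zero_le_one, sub_add_cancel,
          ENNReal.mul_rpow_of_nonneg _ _ hq0.le, ENNReal.mul_rpow_of_nonneg _ _ hq0.le,
          ENNReal.mul_rpow_of_nonneg _ _ hq0.le, ENNReal.mul_rpow_of_nonneg _ _ hq0.le,
          ENNReal.mul_rpow_of_nonneg _ _ hq0.le, ← ENNReal.rpow_mul,
          show ε / (2 * q) * q = ε / 2 by field_simp]
        ring

/-- The gain at large scales against functions of vanishing grid averages. -/
theorem eLpNorm_conv_dilate_sub_gridAvg_le (hq : 1 ≤ q) (hε : 0 < ε)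
    (h : IsLPKernel ε B φ) {lam : ℝ} (hlam : 0 < lam) {ℓ : ℝ} (hℓ : 0 < ℓ) {η : ℝ}
    (hη : 0 < η) (hη1 : η ≤ 1) {g : Euc n → ℂ}
    (hg : Measurable g) (hgq : MemLp g (ENNReal.ofReal q)) :
    eLpNorm (conv (fun x => g x - gridAvg ℓ g x) (dilate φ lam)) (ENNReal.ofReal q) volume
      ≤ scaleFactor n lam * (2 ^ n * (2 * (ENNReal.ofReal B * decayIntegral n ε))) *
        ENNReal.ofReal (n * ℓ / lam) ^ η * eLpNorm g (ENNReal.ofReal q) volume := by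
  have hφ := h.continuous.measurable
  refine (eLpNorm_conv_sub_gridAvg_le hq hℓ hg hgq (measurable_dilate hφ lam)
    (h.lintegral_dilate_ne_top hε hlam)
    (ENNReal.mul_ne_top ENNReal.ofReal_ne_top ENNReal.ofReal_ne_top)
    (h.enorm_dilate_le hε hlam) (ω := scaleFactor n lam *
      (2 * (ENNReal.ofReal B * decayIntegral n ε) * ENNReal.ofReal (n * ℓ / lam) ^ η))
    fun v hv => ?_).trans (le_of_eq (by ring))
  have h1 (s : Euc n) : ‖dilate φ lam s - dilate φ lam (s - v)‖ₑ
      = ‖dilate (fun x => φ x - φ (x - lam⁻¹ • v)) lam s‖ₑ := by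
    simp only [dilate, smul_sub, mul_sub]
  simp_rw [h1]
  rw [lintegral_enorm_dilate (by fun_prop) hlam]
  gcongr
  refine (h.lintegral_sub_translate_le hε hη hη1 _).trans ?_
  gcongr
  have hvn : ‖v‖ ≤ n * ℓ := by
    have hv1 : ‖v‖ ≤ ∑ i : Fin n, |v i| := by
      rw [EuclideanSpace.norm_eq]
      refine Real.sqrt_le_iff.2 ⟨Finset.sum_nonneg fun i _ => abs_nonneg _, ?_⟩
      simp only [Real.norm_eq_abs]
      exact Finset.sum_sq_le_sq_sum_of_nonneg fun i _ => abs_nonneg _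
    refine hv1.trans ((Finset.sum_le_sum fun i _ => (hv i).le).trans (le_of_eq ?_))
    simp
  rw [norm_smul, norm_inv, Real.norm_of_nonneg hlam.le, inv_mul_eq_div]
  gcongr

end IsLPKernel

/-! ### A discrete Young inequality -/

theorem tsum_int_pow_natAbs_le (r : ℝ≥0∞) :
    ∑' i : ℤ, r ^ i.natAbs ≤ 2 * (1 - r)⁻¹ := by
  have h := tsum_of_nat_of_neg_add_one (f := fun i : ℤ => r ^ i.natAbs) ENNReal.summable
    ENNReal.summable
  rw [h, two_mul]
  refine add_le_add ?_ ?_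
  · simp only [Int.natAbs_natCast]
    rw [ENNReal.tsum_geometric]
  · have : ∀ k : ℕ, (-((k : ℤ) + 1)).natAbs = k + 1 := fun k => by omega
    simp only [this]
    rw [ENNReal.tsum_geometric_add_one]
    by_cases hr : r ≤ 1
    · exact mul_le_of_le_one_left zero_le hr
    -- For $r>1$ the truncated difference $1-r$ is $0$, so the right-hand side is infinite.
    · rw [tsub_eq_zero_of_le (not_le.1 hr).le]
      simp

/-- Schur's test with exponent 2 for counting measure on $\mathbb Z$: every row and every column of
$w(k-j)$ has the same sum. -/
theorem tsum_sq_convolution_le (w b : ℤ → ℝ≥0∞) :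
    ∑' j : ℤ, (∑' k : ℤ, w (k - j) * b k) ^ 2 ≤ (∑' i, w i) ^ 2 * ∑' k, b k ^ 2 := by
  have h := lintegral_rpow_kernel_le (μ := Measure.count) (q := 2) (by norm_num)
    (K := fun j k : ℤ => w (k - j)) (h := b) (measurable_of_countable _)
    (measurable_of_countable _) (a := ∑' i, w i) (fun j => ?_) (fun k => ?_)
  · simp only [lintegral_count] at h
    simpa only [ENNReal.rpow_ofNat] using h
  · rw [lintegral_count]
    exact ((Equiv.subRight j).tsum_eq w).le
  · rw [lintegral_count]
    exact ((Equiv.subLeft k).tsum_eq w).le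

/-! ### The Littlewood–Paley estimate -/

theorem gridDiff_const {k : ℤ} (f : Euc n → ℂ) {x z : Euc n} (hz : z ∈ gridCube (2 ^ k) x) :
    gridDiff k f z = gridDiff k f x := by
  rw [gridDiff, gridDiff, gridAvg_eq_of_mem f hz, gridAvg_eq_of_mem f
    (gridCube_subset_two_mul x hz)]

theorem measurable_gridDiff (k : ℤ) {f : Euc n → ℂ} (hf : Measurable f) :
    Measurable (gridDiff k f) :=
  (measurable_gridAvg _ hf).sub (measurable_gridAvg _ hf)

theorem memLp_gridDiff {q : ℝ} (hq : 1 ≤ q) (k : ℤ) {f : Euc n → ℂ} (hf : Measurable f)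
    (hfq : MemLp f (ENNReal.ofReal q)) : MemLp (gridDiff k f) (ENNReal.ofReal q) :=
  (memLp_gridAvg (by positivity) hq hf hfq).sub (memLp_gridAvg (by positivity) hq hf hfq)

theorem gridAvg_gridDiff {q : ℝ} (hq : 1 ≤ q) (k : ℤ) {f : Euc n → ℂ} (hf : Measurable f)
    (hfq : MemLp f (ENNReal.ofReal q)) (x : Euc n) :
    gridAvg (2 * 2 ^ k) (gridDiff k f) x = 0 := by
  have hq1 : 1 ≤ ENNReal.ofReal q := by simpa using hq
  have h1 : (0 : ℝ) < 2 ^ k := by positivity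
  have h2 : (0 : ℝ) < 2 * 2 ^ k := by positivity
  have := gridAvg_sub h2 hq1 (memLp_gridAvg h1 hq hf hfq) (memLp_gridAvg h2 hq hf hfq) x
  rw [gridAvg_gridAvg h1 h2 gridCube_subset_two_mul hq1 hfq,
    gridAvg_gridAvg h2 h2 (fun _ => subset_rfl) hq1 hfq, sub_self] at this
  exact this

theorem measurable_conv {g Φ : Euc n → ℂ} (hg : Measurable g) (hΦ : Measurable Φ) :
    Measurable (conv g Φ) := by
  have hm : Measurable (Function.uncurry fun x t : Euc n => g t * Φ (x - t)) := by
    unfold Function.uncurry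
    fun_prop
  exact (hm.stronglyMeasurable.integral_prod_right).measurable

/-! ### Almost orthogonality between dilated kernels and grid increments. -/

/-- The constant of the almost orthogonality estimates. -/
def almostOrthConst (n : ℕ) (ε q : ℝ) : ℝ≥0∞ :=
  2 ^ n * (2 * decayIntegral n ε) * ENNReal.ofReal (2 * n) ^ (ε / (2 * q))

/-- The ratio of the geometric decay in the almost orthogonality estimates. -/
def almostOrthRatio (ε q : ℝ) : ℝ≥0∞ := 2 ^ (-(ε / (2 * q)))

theorem almostOrthConst_ne_top {ε q : ℝ} (hε : 0 < ε) (hq : 0 < q) :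
    almostOrthConst n ε q ≠ ∞ := by
  refine ENNReal.mul_ne_top (ENNReal.mul_ne_top (ENNReal.pow_ne_top (by simp))
    (ENNReal.mul_ne_top (by simp) (decayIntegral_ne_top hε))) ?_
  exact ENNReal.rpow_ne_top_of_nonneg (by positivity) ENNReal.ofReal_ne_top

theorem almostOrthRatio_lt_one {ε q : ℝ} (hε : 0 < ε) (hq : 0 < q) : almostOrthRatio ε q < 1 :=
  ENNReal.rpow_lt_one_of_one_lt_of_neg (by norm_num) (by simp; positivity)

theorem ofReal_rpow_le_ratio {ε q : ℝ} (hε : 0 < ε) (hq : 0 < q) {t : ℝ} {i : ℕ}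
    (ht : t ≤ 2 * n * 2 ^ (-(i : ℤ))) :
    ENNReal.ofReal t ^ (ε / (2 * q))
      ≤ ENNReal.ofReal (2 * n) ^ (ε / (2 * q)) * almostOrthRatio ε q ^ i := by
  have hη : 0 ≤ ε / (2 * q) := by positivity
  calc ENNReal.ofReal t ^ (ε / (2 * q))
      ≤ ENNReal.ofReal (2 * n * 2 ^ (-(i : ℤ))) ^ (ε / (2 * q)) := by gcongr
    _ = _ := by
        rw [ENNReal.ofReal_mul (by positivity), ENNReal.mul_rpow_of_nonneg _ _ hη]
        congr 1
        rw [almostOrthRatio, ← Real.rpow_intCast, ← ENNReal.ofReal_rpow_of_pos (by norm_num),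
          ENNReal.ofReal_ofNat, ← ENNReal.rpow_mul, ← ENNReal.rpow_natCast, ← ENNReal.rpow_mul]
        congr 1
        push_cast
        ring

namespace IsLPKernel

variable {ε B : ℝ} {φ : Euc n → ℂ} {q : ℝ}

theorem eLpNorm_conv_le_of_const (hq : 1 ≤ q) (hε : 0 < ε) (hε1 : ε ≤ 1)
    (h : IsLPKernel ε B φ) {j k : ℤ} {i : ℕ} (hi : k = j + i) {lam : ℝ}
    (hlam : lam ∈ Ico ((2 : ℝ) ^ j) (2 ^ (j + 1))) {g : Euc n → ℂ}
    (hg : Measurable g) (hgq : MemLp g (ENNReal.ofReal q))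
    (hc : ∀ x, ∀ z ∈ gridCube (2 ^ k) x, g z = g x) :
    eLpNorm (conv g (dilate φ lam)) (ENNReal.ofReal q) volume
      ≤ scaleFactor n lam * ENNReal.ofReal B * almostOrthConst n ε q * almostOrthRatio ε q ^ i
        * eLpNorm g (ENNReal.ofReal q) volume := by
  have hlam0 : 0 < lam := lt_of_lt_of_le (by positivity) hlam.1
  refine (h.eLpNorm_conv_dilate_le_of_const hq hε hε1 hlam0 (ℓ := 2 ^ k) (by positivity) hg hgq
    hc).trans ?_
  refine mul_le_mul' ?_ le_rfl
  have ht : n * lam / 2 ^ k ≤ 2 * n * 2 ^ (-(i : ℤ)) := by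
    rw [div_le_iff₀ (by positivity), mul_assoc, ← zpow_add₀ two_ne_zero, hi,
      show -(i : ℤ) + (j + i) = j by ring]
    have := hlam.2.le
    rw [zpow_add_one₀ two_ne_zero] at this
    have hn : (0 : ℝ) ≤ n := n.cast_nonneg
    nlinarith
  -- The factor $2^n$ is inserted only so that coarse and fine grids share one constant.
  have h2 : (1 : ℝ≥0∞) ≤ 2 ^ n := one_le_pow₀ (by norm_num)
  calc scaleFactor n lam * (2 * (ENNReal.ofReal B * decayIntegral n ε)) *
        ENNReal.ofReal (n * lam / 2 ^ k) ^ (ε / (2 * q))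
      ≤ scaleFactor n lam * (2 * (ENNReal.ofReal B * decayIntegral n ε)) *
        (ENNReal.ofReal (2 * n) ^ (ε / (2 * q)) * almostOrthRatio ε q ^ i) := by
        gcongr
        exact ofReal_rpow_le_ratio hε (by linarith) ht
    _ = 1 * (scaleFactor n lam * (2 * (ENNReal.ofReal B * decayIntegral n ε)) *
        (ENNReal.ofReal (2 * n) ^ (ε / (2 * q)) * almostOrthRatio ε q ^ i)) := by rw [one_mul]
    _ ≤ 2 ^ n * (scaleFactor n lam * (2 * (ENNReal.ofReal B * decayIntegral n ε)) *
        (ENNReal.ofReal (2 * n) ^ (ε / (2 * q)) * almostOrthRatio ε q ^ i)) := by gcongr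
    _ = _ := by
        rw [almostOrthConst]
        ring

/-- The side is only bounded by $2\cdot2^k$ because two sides occur: $2\cdot2^k$ for the increments,
and $2^k$ for what remains of `f` after subtracting a fine average. -/
theorem eLpNorm_conv_sub_gridAvg_le (hq : 1 ≤ q) (hε : 0 < ε) (hε1 : ε ≤ 1)
    (h : IsLPKernel ε B φ) {j k : ℤ} {i : ℕ} (hi : j = k + i) {lam : ℝ}
    (hlam : lam ∈ Ico ((2 : ℝ) ^ j) (2 ^ (j + 1))) {g : Euc n → ℂ}
    (hg : Measurable g) (hgq : MemLp g (ENNReal.ofReal q)) {ℓ : ℝ} (hℓ : 0 < ℓ)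
    (hℓk : ℓ ≤ 2 * 2 ^ k) :
    eLpNorm (conv (fun x => g x - gridAvg ℓ g x) (dilate φ lam)) (ENNReal.ofReal q) volume
      ≤ scaleFactor n lam * ENNReal.ofReal B * almostOrthConst n ε q * almostOrthRatio ε q ^ i
        * eLpNorm g (ENNReal.ofReal q) volume := by
  have hlam0 : 0 < lam := lt_of_lt_of_le (by positivity) hlam.1
  have hη1 : ε / (2 * q) ≤ 1 := by
    rw [div_le_one (by linarith)]
    linarith
  refine (h.eLpNorm_conv_dilate_sub_gridAvg_le hq hε hlam0 hℓ (η := ε / (2 * q))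
    (by have : 0 < q := by linarith
        positivity) hη1 hg hgq).trans ?_
  refine mul_le_mul' ?_ le_rfl
  have ht : n * ℓ / lam ≤ 2 * n * 2 ^ (-(i : ℤ)) := by
    rw [div_le_iff₀ hlam0]
    have h1 : (2 : ℝ) ^ k ≤ 2 ^ (-(i : ℤ)) * lam := by
      calc (2 : ℝ) ^ k = 2 ^ (-(i : ℤ)) * 2 ^ j := by
            rw [← zpow_add₀ two_ne_zero, hi]
            congr 1
            ring
        _ ≤ _ := by
            gcongr
            exact hlam.1
    have hn : (0 : ℝ) ≤ n := n.cast_nonneg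
    nlinarith
  calc _ ≤ scaleFactor n lam * (2 ^ n * (2 * (ENNReal.ofReal B * decayIntegral n ε))) *
        (ENNReal.ofReal (2 * n) ^ (ε / (2 * q)) * almostOrthRatio ε q ^ i) := by
        gcongr
        exact ofReal_rpow_le_ratio hε (by linarith) ht
    _ = _ := by
        rw [almostOrthConst]
        ring

/-- An increment is constant on cubes of side $2^k$, which helps a kernel of mean zero at finer
scales, and has mean zero on cubes of side $2^{k+1}$, which helps a regular kernel at coarser
scales. The gain is geometric in both directions. -/
theorem eLpNorm_conv_gridDiff_le (hq : 1 ≤ q) (hε : 0 < ε) (hε1 : ε ≤ 1)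
    (h : IsLPKernel ε B φ) {j : ℤ} (k : ℤ) {lam : ℝ}
    (hlam : lam ∈ Ico ((2 : ℝ) ^ j) (2 ^ (j + 1))) {f : Euc n → ℂ}
    (hf : Measurable f) (hfq : MemLp f (ENNReal.ofReal q)) :
    eLpNorm (conv (gridDiff k f) (dilate φ lam)) (ENNReal.ofReal q) volume
      ≤ scaleFactor n lam * ENNReal.ofReal B * almostOrthConst n ε q *
        almostOrthRatio ε q ^ (k - j).natAbs
        * eLpNorm (gridDiff k f) (ENNReal.ofReal q) volume := by
  rcases le_total j k with hjk | hjk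
  · exact h.eLpNorm_conv_le_of_const hq hε hε1 (i := (k - j).natAbs) (k := k) (by omega) hlam
      (measurable_gridDiff k hf) (memLp_gridDiff hq k hf hfq) (fun x z hz => gridDiff_const f hz)
  · have := h.eLpNorm_conv_sub_gridAvg_le hq hε hε1 (i := (k - j).natAbs) (k := k) (by omega) hlam
      (measurable_gridDiff k hf) (memLp_gridDiff hq k hf hfq) (ℓ := 2 * 2 ^ k) (by positivity)
      le_rfl
    simpa only [gridAvg_gridDiff hq k hf hfq, sub_zero] using this

theorem conv_sub (hq : 1 ≤ q) (hε : 0 < ε) (h : IsLPKernel ε B φ) {lam : ℝ} (hlam : 0 < lam)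
    {f g : Euc n → ℂ} (hf : Measurable f) (hfq : MemLp f (ENNReal.ofReal q)) (hg : Measurable g)
    (hgq : MemLp g (ENNReal.ofReal q)) (x : Euc n) :
    conv (fun y => f y - g y) (dilate φ lam) x
      = conv f (dilate φ lam) x - conv g (dilate φ lam) x := by
  simp only [conv_apply, sub_mul]
  exact integral_sub (h.integrable_conv_dilate hq hε hlam hf hfq x)
    (h.integrable_conv_dilate hq hε hlam hg hgq x)

theorem conv_gridAvg_eq_sum (hq : 1 ≤ q) (hε : 0 < ε) (h : IsLPKernel ε B φ) {lam : ℝ}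
    (hlam : 0 < lam) {f : Euc n → ℂ} (hf : Measurable f) (hfq : MemLp f (ENNReal.ofReal q))
    (M : ℤ) (N : ℕ) (x : Euc n) :
    conv (gridAvg (2 ^ M) f) (dilate φ lam) x
      = ∑ i ∈ Finset.range N, conv (gridDiff (M + i) f) (dilate φ lam) x
        + conv (gridAvg (2 ^ (M + N)) f) (dilate φ lam) x := by
  induction N with
  | zero => simp
  | succ N ih =>
    have h1 : (2 : ℝ) * 2 ^ (M + N) = 2 ^ (M + ((N + 1 : ℕ) : ℤ)) := by
      rw [Nat.cast_add, Nat.cast_one, ← add_assoc, zpow_add_one₀ two_ne_zero, mul_comm]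
    have h2 : conv (gridDiff (M + N) f) (dilate φ lam) x = _ :=
      h.conv_sub hq hε hlam (measurable_gridAvg (2 ^ (M + N)) hf)
        (memLp_gridAvg (by positivity) hq hf hfq) (measurable_gridAvg (2 * 2 ^ (M + N)) hf)
        (memLp_gridAvg (by positivity) hq hf hfq) x
    rw [ih, Finset.sum_range_succ, h2, h1]
    ring

/-- Split `f` into a finite block of increments centred at scale $2^j$, a remainder finer than the
block and an average coarser than it. The convolutions of the two end pieces are $O(r^N)$, so
convergence of the martingale itself is never needed. -/
theorem eLpNorm_conv_le_tsum (hq : 1 ≤ q) (hε : 0 < ε) (hε1 : ε ≤ 1)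
    (h : IsLPKernel ε B φ) {j : ℤ} {lam : ℝ}
    (hlam : lam ∈ Ico ((2 : ℝ) ^ j) (2 ^ (j + 1))) {f : Euc n → ℂ}
    (hf : Measurable f) (hfq : MemLp f (ENNReal.ofReal q)) :
    eLpNorm (conv f (dilate φ lam)) (ENNReal.ofReal q) volume
      ≤ scaleFactor n lam * ENNReal.ofReal B * almostOrthConst n ε q *
        ∑' k : ℤ, almostOrthRatio ε q ^ (k - j).natAbs
        * eLpNorm (gridDiff k f) (ENNReal.ofReal q) volume := by
  have hlam0 : 0 < lam := lt_of_lt_of_le (by positivity) hlam.1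
  have hq1 : 1 ≤ ENNReal.ofReal q := by simpa using hq
  have hdm := measurable_dilate h.continuous.measurable lam
  set C := scaleFactor n lam * ENNReal.ofReal B * almostOrthConst n ε q with hC
  have hCtop : C ≠ ∞ := ENNReal.mul_ne_top (ENNReal.mul_ne_top ENNReal.ofReal_ne_top
    ENNReal.ofReal_ne_top) (almostOrthConst_ne_top hε (by linarith))
  set r := almostOrthRatio ε q with hr
  set S := ∑' k : ℤ, r ^ (k - j).natAbs * eLpNorm (gridDiff k f) (ENNReal.ofReal q) volume with hS
  set F := eLpNorm f (ENNReal.ofReal q) volume with hF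
  have hN (N : ℕ) : eLpNorm (conv f (dilate φ lam)) (ENNReal.ofReal q) volume
      ≤ C * S + 2 * C * F * r ^ N := by
    have hsplit : conv f (dilate φ lam)
        = conv (fun x => f x - gridAvg (2 ^ (j - N)) f x) (dilate φ lam)
          + (∑ i ∈ Finset.range (2 * N), conv (gridDiff (j - N + i) f) (dilate φ lam)
            + conv (gridAvg (2 ^ (j + N)) f) (dilate φ lam)) := by
      funext x
      have h1 := h.conv_gridAvg_eq_sum hq hε hlam0 hf hfq (j - N) (2 * N) x
      rw [show j - (N : ℤ) + ((2 * N : ℕ) : ℤ) = j + N by push_cast; ring] at h1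
      rw [Pi.add_apply, Pi.add_apply, Finset.sum_apply, ← h1, h.conv_sub hq hε hlam0 hf hfq
        (measurable_gridAvg _ hf) (memLp_gridAvg (by positivity) hq hf hfq), sub_add_cancel]
    have hA : eLpNorm (conv (fun x => f x - gridAvg (2 ^ (j - N)) f x) (dilate φ lam))
        (ENNReal.ofReal q) volume ≤ C * r ^ N * F :=
      h.eLpNorm_conv_sub_gridAvg_le hq hε hε1 (k := j - N) (i := N) (by ring) hlam hf hfq
        (by positivity) (le_mul_of_one_le_left (by positivity) (by norm_num))
    have hB : eLpNorm (conv (gridAvg (2 ^ (j + N)) f) (dilate φ lam))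
        (ENNReal.ofReal q) volume ≤ C * r ^ N * F := by
      refine (h.eLpNorm_conv_le_of_const hq hε hε1 (k := j + N) (i := N) rfl hlam
        (measurable_gridAvg _ hf) (memLp_gridAvg (by positivity) hq hf hfq)
        (fun x z hz => gridAvg_eq_of_mem f hz)).trans ?_
      gcongr
      exact eLpNorm_gridAvg_le (by positivity) hq hf
    have hD : eLpNorm (∑ i ∈ Finset.range (2 * N), conv (gridDiff (j - N + i) f) (dilate φ lam))
        (ENNReal.ofReal q) volume ≤ C * S := by
      refine (eLpNorm_sum_le (fun i _ => (measurable_conv (measurable_gridDiff _ hf)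
        hdm).aestronglyMeasurable) hq1).trans ?_
      refine (Finset.sum_le_sum fun (i : ℕ) _ =>
        h.eLpNorm_conv_gridDiff_le hq hε hε1 (j - N + (i : ℤ)) hlam hf hfq).trans ?_
      simp_rw [mul_assoc]
      rw [← Finset.mul_sum, ← Finset.mul_sum, ← Finset.mul_sum]
      rw [hC, mul_assoc, mul_assoc]
      gcongr
      have hinj : Set.InjOn (fun i : ℕ => j - N + (i : ℤ)) (Finset.range (2 * N)) := by
        intro a _ b _ hab
        simpa using hab
      rw [← Finset.sum_image (f := fun k : ℤ => r ^ (k - j).natAbs *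
        eLpNorm (gridDiff k f) (ENNReal.ofReal q) volume) hinj]
      exact ENNReal.sum_le_tsum _
    rw [hsplit]
    have hmA := (measurable_conv (hf.sub (measurable_gridAvg (2 ^ (j - N)) hf))
      hdm).aestronglyMeasurable (μ := volume)
    have hmB := (measurable_conv (measurable_gridAvg (2 ^ (j + N)) hf)
      hdm).aestronglyMeasurable (μ := volume)
    have hmD : AEStronglyMeasurable (∑ i ∈ Finset.range (2 * N),
        conv (gridDiff (j - N + i) f) (dilate φ lam)) volume :=
      Finset.aestronglyMeasurable_sum _ fun i _ => (measurable_conv (measurable_gridDiff _ hf)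
        hdm).aestronglyMeasurable
    refine (eLpNorm_add_le hmA (hmD.add hmB) hq1).trans ?_
    refine (add_le_add hA ((eLpNorm_add_le hmD hmB hq1).trans (add_le_add hD hB))).trans
      (le_of_eq ?_)
    ring
  have hlim : Filter.Tendsto (fun N : ℕ => C * S + 2 * C * F * r ^ N) Filter.atTop
      (nhds (C * S + 2 * C * F * 0)) := by
    refine tendsto_const_nhds.add (ENNReal.Tendsto.const_mul
      (ENNReal.tendsto_pow_atTop_nhds_zero_of_lt_one
        (almostOrthRatio_lt_one hε (by linarith))) (Or.inr ?_))
    exact ENNReal.mul_ne_top (ENNReal.mul_ne_top (by simp) hCtop) hfq.2.ne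
  rw [mul_zero, add_zero] at hlim
  exact ge_of_tendsto' hlim hN

end IsLPKernel

/-! ### From single scales to the integral over all scales. -/

theorem Ioi_zero_subset_iUnion_Ico : Ioi (0 : ℝ) ⊆ ⋃ j : ℤ, Ico ((2 : ℝ) ^ j) (2 ^ (j + 1)) := by
  intro x hx
  obtain ⟨j, hj⟩ := exists_mem_Ico_zpow (y := (2 : ℝ)) hx (by norm_num)
  exact mem_iUnion.2 ⟨j, hj⟩

/-- The square of the $L^1$ growth $\lambda^{n/2}$ reduces $d\lambda/\lambda^{n+1}$ to
$d\lambda/\lambda$, which gives each dyadic interval mass at most 1. Only upper bounds are taken, so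
`G` may be arbitrary. -/
theorem lintegral_scaleMeasure_le (n : ℕ) {G : ℝ → ℝ≥0∞} {T : ℤ → ℝ≥0∞}
    (hG : ∀ j : ℤ, ∀ lam ∈ Ico ((2 : ℝ) ^ j) (2 ^ (j + 1)), G lam ≤ scaleFactor n lam ^ 2 * T j) :
    ∫⁻ lam, G lam ∂scaleMeasure n ≤ ∑' j, T j := by
  have hdens : Measurable fun lam : ℝ => ENNReal.ofReal ((lam ^ (n + 1))⁻¹) := by fun_prop
  refine (lintegral_withDensity_le_lintegral_mul _ hdens _).trans ?_
  refine (lintegral_mono_set Ioi_zero_subset_iUnion_Ico).trans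
    ((lintegral_iUnion_le _ _).trans (ENNReal.tsum_le_tsum fun j => ?_))
  have hpt : ∀ lam ∈ Ico ((2 : ℝ) ^ j) (2 ^ (j + 1)),
      ((fun lam : ℝ => ENNReal.ofReal ((lam ^ (n + 1))⁻¹)) * G) lam
        ≤ ENNReal.ofReal ((2 ^ j)⁻¹) * T j := by
    intro lam hlam
    have h0 : 0 < lam := lt_of_lt_of_le (by positivity) hlam.1
    calc ENNReal.ofReal ((lam ^ (n + 1))⁻¹) * G lam
        ≤ ENNReal.ofReal ((lam ^ (n + 1))⁻¹) * (scaleFactor n lam ^ 2 * T j) := by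
          gcongr
          exact hG j lam hlam
      _ = ENNReal.ofReal lam⁻¹ * T j := by
          rw [← mul_assoc, scaleFactor, ← ENNReal.ofReal_pow (by positivity),
            ← ENNReal.ofReal_mul (by positivity)]
          congr 2
          rw [← Real.rpow_natCast (lam ^ ((n : ℝ) / 2)), ← Real.rpow_mul h0.le,
            show (n : ℝ) / 2 * (2 : ℕ) = n by push_cast; ring, Real.rpow_natCast]
          field_simp
          ring
      _ ≤ _ := by
          gcongr
          exact hlam.1
  refine (setLIntegral_mono measurable_const hpt).trans ?_
  rw [setLIntegral_const, Real.volume_Ico, zpow_add_one₀ two_ne_zero, mul_right_comm,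
    ← ENNReal.ofReal_mul (by positivity)]
  have h2 : ((2 : ℝ) ^ j)⁻¹ * (2 ^ j * 2 - 2 ^ j) = 1 := by
    have : (2 : ℝ) ^ j ≠ 0 := by positivity
    field_simp
    norm_num
  rw [h2, ENNReal.ofReal_one, one_mul]

/-- The constant of the Littlewood–Paley estimate. -/
def lpConst (n : ℕ) (ε q : ℝ) : ℝ≥0∞ :=
  almostOrthConst n ε q ^ 2 * (2 * (1 - almostOrthRatio ε q)⁻¹) ^ 2 * squareConst q

theorem lpConst_ne_top {ε q : ℝ} (hε : 0 < ε) (hq : 1 < q) : lpConst n ε q ≠ ∞ := by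
  have hq0 : 0 < q := by linarith
  refine ENNReal.mul_ne_top (ENNReal.mul_ne_top
    (ENNReal.pow_ne_top (almostOrthConst_ne_top hε hq0)) (ENNReal.pow_ne_top
    (ENNReal.mul_ne_top (by simp) ?_))) (squareConst_ne_top hq)
  rw [ENNReal.inv_ne_top]
  exact (tsub_pos_of_lt (almostOrthRatio_lt_one hε hq0)).ne'

/-- The mixed norm Littlewood–Paley estimate for `1 < q < 2`. -/
theorem IsLPKernel.lintegral_eLpNorm_conv_sq_le {ε B q : ℝ} {φ : Euc n → ℂ} (hq₁ : 1 < q)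
    (hq₂ : q < 2) (hε : 0 < ε) (hε1 : ε ≤ 1) (h : IsLPKernel ε B φ) {f : Euc n → ℂ}
    (hf : Measurable f) (hfq : MemLp f (ENNReal.ofReal q)) :
    ∫⁻ lam, eLpNorm (conv f (dilate φ lam)) (ENNReal.ofReal q) volume ^ 2 ∂scaleMeasure n
      ≤ ENNReal.ofReal B ^ 2 * lpConst n ε q * eLpNorm f (ENNReal.ofReal q) volume ^ 2 := by
  set r := almostOrthRatio ε q with hr
  set b : ℤ → ℝ≥0∞ := fun k => eLpNorm (gridDiff k f) (ENNReal.ofReal q) volume with hb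
  set A := ENNReal.ofReal B * almostOrthConst n ε q with hA
  calc ∫⁻ lam, eLpNorm (conv f (dilate φ lam)) (ENNReal.ofReal q) volume ^ 2 ∂scaleMeasure n
      ≤ ∑' j : ℤ, A ^ 2 * (∑' k : ℤ, r ^ (k - j).natAbs * b k) ^ 2 := by
        refine lintegral_scaleMeasure_le n fun j lam hlam => ?_
        rw [← mul_pow, ← mul_pow]
        gcongr
        refine (h.eLpNorm_conv_le_tsum hq₁.le hε hε1 hlam hf hfq).trans (le_of_eq ?_)
        rw [hA]
        ring
    _ ≤ A ^ 2 * ((2 * (1 - r)⁻¹) ^ 2 * (squareConst q *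
          eLpNorm f (ENNReal.ofReal q) volume ^ 2)) := by
        rw [ENNReal.tsum_mul_left]
        gcongr
        refine (tsum_sq_convolution_le (fun i => r ^ i.natAbs) b).trans ?_
        gcongr
        · exact tsum_int_pow_natAbs_le r
        · exact tsum_eLpNorm_gridDiff_sq_le hq₁ hq₂ hf hfq
    _ = _ := by
        rw [lpConst, hA]
        ring

/-! ### Kernels with decaying derivatives -/

theorem one_add_norm_rpow_le {t : ℝ} (ht : 0 ≤ t) {x z : Euc n} (h : 1 + ‖x‖ ≤ 2 * (1 + ‖z‖)) :
    (1 + ‖z‖) ^ (-t) ≤ 2 ^ t * (1 + ‖x‖) ^ (-t) := by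
  have hz : 0 < 1 + ‖z‖ := by positivity
  have hx : 0 < 1 + ‖x‖ := by positivity
  rw [Real.rpow_neg hz.le, Real.rpow_neg hx.le, ← div_eq_mul_inv, le_div_iff₀ (by positivity),
    inv_mul_le_iff₀ (by positivity), ← Real.mul_rpow hz.le (by norm_num), mul_comm _ (2 : ℝ)]
  exact Real.rpow_le_rpow hx.le h ht

/-- The mean value inequality on the unit ball around $x$. There $1+\|x\|\le2(1+\|z\|)$, and
comparing the decay at $z$ with that at $x$ costs $2^{n+\varepsilon}$. -/
theorem IsLPKernel.of_fderiv {ε B : ℝ} (hε : 0 < ε) (hB : 0 ≤ B) {φ : Euc n → ℂ}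
    (hd : Differentiable ℝ φ) (h0 : ∫ x, φ x = 0)
    (hb : ∀ x, ‖φ x‖ ≤ B * (1 + ‖x‖) ^ (-((n : ℝ) + ε)))
    (hb' : ∀ x, ‖fderiv ℝ φ x‖ ≤ B * (1 + ‖x‖) ^ (-((n : ℝ) + ε))) :
    IsLPKernel ε (2 ^ ((n : ℝ) + ε) * B) φ := by
  have ht : 0 ≤ (n : ℝ) + ε := by positivity
  refine ⟨hd.continuous, h0, fun x => (hb x).trans ?_, fun x v hv => ?_⟩
  · gcongr
    exact le_mul_of_one_le_left hB (Real.one_le_rpow (by norm_num) ht)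
  · have hball : ∀ z ∈ Metric.closedBall x 1, ‖fderiv ℝ φ z‖
        ≤ 2 ^ ((n : ℝ) + ε) * B * (1 + ‖x‖) ^ (-((n : ℝ) + ε)) := by
      intro z hz
      rw [mem_closedBall_iff_norm'] at hz
      have h1 : 1 + ‖x‖ ≤ 2 * (1 + ‖z‖) := by
        have := norm_le_norm_add_norm_sub z x
        rw [norm_sub_rev] at this
        linarith [norm_nonneg z]
      refine (hb' z).trans ?_
      rw [mul_right_comm, mul_comm]
      gcongr
      exact one_add_norm_rpow_le ht h1
    have := (convex_closedBall x 1).norm_image_sub_le_of_norm_fderiv_le (f := φ) (𝕜 := ℝ)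
      (fun z _ => hd z) hball (x := x - v) (y := x)
      (by rw [mem_closedBall_iff_norm]; simpa using hv) (Metric.mem_closedBall_self zero_le_one)
    rw [sub_sub_cancel] at this
    linarith

theorem IsLPKernel.mono {ε B B' : ℝ} {φ : Euc n → ℂ} (h : IsLPKernel ε B φ) (hB : B ≤ B') :
    IsLPKernel ε B' φ :=
  ⟨h.continuous, h.integral_eq_zero, fun x => (h.bound x).trans (by gcongr),
    fun x v hv => (h.lipschitz x v hv).trans (by gcongr)⟩

theorem IsLPKernel.integrable {ε B : ℝ} {φ : Euc n → ℂ} (hε : 0 < ε) (h : IsLPKernel ε B φ) :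
    Integrable φ :=
  ⟨h.continuous.aestronglyMeasurable, (h.lintegral_le hε).trans_lt
    (ENNReal.mul_lt_top ENNReal.ofReal_lt_top (decayIntegral_ne_top hε).lt_top)⟩

theorem IsLPKernel.sub {ε B B' : ℝ} {φ φ' : Euc n → ℂ} (hε : 0 < ε) (h : IsLPKernel ε B φ)
    (h' : IsLPKernel ε B' φ') : IsLPKernel ε (B + B') (fun x => φ x - φ' x) := by
  refine ⟨h.continuous.sub h'.continuous, ?_, fun x => ?_, fun x v hv => ?_⟩
  · rw [integral_sub (h.integrable hε) (h'.integrable hε), h.integral_eq_zero,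
      h'.integral_eq_zero, sub_zero]
  · rw [add_mul]
    exact (norm_sub_le _ _).trans (add_le_add (h.bound x) (h'.bound x))
  · rw [sub_sub_sub_comm, add_mul, add_mul]
    exact (norm_sub_le _ _).trans (add_le_add (h.lipschitz x v hv) (h'.lipschitz x v hv))

/-! ### The difference between a wavelet and its rescaling. -/

/-- The `L¹`-normalized dilation `x ↦ μ ^ n ψ (μ x)`. -/
def rescale (μ : ℝ) (ψ : Euc n → ℂ) : Euc n → ℂ := fun x => ((μ ^ n : ℝ) : ℂ) * ψ (μ • x)

/-- The mean value inequality in the dilation parameter. The chain rule produces $DG(\nu x)x$, whose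
factor $\|x\|$ uses up one power of decay; hence the exponent $t+1$ for the derivative. It is
applied to $\psi$ with $k=n$ and to $D\psi$ with $k=n+1$. -/
theorem norm_sub_pow_smul_comp_smul_le {V : Type*} [NormedAddCommGroup V] [NormedSpace ℝ V]
    {t M : ℝ} (ht : 0 ≤ t) (hM : 0 ≤ M) {G : Euc n → V} (hG : Differentiable ℝ G)
    (hb : ∀ z, ‖G z‖ ≤ M * (1 + ‖z‖) ^ (-t))
    (hb' : ∀ z w, ‖fderiv ℝ G z w‖ ≤ M * ‖w‖ * (1 + ‖z‖) ^ (-(t + 1)))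
    (k : ℕ) {μ : ℝ} (hμ : μ ∈ Icc (1 / 2 : ℝ) 2) (x : Euc n) :
    ‖G x - μ ^ k • G (μ • x)‖
      ≤ (k + 2) * 2 ^ k * M * 2 ^ t * |μ - 1| * (1 + ‖x‖) ^ (-t) := by
  have hder (ν : ℝ) : HasDerivAt (fun ν : ℝ => ν ^ k • G (ν • x))
      (ν ^ k • fderiv ℝ G (ν • x) x + (k * ν ^ (k - 1)) • G (ν • x)) ν := by
    have h1 : HasDerivAt (fun ν : ℝ => ν • x) x ν := by
      simpa using (hasDerivAt_id ν).smul_const x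
    have h2 : HasDerivAt (fun ν : ℝ => G (ν • x)) (fderiv ℝ G (ν • x) x) ν :=
      (hG (ν • x)).hasFDerivAt.comp_hasDerivAt ν h1
    exact (hasDerivAt_pow k ν).smul h2
  have hbound : ∀ ν ∈ Icc (1 / 2 : ℝ) 2,
      ‖ν ^ k • fderiv ℝ G (ν • x) x + (k * ν ^ (k - 1)) • G (ν • x)‖
        ≤ (k + 2) * 2 ^ k * M * 2 ^ t * (1 + ‖x‖) ^ (-t) := by
    intro ν hν
    have hν0 : 0 < ν := by linarith [hν.1]
    set z := ν • x with hz
    have hzx : ‖z‖ = ν * ‖x‖ := by rw [hz, norm_smul, Real.norm_of_nonneg hν0.le]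
    have hxn := norm_nonneg x
    have h1 : ‖x‖ ≤ 2 * (1 + ‖z‖) := by rw [hzx]; nlinarith [hν.1]
    have h1' : 1 + ‖x‖ ≤ 2 * (1 + ‖z‖) := by rw [hzx]; nlinarith [hν.1]
    have hz1 : 0 < 1 + ‖z‖ := by positivity
    have h2 : ‖fderiv ℝ G z x‖ ≤ 2 * M * (1 + ‖z‖) ^ (-t) := by
      refine (hb' z x).trans ?_
      calc M * ‖x‖ * (1 + ‖z‖) ^ (-(t + 1))
          ≤ M * (2 * (1 + ‖z‖)) * (1 + ‖z‖) ^ (-(t + 1)) := by gcongr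
        _ = 2 * M * ((1 + ‖z‖) ^ (-(t + 1)) * (1 + ‖z‖)) := by ring
        _ = _ := by
            rw [← Real.rpow_add_one hz1.ne']
            congr 2
            ring
    have h3 : ν ^ k ≤ 2 ^ k := pow_le_pow_left₀ hν0.le hν.2 k
    have h4 : ν ^ (k - 1) ≤ 2 ^ k :=
      (pow_le_pow_left₀ hν0.le hν.2 _).trans (pow_le_pow_right₀ (by norm_num) (Nat.sub_le k 1))
    calc ‖ν ^ k • fderiv ℝ G z x + (k * ν ^ (k - 1)) • G z‖
        ≤ ν ^ k * ‖fderiv ℝ G z x‖ + (k * ν ^ (k - 1)) * ‖G z‖ := by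
          refine (norm_add_le _ _).trans (le_of_eq ?_)
          rw [norm_smul, norm_smul, Real.norm_of_nonneg (by positivity),
            Real.norm_of_nonneg (by positivity)]
      _ ≤ 2 ^ k * (2 * M * (1 + ‖z‖) ^ (-t)) + (k * 2 ^ k) * (M * (1 + ‖z‖) ^ (-t)) := by
          gcongr
          exact hb z
      _ = (k + 2) * 2 ^ k * M * (1 + ‖z‖) ^ (-t) := by ring
      _ ≤ (k + 2) * 2 ^ k * M * (2 ^ t * (1 + ‖x‖) ^ (-t)) := by
          gcongr
          exact one_add_norm_rpow_le ht h1'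
      _ = _ := by ring
  have h := (convex_Icc (1 / 2 : ℝ) 2).norm_image_sub_le_of_norm_hasDerivWithin_le
    (fun ν _ => (hder ν).hasDerivWithinAt) hbound hμ (⟨by norm_num, by norm_num⟩ :
      (1 : ℝ) ∈ Icc (1 / 2 : ℝ) 2)
  simp only [one_pow, one_smul] at h
  rw [Real.norm_eq_abs, abs_sub_comm] at h
  refine h.trans (le_of_eq ?_)
  ring

namespace HasDecay

variable {A α β κ : ℝ} {ψ : Euc n → ℂ}

theorem const_nonneg (h : HasDecay A α β κ ψ) : 0 ≤ A := by
  have := (norm_nonneg _).trans (h.decay 0)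
  simpa using this

theorem div_rpow_le (hA : 0 ≤ A) {s t : ℝ} (hst : t ≤ s) (x : Euc n) :
    A / (1 + ‖x‖) ^ s ≤ A * (1 + ‖x‖) ^ (-t) := by
  rw [Real.rpow_neg (by positivity), ← div_eq_mul_inv]
  gcongr
  linarith [norm_nonneg x]

/-- The decay hypothesis concerns single second-order partials; expanding in the standard basis,
$n^2$ of them bound the operator norm. -/
theorem norm_fderiv_fderiv_apply_le (h : HasDecay A α β κ ψ) (x w : Euc n) :
    ‖fderiv ℝ (fderiv ℝ ψ) x w‖ ≤ (n : ℝ) ^ 2 * (A / (1 + ‖x‖) ^ ((n : ℝ) + 1 + κ)) * ‖w‖ := by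
  set H := A / (1 + ‖x‖) ^ ((n : ℝ) + 1 + κ) with hH
  have hH0 : 0 ≤ H := div_nonneg h.const_nonneg (by positivity)
  refine ContinuousLinearMap.opNorm_le_bound _ (by positivity) fun u => ?_
  set D := fderiv ℝ (fderiv ℝ ψ) x with hD
  have hsum (v : Euc n) : v = ∑ i, v i • EuclideanSpace.single i (1 : ℝ) := by
    have := (EuclideanSpace.basisFun (Fin n) ℝ).sum_repr v
    simpa using this.symm
  have h1 : D w u = ∑ i, ∑ j, w i • u j •
      D (EuclideanSpace.single i 1) (EuclideanSpace.single j 1) := by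
    conv_lhs => rw [hsum w, hsum u]
    simp only [map_sum, map_smul, sum_apply, smul_apply, Finset.smul_sum]
    rw [Finset.sum_comm]
    exact Finset.sum_congr rfl fun i _ => Finset.sum_congr rfl fun j _ => smul_comm _ _ _
  rw [h1]
  calc _ ≤ ∑ i : Fin n, ∑ j : Fin n, ‖w‖ * (‖u‖ * H) := by
        refine norm_sum_le_of_le _ fun i _ => norm_sum_le_of_le _ fun j _ => ?_
        rw [norm_smul, norm_smul]
        gcongr
        · exact PiLp.norm_apply_le w i
        · exact PiLp.norm_apply_le u j
        · exact h.decay_hess x i j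
    _ = _ := by
        simp
        ring

/-- The exponent of the kernels attached to a decaying wavelet. -/
def exponent (β κ : ℝ) : ℝ := min 1 (min β κ)

theorem exponent_pos (hβ : 0 < β) (hκ : 0 < κ) : 0 < exponent β κ :=
  lt_min one_pos (lt_min hβ hκ)

theorem exponent_le_one (β κ : ℝ) : exponent β κ ≤ 1 := min_le_left _ _

theorem exponent_le_left (β κ : ℝ) : exponent β κ ≤ β := (min_le_right _ _).trans (min_le_left _ _)

theorem exponent_le_right (β κ : ℝ) : exponent β κ ≤ κ :=
  (min_le_right _ _).trans (min_le_right _ _)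

theorem isLPKernel (hα : 0 < α) (hβ : 0 < β) (hκ : 0 < κ) (h : HasDecay A α β κ ψ)
    (h0 : ∫ x, ψ x = 0) :
    IsLPKernel (exponent β κ) (2 ^ ((n : ℝ) + exponent β κ) * A) ψ := by
  have h1 := exponent_le_one β κ
  refine IsLPKernel.of_fderiv (exponent_pos hβ hκ) h.const_nonneg h.differentiable h0
    (fun x => (h.decay x).trans (div_rpow_le h.const_nonneg (by linarith) x))
    (fun x => (h.decay_grad x).trans (div_rpow_le h.const_nonneg (by linarith) x))

/-- The constant of the kernel `ψ - rescale μ ψ`. -/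
def diffConst (n : ℕ) (A β κ : ℝ) : ℝ :=
  2 ^ ((n : ℝ) + exponent β κ) *
    ((n + 3) * 2 ^ (n + 1) * (((n : ℝ) ^ 2 + 1) * A) * 2 ^ ((n : ℝ) + exponent β κ))

/-- Differentiating the rescaling in $\mu$ brings in $\|x\|\,|\nabla\psi|$, and for the gradient
$\|x\|\,|D^2\psi|$. After the loss of one power the decay is still $n+\beta$ and $n+\kappa$, both at
least $n+\varepsilon$, so the difference obeys the kernel bounds with an additional factor
$|\mu-1|$. -/
theorem isLPKernel_sub_rescale (hα : 0 < α) (hβ : 0 < β) (hκ : 0 < κ) (h : HasDecay A α β κ ψ)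
    (hi : Integrable ψ) (h0 : ∫ x, ψ x = 0) {μ : ℝ} (hμ : μ ∈ Icc (1 / 2 : ℝ) 2) :
    IsLPKernel (exponent β κ) (diffConst n A β κ * |μ - 1|) (fun x => ψ x - rescale μ ψ x) := by
  have hA := h.const_nonneg
  have hε := exponent_pos hβ hκ
  have hε1 := exponent_le_one β κ
  have hεβ := exponent_le_left β κ
  have hεκ := exponent_le_right β κ
  set ε := exponent β κ with hεdef
  have hμ0 : μ ≠ 0 := by have := hμ.1; positivity
  have ht : 0 ≤ (n : ℝ) + ε := by positivity
  have hM : A ≤ ((n : ℝ) ^ 2 + 1) * A := le_mul_of_one_le_left hA (by nlinarith [sq_nonneg (n : ℝ)])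
  have hψμ (x : Euc n) : rescale μ ψ x = μ ^ n • ψ (μ • x) := by
    rw [rescale, Complex.real_smul]
  have hdμ : Differentiable ℝ fun x : Euc n => ψ (μ • x) :=
    h.differentiable.comp (differentiable_id.const_smul μ)
  have hdr : Differentiable ℝ (rescale μ ψ) := by
    have : rescale μ ψ = fun x => μ ^ n • ψ (μ • x) := funext hψμ
    rw [this]
    exact hdμ.const_smul (μ ^ n)
  have hfd (x : Euc n) : fderiv ℝ (fun x => ψ x - rescale μ ψ x) x
      = fderiv ℝ ψ x - μ ^ (n + 1) • fderiv ℝ ψ (μ • x) := by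
    rw [fderiv_fun_sub (h.differentiable x) (hdr x)]
    rw [show rescale μ ψ = fun x => μ ^ n • ψ (μ • x) from funext hψμ, fderiv_fun_const_smul (hdμ x), fderiv_comp_smul, smul_smul, pow_succ]
  have hC : diffConst n A β κ * |μ - 1| = 2 ^ ((n : ℝ) + ε) *
      ((n + 3) * 2 ^ (n + 1) * (((n : ℝ) ^ 2 + 1) * A) * 2 ^ ((n : ℝ) + ε) * |μ - 1|) := by
    rw [diffConst, mul_assoc]
  rw [hC]
  refine IsLPKernel.of_fderiv hε (by positivity) (h.differentiable.sub hdr) ?_ (fun x => ?_)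
    fun x => ?_
  · have hir : Integrable (rescale μ ψ) := (hi.comp_smul hμ0).const_mul _
    rw [integral_sub hi hir, h0]
    simp only [rescale]
    rw [integral_const_mul, Measure.integral_comp_smul, h0]
    simp
  · rw [hψμ]
    refine (norm_sub_pow_smul_comp_smul_le ht hA h.differentiable
      (fun z => (h.decay z).trans (div_rpow_le hA (by linarith) z)) (fun z w => ?_) n hμ
      x).trans ?_
    · refine (ContinuousLinearMap.le_opNorm _ w).trans ?_
      rw [mul_right_comm]
      gcongr
      exact (h.decay_grad z).trans (div_rpow_le (t := (n : ℝ) + ε + 1) hA (by linarith) z)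
    · gcongr
      · norm_num
      · norm_num
      · omega
  · rw [hfd]
    refine (norm_sub_pow_smul_comp_smul_le ht (by positivity : 0 ≤ ((n : ℝ) ^ 2 + 1) * A)
      h.differentiable_fderiv (fun z => ?_) (fun z w => ?_) (n + 1) hμ x).trans (le_of_eq ?_)
    · refine (h.decay_grad z).trans ((div_rpow_le (t := (n : ℝ) + ε) hA (by linarith) z).trans ?_)
      gcongr
    · refine (h.norm_fderiv_fderiv_apply_le z w).trans ?_
      have h1 : A / (1 + ‖z‖) ^ ((n : ℝ) + 1 + κ) ≤ A * (1 + ‖z‖) ^ (-((n : ℝ) + ε + 1)) :=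
        div_rpow_le hA (by linarith) z
      calc _ ≤ ((n : ℝ) ^ 2 + 1) * (A * (1 + ‖z‖) ^ (-((n : ℝ) + ε + 1))) * ‖w‖ := by
            gcongr
            linarith
        _ = _ := by ring
    · push_cast
      ring

end HasDecay

/-! ### The measure on scales -/

instance : SigmaFinite (scaleMeasure n) := by
  unfold scaleMeasure
  infer_instance

theorem ae_scaleMeasure_pos : ∀ᵐ lam ∂scaleMeasure n, 0 < lam :=
  (withDensity_absolutelyContinuous _ _).ae_le (ae_restrict_mem measurableSet_Ioi)

theorem ae_scaleMeasurePi_pos (m : ℕ) : ∀ᵐ lam ∂scaleMeasurePi n m, ∀ i, 0 < lam i := by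
  rw [ae_all_iff]
  intro i
  exact (Measure.quasiMeasurePreserving_eval (fun _ : Fin m => scaleMeasure n) i).ae
    ae_scaleMeasure_pos

/-- The last scale is singled out and integrated innermost because `cascade` adds new layers at the
end. -/
theorem lintegral_scaleMeasurePi_succ {m : ℕ} {F : (Fin m → ℝ) → ℝ → ℝ≥0∞}
    (hF : Measurable (Function.uncurry F)) :
    ∫⁻ lam, F (Fin.init lam) (lam (Fin.last m)) ∂scaleMeasurePi n (m + 1)
      = ∫⁻ a, ∫⁻ t, F a t ∂scaleMeasure n ∂scaleMeasurePi n m := by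
  have h := measurePreserving_piFinSuccAbove (fun _ : Fin (m + 1) => scaleMeasure n) (Fin.last m)
  have h2 := h.lintegral_comp_emb (MeasurableEquiv.measurableEmbedding _)
    (fun p : ℝ × (Fin m → ℝ) => F p.2 p.1)
  have h3 : ∀ lam : Fin (m + 1) → ℝ, (fun p : ℝ × (Fin m → ℝ) => F p.2 p.1)
      (MeasurableEquiv.piFinSuccAbove (fun _ => ℝ) (Fin.last m) lam)
      = F (Fin.init lam) (lam (Fin.last m)) := by
    intro lam
    simp [MeasurableEquiv.piFinSuccAbove, Fin.insertNthEquiv, Fin.removeNth_last]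
  simp_rw [h3] at h2
  have hs : Measurable fun p : ℝ × (Fin m → ℝ) => F p.2 p.1 := hF.comp measurable_swap
  rw [scaleMeasurePi, h2, lintegral_prod_symm' _ hs]
  rfl

/-! ### Cascades -/

theorem conv_congr_ae {f g : Euc n → ℂ} (h : f =ᵐ[volume] g) (Φ : Euc n → ℂ) :
    conv f Φ = conv g Φ := by
  funext x
  rw [conv_apply, conv_apply]
  refine integral_congr_ae ?_
  filter_upwards [h] with t ht
  rw [ht]

theorem cascade_succ (ψ : Euc n → ℂ) (m : ℕ) (lam : Fin (m + 1) → ℝ) (f : Euc n → ℂ) (x : Euc n) :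
    cascade ψ (m + 1) lam f x = ((‖conv (cascade ψ m (Fin.init lam) f)
      (dilate ψ (lam (Fin.last m))) x‖ : ℝ) : ℂ) := rfl

theorem cascade_congr_ae (ψ : Euc n → ℂ) {f g : Euc n → ℂ} (h : f =ᵐ[volume] g) (m : ℕ)
    (lam : Fin m → ℝ) : cascade ψ m lam f =ᵐ[volume] cascade ψ m lam g := by
  induction m with
  | zero => exact h
  | succ m ih =>
    refine Filter.Eventually.of_forall fun x => ?_
    rw [cascade_succ, cascade_succ, conv_congr_ae (ih (Fin.init lam))]

theorem measurable_uncurry_dilate {ψ : Euc n → ℂ} (hψ : Measurable ψ) :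
    Measurable fun p : ℝ × Euc n => dilate ψ p.1 p.2 := by
  unfold dilate
  fun_prop

theorem measurable_fin_init (m : ℕ) :
    Measurable (Fin.init : (Fin (m + 1) → ℝ) → (Fin m → ℝ)) :=
  measurable_pi_iff.2 fun i => measurable_pi_apply i.castSucc

theorem measurable_uncurry_conv_dilate {ψ : Euc n → ℂ} (hψ : Measurable ψ) {X : Type*}
    [MeasurableSpace X] {u : X → Euc n → ℂ} (hu : Measurable (Function.uncurry u)) :
    Measurable fun p : (X × ℝ) × Euc n => conv (u p.1.1) (dilate ψ p.1.2) p.2 := by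
  have hm : Measurable (Function.uncurry fun (p : (X × ℝ) × Euc n) (t : Euc n) =>
      u p.1.1 t * dilate ψ p.1.2 (p.2 - t)) := by
    refine Measurable.mul ?_ ?_
    · exact hu.comp (f := fun r : ((X × ℝ) × Euc n) × Euc n => (r.1.1.1, r.2)) (by fun_prop)
    · exact (measurable_uncurry_dilate hψ).comp
        (f := fun r : ((X × ℝ) × Euc n) × Euc n => (r.1.1.2, r.1.2 - r.2)) (by fun_prop)
  exact (hm.stronglyMeasurable.integral_prod_right).measurable

theorem measurable_uncurry_cascade {ψ : Euc n → ℂ} (hψ : Measurable ψ) {f : Euc n → ℂ}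
    (hf : Measurable f) (m : ℕ) :
    Measurable (Function.uncurry fun (lam : Fin m → ℝ) (x : Euc n) => cascade ψ m lam f x) := by
  induction m with
  | zero => exact hf.comp measurable_snd
  | succ m ih =>
    have h := (measurable_uncurry_conv_dilate hψ ih).comp
      (f := fun p : (Fin (m + 1) → ℝ) × Euc n => ((Fin.init p.1, p.1 (Fin.last m)), p.2))
      ((((measurable_fin_init m).comp measurable_fst).prodMk
        ((measurable_pi_apply _).comp measurable_fst)).prodMk measurable_snd)
    exact Complex.measurable_ofReal.comp h.norm

theorem measurable_cascade {ψ : Euc n → ℂ} (hψ : Measurable ψ) {f : Euc n → ℂ}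
    (hf : Measurable f) (m : ℕ) (lam : Fin m → ℝ) : Measurable (cascade ψ m lam f) :=
  (measurable_uncurry_cascade hψ hf m).comp measurable_prodMk_left

theorem measurable_eLpNorm_ofReal {X : Type*} [MeasurableSpace X] {q : ℝ} (hq : 0 < q)
    {u : X → Euc n → ℂ} (hu : Measurable (Function.uncurry u)) :
    Measurable fun a => eLpNorm (u a) (ENNReal.ofReal q) volume := by
  simp_rw [eLpNorm_ofReal_eq hq]
  have : Measurable (Function.uncurry fun a x => ‖u a x‖ₑ ^ q) := hu.enorm.pow_const q
  exact (this.lintegral_prod_right').pow_const _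

theorem eLpNorm_cascade_succ (ψ : Euc n → ℂ) (m : ℕ) (lam : Fin (m + 1) → ℝ) (f : Euc n → ℂ)
    (p : ℝ≥0∞) : eLpNorm (cascade ψ (m + 1) lam f) p volume
      = eLpNorm (conv (cascade ψ m (Fin.init lam) f) (dilate ψ (lam (Fin.last m)))) p volume := by
  refine eLpNorm_congr_norm_ae (Filter.Eventually.of_forall fun x => ?_)
  rw [cascade_succ, Complex.norm_real, norm_norm]

/-! ### Norm bounds for cascades. -/

namespace IsLPKernel

variable {ε B q : ℝ} {φ : Euc n → ℂ}

theorem memLp_conv_dilate (hq : 1 ≤ q) (hε : 0 < ε) (h : IsLPKernel ε B φ) {lam : ℝ}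
    (hlam : 0 < lam) {f : Euc n → ℂ} (hf : Measurable f) (hfq : MemLp f (ENNReal.ofReal q)) :
    MemLp (conv f (dilate φ lam)) (ENNReal.ofReal q) := by
  have hdm := measurable_dilate h.continuous.measurable lam
  refine ⟨(measurable_conv hf hdm).aestronglyMeasurable, ?_⟩
  exact (eLpNorm_conv_le hq hf hdm).trans_lt
    (ENNReal.mul_lt_top (h.lintegral_dilate_ne_top hε hlam).lt_top hfq.2)

theorem memLp_cascade (hq : 1 ≤ q) (hε : 0 < ε) (h : IsLPKernel ε B φ) {m : ℕ}
    {lam : Fin m → ℝ} (hlam : ∀ i, 0 < lam i) {f : Euc n → ℂ} (hf : Measurable f)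
    (hfq : MemLp f (ENNReal.ofReal q)) :
    MemLp (cascade φ m lam f) (ENNReal.ofReal q) := by
  have hφ := h.continuous.measurable
  induction m with
  | zero => exact hfq
  | succ m ih =>
    refine ⟨(measurable_cascade hφ hf _ _).aestronglyMeasurable, ?_⟩
    rw [eLpNorm_cascade_succ]
    exact (h.memLp_conv_dilate hq hε (hlam _) (measurable_cascade hφ hf _ _)
      (ih fun i => hlam i.castSucc)).2

/-- The constant controlling one layer of a cascade. -/
def layerConst (n : ℕ) (ε q B : ℝ) : ℝ≥0∞ := ENNReal.ofReal B ^ 2 * lpConst n ε q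

/-- Each layer is the Littlewood–Paley estimate applied to the previous stage with its scales fixed;
the modulus does not change the norm. -/
theorem lintegral_eLpNorm_cascade_sq_le (hq₁ : 1 < q) (hq₂ : q < 2) (hε : 0 < ε) (hε1 : ε ≤ 1)
    (h : IsLPKernel ε B φ) {f : Euc n → ℂ} (hf : Measurable f)
    (hfq : MemLp f (ENNReal.ofReal q)) (m : ℕ) :
    ∫⁻ lam, eLpNorm (cascade φ m lam f) (ENNReal.ofReal q) volume ^ 2 ∂scaleMeasurePi n m
      ≤ layerConst n ε q B ^ m * eLpNorm f (ENNReal.ofReal q) volume ^ 2 := by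
  have hφ := h.continuous.measurable
  have hq0 : 0 < q := by linarith
  induction m with
  | zero =>
    simp only [cascade, lintegral_const, scaleMeasurePi]
    simp
  | succ m ih =>
    have hF : Measurable (Function.uncurry fun (a : Fin m → ℝ) (t : ℝ) =>
        eLpNorm (conv (cascade φ m a f) (dilate φ t)) (ENNReal.ofReal q) volume ^ 2) :=
      (measurable_eLpNorm_ofReal hq0 (u := fun (p : (Fin m → ℝ) × ℝ) x =>
        conv (cascade φ m p.1 f) (dilate φ p.2) x)
        (measurable_uncurry_conv_dilate hφ (measurable_uncurry_cascade hφ hf m))).pow_const 2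
    simp_rw [eLpNorm_cascade_succ]
    rw [lintegral_scaleMeasurePi_succ hF]
    calc _ ≤ ∫⁻ a, layerConst n ε q B *
          eLpNorm (cascade φ m a f) (ENNReal.ofReal q) volume ^ 2 ∂scaleMeasurePi n m := by
          refine lintegral_mono_ae ?_
          filter_upwards [ae_scaleMeasurePi_pos m] with a ha
          exact h.lintegral_eLpNorm_conv_sq_le hq₁ hq₂ hε hε1 (measurable_cascade hφ hf _ _)
            (h.memLp_cascade hq₁.le hε ha hf hfq)
      _ ≤ layerConst n ε q B * (layerConst n ε q B ^ m *
          eLpNorm f (ENNReal.ofReal q) volume ^ 2) := by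
          rw [lintegral_const_mul _ ((measurable_eLpNorm_ofReal hq0
            (measurable_uncurry_cascade hφ hf m)).pow_const 2)]
          gcongr
      _ = _ := by ring

/-! ### Comparison of the cascades of two kernels. -/

/-- The constant controlling the difference of two cascades. -/
def cascadeDiffConst (K : ℝ≥0∞) : ℕ → ℝ≥0∞
  | 0 => 0
  | m + 1 => 2 * K ^ m + 2 * K * cascadeDiffConst K m

theorem cascadeDiffConst_ne_top {K : ℝ≥0∞} (hK : K ≠ ∞) (m : ℕ) : cascadeDiffConst K m ≠ ∞ := by
  induction m with
  | zero => simp [cascadeDiffConst]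
  | succ m ih =>
    exact ENNReal.add_ne_top.2 ⟨ENNReal.mul_ne_top (by simp) (ENNReal.pow_ne_top hK),
      ENNReal.mul_ne_top (ENNReal.mul_ne_top (by simp) hK) ih⟩

theorem add_sq_le_two_mul (a b : ℝ≥0∞) : (a + b) ^ 2 ≤ 2 * a ^ 2 + 2 * b ^ 2 := by
  have h := ENNReal.rpow_add_le_mul_rpow_add_rpow a b (p := 2) (by norm_num)
  rw [show (2 : ℝ) - 1 = 1 by norm_num, ENNReal.rpow_one, mul_add] at h
  simpa only [ENNReal.rpow_ofNat] using h

/-- From $U*\varphi-U'*\varphi'=U*(\varphi-\varphi')+(U-U')*\varphi'$: either the kernel of the new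
layer is exchanged, or the earlier discrepancy is propagated. -/
theorem eLpNorm_cascade_sub_succ_le (hq : 1 ≤ q) (hε : 0 < ε) {φ' : Euc n → ℂ} {B' D : ℝ}
    (h : IsLPKernel ε B φ) (h' : IsLPKernel ε B' φ')
    (hd : IsLPKernel ε D fun x => φ x - φ' x) {f : Euc n → ℂ} (hf : Measurable f)
    (hfq : MemLp f (ENNReal.ofReal q)) {m : ℕ} {a : Fin m → ℝ} (ha : ∀ i, 0 < a i) {t : ℝ}
    (ht : 0 < t) :
    eLpNorm (fun x => conv (cascade φ m a f) (dilate φ t) x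
      - conv (cascade φ' m a f) (dilate φ' t) x) (ENNReal.ofReal q) volume
      ≤ eLpNorm (conv (cascade φ m a f) (dilate (fun x => φ x - φ' x) t)) (ENNReal.ofReal q) volume
        + eLpNorm (conv (fun x => cascade φ m a f x - cascade φ' m a f x) (dilate φ' t))
          (ENNReal.ofReal q) volume := by
  have hφ := h.continuous.measurable
  have hφ' := h'.continuous.measurable
  have hU := measurable_cascade hφ hf m a
  have hU' := measurable_cascade hφ' hf m a
  have hUq := h.memLp_cascade hq hε ha hf hfq
  have hUq' := h'.memLp_cascade hq hε ha hf hfq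
  refine le_trans (le_of_eq ?_) (eLpNorm_add_le
    (measurable_conv hU (measurable_dilate hd.continuous.measurable t)).aestronglyMeasurable
    (measurable_conv (hU.sub hU') (measurable_dilate hφ' t)).aestronglyMeasurable
    (by simpa using hq))
  congr 1
  funext x
  rw [Pi.add_apply, h'.conv_sub hq hε ht hU hUq hU' hUq']
  have h1 : conv (cascade φ m a f) (dilate (fun x => φ x - φ' x) t) x
      = conv (cascade φ m a f) (dilate φ t) x - conv (cascade φ m a f) (dilate φ' t) x := by
    simp only [conv_apply]
    rw [← integral_sub (h.integrable_conv_dilate hq hε ht hU hUq x)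
      (h'.integrable_conv_dilate hq hε ht hU hUq x)]
    simp only [dilate, mul_sub]
  rw [h1]
  ring

/-- Every contribution contains the difference kernel in exactly one layer, so its constant `D`
enters only through a single factor `layerConst n ε q D`, while the other layers contribute powers
of `K`. -/
theorem lintegral_eLpNorm_cascade_sub_sq_le (hq₁ : 1 < q) (hq₂ : q < 2) (hε : 0 < ε) (hε1 : ε ≤ 1)
    {φ' : Euc n → ℂ} {D : ℝ} (h : IsLPKernel ε B φ) (h' : IsLPKernel ε B φ')
    (hd : IsLPKernel ε D fun x => φ x - φ' x) {f : Euc n → ℂ} (hf : Measurable f)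
    (hfq : MemLp f (ENNReal.ofReal q)) (m : ℕ) :
    ∫⁻ lam, eLpNorm (fun x => cascade φ m lam f x - cascade φ' m lam f x)
      (ENNReal.ofReal q) volume ^ 2 ∂scaleMeasurePi n m
      ≤ layerConst n ε q D * cascadeDiffConst (layerConst n ε q B) m
        * eLpNorm f (ENNReal.ofReal q) volume ^ 2 := by
  have hφ := h.continuous.measurable
  have hφ' := h'.continuous.measurable
  have hdm := hd.continuous.measurable
  have hq0 : 0 < q := by linarith
  set K := layerConst n ε q B with hK
  set F := eLpNorm f (ENNReal.ofReal q) volume with hF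
  induction m with
  | zero => simp [cascade]
  | succ m ih =>
    have hUm := measurable_uncurry_cascade hφ hf m
    have hUm' := measurable_uncurry_cascade hφ' hf m
    have hsub : Measurable (Function.uncurry fun (a : Fin m → ℝ) (x : Euc n) =>
        cascade φ m a f x - cascade φ' m a f x) := hUm.sub hUm'
    have hm1 : Measurable (Function.uncurry fun (a : Fin m → ℝ) (t : ℝ) =>
        eLpNorm (conv (cascade φ m a f) (dilate (fun x => φ x - φ' x) t))
          (ENNReal.ofReal q) volume ^ 2) :=
      (measurable_eLpNorm_ofReal hq0 (u := fun (p : (Fin m → ℝ) × ℝ) x =>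
        conv (cascade φ m p.1 f) (dilate (fun x => φ x - φ' x) p.2) x)
        (measurable_uncurry_conv_dilate hdm hUm)).pow_const 2
    have hm2 : Measurable (Function.uncurry fun (a : Fin m → ℝ) (t : ℝ) =>
        eLpNorm (conv (fun x => cascade φ m a f x - cascade φ' m a f x) (dilate φ' t))
          (ENNReal.ofReal q) volume ^ 2) :=
      (measurable_eLpNorm_ofReal hq0 (u := fun (p : (Fin m → ℝ) × ℝ) x =>
        conv (fun x => cascade φ m p.1 f x - cascade φ' m p.1 f x) (dilate φ' p.2) x)
        (measurable_uncurry_conv_dilate hφ' hsub)).pow_const 2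
    have hpt : ∀ᵐ lam ∂scaleMeasurePi n (m + 1),
        eLpNorm (fun x => cascade φ (m + 1) lam f x - cascade φ' (m + 1) lam f x)
          (ENNReal.ofReal q) volume ^ 2
        ≤ 2 * (fun (a : Fin m → ℝ) (t : ℝ) =>
          eLpNorm (conv (cascade φ m a f) (dilate (fun x => φ x - φ' x) t))
          (ENNReal.ofReal q) volume ^ 2) (Fin.init lam) (lam (Fin.last m))
        + 2 * (fun (a : Fin m → ℝ) (t : ℝ) =>
          eLpNorm (conv (fun x => cascade φ m a f x - cascade φ' m a f x) (dilate φ' t))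
          (ENNReal.ofReal q) volume ^ 2) (Fin.init lam) (lam (Fin.last m)) := by
      filter_upwards [ae_scaleMeasurePi_pos (m + 1)] with lam hlam
      refine le_trans ?_ (add_sq_le_two_mul _ _)
      gcongr
      refine le_trans ?_ (h.eLpNorm_cascade_sub_succ_le hq₁.le hε h' hd hf hfq
        (fun i => hlam i.castSucc) (hlam (Fin.last m)))
      refine eLpNorm_mono fun x => ?_
      -- The modulus is 1-Lipschitz, so the difference of moduli is bounded by the difference of the
      -- convolutions.
      rw [cascade_succ, cascade_succ, ← Complex.ofReal_sub, Complex.norm_real, Real.norm_eq_abs]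
      exact abs_norm_sub_norm_le _ _
    refine (lintegral_mono_ae hpt).trans ?_
    have hcomp : Measurable fun lam : Fin (m + 1) → ℝ => (Fin.init lam, lam (Fin.last m)) :=
      (measurable_fin_init m).prodMk (measurable_pi_apply _)
    have hm1' := hm1.comp hcomp
    have hm2' := hm2.comp hcomp
    simp only [Function.comp_def, Function.uncurry_apply_pair] at hm1' hm2'
    rw [lintegral_add_left (hm1'.const_mul 2), lintegral_const_mul _ hm1',
      lintegral_const_mul _ hm2', lintegral_scaleMeasurePi_succ hm1,
      lintegral_scaleMeasurePi_succ hm2]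
    have e1 : ∫⁻ a, ∫⁻ t, eLpNorm (conv (cascade φ m a f) (dilate (fun x => φ x - φ' x) t))
          (ENNReal.ofReal q) volume ^ 2 ∂scaleMeasure n ∂scaleMeasurePi n m
        ≤ layerConst n ε q D * (K ^ m * F ^ 2) := by
      calc _ ≤ ∫⁻ a, layerConst n ε q D *
            eLpNorm (cascade φ m a f) (ENNReal.ofReal q) volume ^ 2 ∂scaleMeasurePi n m := by
            refine lintegral_mono_ae ?_
            filter_upwards [ae_scaleMeasurePi_pos m] with a ha
            exact hd.lintegral_eLpNorm_conv_sq_le hq₁ hq₂ hε hε1 (measurable_cascade hφ hf _ _)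
              (h.memLp_cascade hq₁.le hε ha hf hfq)
        _ ≤ _ := by
            rw [lintegral_const_mul _ ((measurable_eLpNorm_ofReal hq0 hUm).pow_const 2)]
            gcongr
            exact h.lintegral_eLpNorm_cascade_sq_le hq₁ hq₂ hε hε1 hf hfq m
    have e2 : ∫⁻ a, ∫⁻ t, eLpNorm (conv (fun x => cascade φ m a f x - cascade φ' m a f x)
          (dilate φ' t)) (ENNReal.ofReal q) volume ^ 2 ∂scaleMeasure n ∂scaleMeasurePi n m
        ≤ K * (layerConst n ε q D * cascadeDiffConst K m * F ^ 2) := by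
      calc _ ≤ ∫⁻ a, K * eLpNorm (fun x => cascade φ m a f x - cascade φ' m a f x)
            (ENNReal.ofReal q) volume ^ 2 ∂scaleMeasurePi n m := by
            refine lintegral_mono_ae ?_
            filter_upwards [ae_scaleMeasurePi_pos m] with a ha
            exact h'.lintegral_eLpNorm_conv_sq_le hq₁ hq₂ hε hε1
              ((measurable_cascade hφ hf _ _).sub (measurable_cascade hφ' hf _ _))
              ((h.memLp_cascade hq₁.le hε ha hf hfq).sub (h'.memLp_cascade hq₁.le hε ha hf hfq))
        _ ≤ _ := by
            rw [lintegral_const_mul _ ((measurable_eLpNorm_ofReal hq0 hsub).pow_const 2)]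
            gcongr
    calc _ ≤ 2 * (layerConst n ε q D * (K ^ m * F ^ 2))
          + 2 * (K * (layerConst n ε q D * cascadeDiffConst K m * F ^ 2)) := by gcongr
      _ = _ := by
          rw [cascadeDiffConst]
          ring

end IsLPKernel

/-! ### Linear deformations -/

/-- The Jacobian $s^{-n}$ of $z=st$ is exactly the $L^1$ normalisation in `rescale`, so the dilation
passes to the kernel without leaving a factor and the identity can be iterated through the layers.
-/
theorem conv_comp_smul {s : ℝ} (hs : 0 < s) (f ψ : Euc n → ℂ) (lam : ℝ) (x : Euc n) :
    conv (fun y => f (s • y)) (dilate ψ lam) x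
      = conv f (dilate (rescale s⁻¹ ψ) lam) (s • x) := by
  have h1 : conv (fun y => f (s • y)) (dilate ψ lam) x
      = ∫ t, (fun z => f z * dilate ψ lam (x - s⁻¹ • z)) (s • t) := by
    rw [conv_apply]
    simp only [inv_smul_smul₀ hs.ne']
  have hpow : |(s ^ n)⁻¹| = (s⁻¹) ^ n := by rw [inv_pow, abs_of_pos (by positivity)]
  rw [h1, Measure.integral_comp_smul volume (fun z => f z * dilate ψ lam (x - s⁻¹ • z)) s, finrank_euclideanSpace_fin, hpow, conv_apply,
    ← integral_smul]
  refine integral_congr_ae (Filter.Eventually.of_forall fun z => ?_)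
  have h2 : lam⁻¹ • (x - s⁻¹ • z) = s⁻¹ • lam⁻¹ • (s • x - z) := by
    rw [smul_comm s⁻¹ lam⁻¹, smul_sub s⁻¹, inv_smul_smul₀ hs.ne']
  simp only [dilate, rescale, h2, Complex.real_smul]
  ring

theorem cascade_comp_smul {s : ℝ} (hs : 0 < s) (f ψ : Euc n → ℂ) (m : ℕ) (lam : Fin m → ℝ) :
    cascade ψ m lam (fun y => f (s • y)) = fun x => cascade (rescale s⁻¹ ψ) m lam f (s • x) := by
  induction m with
  | zero => rfl
  | succ m ih =>
    funext x
    rw [cascade_succ, cascade_succ, ih, conv_comp_smul hs]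

theorem deform_smul (c : ℝ) (f : Euc n → ℂ) :
    deform (fun x => c • x) f = fun x => f ((1 - c) • x) := by
  funext x
  rw [deform, sub_smul, one_smul]

theorem scattering_comp_smul {s : ℝ} (hs : 0 < s) (f ψ : Euc n → ℂ) (q : ℝ) (m : ℕ)
    (lam : Fin m → ℝ) :
    scattering ψ q m (fun y => f (s • y)) lam
      = s⁻¹ ^ n * scattering (rescale s⁻¹ ψ) q m f lam := by
  rw [scattering, cascade_comp_smul hs,
    Measure.integral_comp_smul volume (fun x => ‖cascade (rescale s⁻¹ ψ) m lam f x‖ ^ q),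
    finrank_euclideanSpace_fin, abs_of_pos (by positivity), inv_pow, smul_eq_mul, scattering]

theorem scattering_congr_ae (ψ : Euc n → ℂ) (q : ℝ) (m : ℕ) {f g : Euc n → ℂ}
    (h : f =ᵐ[volume] g) (lam : Fin m → ℝ) : scattering ψ q m f lam = scattering ψ q m g lam := by
  refine integral_congr_ae ?_
  filter_upwards [cascade_congr_ae ψ h m lam] with x hx
  rw [hx]

theorem scattering_eq_toReal {ψ : Euc n → ℂ} (hψ : Measurable ψ) {q : ℝ} (hq : 0 < q) (m : ℕ)
    {f : Euc n → ℂ} (hf : Measurable f) (lam : Fin m → ℝ) :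
    scattering ψ q m f lam
      = (eLpNorm (cascade ψ m lam f) (ENNReal.ofReal q) volume).toReal ^ q := by
  have hm := measurable_cascade hψ hf m lam
  rw [scattering, integral_eq_lintegral_of_nonneg_ae
    (Filter.Eventually.of_forall fun x => by positivity)
    (hm.norm.pow_const q).aestronglyMeasurable, ENNReal.toReal_rpow, eLpNorm_ofReal_rpow hq]
  congr 1
  refine lintegral_congr fun x => ?_
  rw [← ENNReal.ofReal_rpow_of_nonneg (norm_nonneg _) hq.le, ofReal_norm]

theorem measurable_scattering {ψ : Euc n → ℂ} (hψ : Measurable ψ) {q : ℝ} (hq : 0 < q) (m : ℕ)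
    {f : Euc n → ℂ} (hf : Measurable f) : Measurable (scattering ψ q m f) := by
  have : scattering ψ q m f = fun lam =>
      (eLpNorm (cascade ψ m lam f) (ENNReal.ofReal q) volume).toReal ^ q :=
    funext fun lam => scattering_eq_toReal hψ hq m hf lam
  rw [this]
  exact ((measurable_eLpNorm_ofReal hq
    (measurable_uncurry_cascade hψ hf m)).ennreal_toReal).pow_const q

theorem eLpNorm_comp_smul {s : ℝ} (hs : 0 < s) {q : ℝ} (hq : 0 < q) {f : Euc n → ℂ}
    (hf : Measurable f) :
    eLpNorm (fun x => f (s • x)) (ENNReal.ofReal q) volume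
      = (ENNReal.ofReal s⁻¹ ^ n) ^ (1 / q) * eLpNorm f (ENNReal.ofReal q) volume := by
  have h := lintegral_comp_inv_smul (inv_pos.2 hs) (hf.enorm.pow_const q)
  rw [inv_inv] at h
  rw [eLpNorm_ofReal_eq hq, eLpNorm_ofReal_eq hq, h,
    ENNReal.mul_rpow_of_nonneg _ _ (by positivity)]

theorem memLp_comp_smul {s : ℝ} (hs : 0 < s) {q : ℝ} (hq : 0 < q) {f : Euc n → ℂ}
    (hf : Measurable f) (hfq : MemLp f (ENNReal.ofReal q)) :
    MemLp (fun x => f (s • x)) (ENNReal.ofReal q) := by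
  refine ⟨(hf.comp (measurable_const_smul s)).aestronglyMeasurable, ?_⟩
  rw [eLpNorm_comp_smul hs hq hf]
  exact ENNReal.mul_lt_top (ENNReal.rpow_lt_top_of_nonneg (by positivity)
    (volume_gridCube_ne_top _)) hfq.2

/-! ### Elementary inequalities -/

/-- Bernoulli's inequality at $b/a$ places $b^q$ above the tangent to $t^q$ at $a$; then $q\le2$ and
$a\le a+b$. -/
theorem rpow_sub_rpow_le {q a b : ℝ} (hq₁ : 1 ≤ q) (hq₂ : q ≤ 2) (hb : 0 ≤ b) (hab : b ≤ a) :
    a ^ q - b ^ q ≤ 2 * (a - b) * (a + b) ^ (q - 1) := by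
  rcases (hb.trans hab).eq_or_lt with ha | ha
  · have hb0 : b = 0 := le_antisymm (by linarith) hb
    rw [← ha, hb0]
    simp
  have h1 := one_add_mul_self_le_rpow_one_add (s := b / a - 1)
    (by linarith [div_nonneg hb ha.le]) hq₁
  rw [add_sub_cancel, Real.div_rpow hb ha.le, le_div_iff₀ (by positivity)] at h1
  have h2 : a ^ q = a * a ^ (q - 1) := by
    rw [mul_comm, ← Real.rpow_add_one ha.ne', sub_add_cancel]
  have h3 : a ^ q - b ^ q ≤ q * (a - b) * a ^ (q - 1) := by
    have h4 : (1 + q * (b / a - 1)) * a ^ q = a ^ q - q * (a - b) * a ^ (q - 1) := by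
      rw [h2]
      field_simp
      ring
    linarith
  refine h3.trans ?_
  have h5 : 0 ≤ a - b := by linarith
  gcongr
  linarith

/-- The weight `w` will be the Jacobian $(1-c)^{-n}$ of the outer integral. Its distance from 1 is a
second first-order error, to be added to the difference of the norms. -/
theorem abs_rpow_sub_mul_rpow_le {q a b d w : ℝ} (hq₁ : 1 ≤ q) (hq₂ : q ≤ 2) (ha : 0 ≤ a)
    (hb : 0 ≤ b) (hd : |a - b| ≤ d) :
    |a ^ q - w * b ^ q| ≤ (2 * d + |1 - w| * b) * (a + b) ^ (q - 1) := by
  have h1 : |a ^ q - b ^ q| ≤ 2 * |a - b| * (a + b) ^ (q - 1) := by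
    rcases le_total b a with h | h
    · rw [abs_of_nonneg (sub_nonneg.2 h), abs_of_nonneg
        (sub_nonneg.2 (Real.rpow_le_rpow hb h (by linarith)))]
      exact rpow_sub_rpow_le hq₁ hq₂ hb h
    · rw [abs_sub_comm, abs_sub_comm a b, abs_of_nonneg (sub_nonneg.2 h), abs_of_nonneg
        (sub_nonneg.2 (Real.rpow_le_rpow ha h (by linarith))), add_comm a b]
      exact rpow_sub_rpow_le hq₁ hq₂ ha h
  have h2 : b ^ q ≤ b * (a + b) ^ (q - 1) := by
    have : b ^ q = b * b ^ (q - 1) := by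
      have h := Real.rpow_add_of_nonneg hb zero_le_one (by linarith : 0 ≤ q - 1)
      rwa [add_sub_cancel, Real.rpow_one] at h
    rw [this]
    gcongr
    linarith
  have hs : 0 ≤ (a + b) ^ (q - 1) := by positivity
  calc |a ^ q - w * b ^ q| = |(a ^ q - b ^ q) + (1 - w) * b ^ q| := by ring_nf
    _ ≤ |a ^ q - b ^ q| + |1 - w| * b ^ q := by
        refine (abs_add_le _ _).trans ?_
        rw [abs_mul, abs_of_nonneg (by positivity : 0 ≤ b ^ q)]
    _ ≤ 2 * d * (a + b) ^ (q - 1) + |1 - w| * (b * (a + b) ^ (q - 1)) := by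
        gcongr
        exact h1.trans (by gcongr)
    _ = _ := by ring

/-- Hölder's inequality in the form needed for differences of `q`-th powers of norms. -/
theorem eLpNorm_le_of_le_mul_rpow {X : Type*} [MeasurableSpace X] {μ : Measure X} {p q : ℝ}
    (hq : 1 < q) (hpq : p * q = 2) {S : X → ℝ} {u v : X → ℝ≥0∞} (hu : Measurable u)
    (hv : Measurable v) (hS : ∀ᵐ x ∂μ, ‖S x‖ₑ ≤ u x * v x ^ (q - 1)) :
    eLpNorm S (ENNReal.ofReal p) μ
      ≤ (∫⁻ x, u x ^ 2 ∂μ) ^ (1 / 2 : ℝ) * (∫⁻ x, v x ^ 2 ∂μ) ^ ((q - 1) / 2) := by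
  have hq0 : 0 < q := by linarith
  have hp : p = 2 / q := by field_simp; exact hpq
  have hp0 : 0 < p := by rw [hp]; positivity
  have h1 : ∫⁻ x, ‖S x‖ₑ ^ p ∂μ
      ≤ (∫⁻ x, u x ^ 2 ∂μ) ^ (1 / q) * (∫⁻ x, v x ^ 2 ∂μ) ^ (1 - 1 / q) := by
    -- Since $p=2/q$, one has $u^p=(u^2)^{1/q}$ and $v^{(q-1)p}=(v^2)^{1-1/q}$, so Hölder leaves
    -- only integrals of squares.
    have h2 := ENNReal.lintegral_mul_norm_pow_le (μ := μ) (hu.pow_const 2).aemeasurable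
      (hv.pow_const 2).aemeasurable (p := 1 / q) (q := 1 - 1 / q) (by positivity)
      (by rw [sub_nonneg, div_le_one hq0]; exact hq.le) (by ring)
    refine le_trans (lintegral_mono_ae ?_) h2
    filter_upwards [hS] with x hx
    calc ‖S x‖ₑ ^ p ≤ (u x * v x ^ (q - 1)) ^ p := by gcongr
      _ = _ := by
          rw [ENNReal.mul_rpow_of_nonneg _ _ hp0.le, ← ENNReal.rpow_mul, ← ENNReal.rpow_natCast,
            ← ENNReal.rpow_natCast, ← ENNReal.rpow_mul, ← ENNReal.rpow_mul]
          congr 2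
          · rw [hp]
            push_cast
            ring
          · rw [hp]
            push_cast
            field_simp
  rw [eLpNorm_ofReal_eq hp0]
  calc _ ≤ ((∫⁻ x, u x ^ 2 ∂μ) ^ (1 / q) * (∫⁻ x, v x ^ 2 ∂μ) ^ (1 - 1 / q)) ^ (1 / p) := by gcongr
    _ = _ := by
        rw [ENNReal.mul_rpow_of_nonneg _ _ (by positivity), ← ENNReal.rpow_mul, ← ENNReal.rpow_mul]
        congr 2
        · rw [hp]
          field_simp
        · rw [hp]
          field_simp

/-! ### Stability of the scattering transform -/

theorem ofReal_abs_mul_two_add {d b w : ℝ} (hd : 0 ≤ d) (hb : 0 ≤ b) {s r : ℝ} (hs : 0 ≤ s)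
    (hr : 0 ≤ r) : ENNReal.ofReal ((2 * d + |w| * b) * s ^ r)
      = (2 * ENNReal.ofReal d + ENNReal.ofReal |w| * ENNReal.ofReal b) * ENNReal.ofReal s ^ r := by
  rw [ENNReal.ofReal_mul (by positivity), ENNReal.ofReal_add (by positivity) (by positivity),
    ENNReal.ofReal_mul (by norm_num), ENNReal.ofReal_mul (abs_nonneg _), ENNReal.ofReal_ofNat,
    ENNReal.ofReal_rpow_of_nonneg hs hr]

theorem enorm_rpow_sub_mul_rpow_le {q : ℝ} (hq₁ : 1 ≤ q) (hq₂ : q ≤ 2) (w : ℝ)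
    {u v : Euc n → ℂ} (hu : MemLp u (ENNReal.ofReal q)) (hv : MemLp v (ENNReal.ofReal q)) :
    ‖(eLpNorm u (ENNReal.ofReal q) volume).toReal ^ q
      - w * (eLpNorm v (ENNReal.ofReal q) volume).toReal ^ q‖ₑ
      ≤ (2 * eLpNorm (fun x => u x - v x) (ENNReal.ofReal q) volume
          + ENNReal.ofReal |1 - w| * eLpNorm v (ENNReal.ofReal q) volume)
        * (eLpNorm u (ENNReal.ofReal q) volume + eLpNorm v (ENNReal.ofReal q) volume) ^ (q - 1) := by
  have hq1 : 1 ≤ ENNReal.ofReal q := by simpa using hq₁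
  have hd := hu.sub hv
  set a := eLpNorm u (ENNReal.ofReal q) volume with ha
  set b := eLpNorm v (ENNReal.ofReal q) volume with hb
  set d := eLpNorm (fun x => u x - v x) (ENNReal.ofReal q) volume with hdd
  have ha' : a ≠ ∞ := hu.2.ne
  have hb' : b ≠ ∞ := hv.2.ne
  have hd' : d ≠ ∞ := hd.2.ne
  have h1 : a ≤ d + b := by
    have := eLpNorm_add_le hd.1 hv.1 hq1
    rwa [sub_add_cancel] at this
  have h2 : b ≤ d + a := by
    have := eLpNorm_sub_le hu.1 hd.1 hq1
    rw [sub_sub_cancel, add_comm] at this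
    exact this
  have h1' := ENNReal.toReal_mono (by finiteness) h1
  have h2' := ENNReal.toReal_mono (by finiteness) h2
  rw [ENNReal.toReal_add hd' hb'] at h1'
  rw [ENNReal.toReal_add hd' ha'] at h2'
  have habs : |a.toReal - b.toReal| ≤ d.toReal := abs_sub_le_iff.2 ⟨by linarith, by linarith⟩
  have h3 := abs_rpow_sub_mul_rpow_le (w := w) hq₁ hq₂ ENNReal.toReal_nonneg
    ENNReal.toReal_nonneg habs
  rw [← ofReal_norm, Real.norm_eq_abs]
  refine (ENNReal.ofReal_le_ofReal h3).trans (le_of_eq ?_)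
  rw [ofReal_abs_mul_two_add ENNReal.toReal_nonneg ENNReal.toReal_nonneg
    (add_nonneg ENNReal.toReal_nonneg ENNReal.toReal_nonneg) (by linarith),
    ENNReal.ofReal_add ENNReal.toReal_nonneg ENNReal.toReal_nonneg,
    ENNReal.ofReal_toReal ha', ENNReal.ofReal_toReal hb', ENNReal.ofReal_toReal hd']

open IsLPKernel HasDecay

/-- The kernel constant common to a wavelet and its rescalings. -/
def kernelConst (n : ℕ) (A β κ : ℝ) : ℝ :=
  2 ^ ((n : ℝ) + exponent β κ) * A + diffConst n A β κ

/-- The constant of one layer for a decaying wavelet. -/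
def waveletLayerConst (n : ℕ) (q A β κ : ℝ) : ℝ≥0∞ :=
  layerConst n (exponent β κ) q (kernelConst n A β κ)

/-- The constant controlling the deformation at first order. -/
def deformConst (n m : ℕ) (q A β κ : ℝ) : ℝ≥0∞ :=
  8 * (layerConst n (exponent β κ) q (2 * diffConst n A β κ) *
      cascadeDiffConst (waveletLayerConst n q A β κ) m)
    + 2 * (ENNReal.ofReal (n * 2 ^ (n + 1)) ^ 2 * waveletLayerConst n q A β κ ^ m)

/-- The constant of the stability estimate. -/
def stabilityConst (n m : ℕ) (q A β κ : ℝ) : ℝ≥0∞ :=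
  (deformConst n m q A β κ ^ (1 / 2 : ℝ) + 2 * (4 * waveletLayerConst n q A β κ ^ m) ^ (1 / 2 : ℝ))
    * (4 * waveletLayerConst n q A β κ ^ m) ^ ((q - 1) / 2)

theorem layerConst_ne_top {ε q : ℝ} (hε : 0 < ε) (hq : 1 < q) (B : ℝ) :
    layerConst n ε q B ≠ ∞ :=
  ENNReal.mul_ne_top (ENNReal.pow_ne_top ENNReal.ofReal_ne_top) (lpConst_ne_top hε hq)

theorem stabilityConst_ne_top {q A β κ : ℝ} (hq : 1 < q) (hβ : 0 < β) (hκ : 0 < κ) (m : ℕ) :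
    stabilityConst n m q A β κ ≠ ∞ := by
  have hε := exponent_pos hβ hκ
  have hW : waveletLayerConst n q A β κ ≠ ∞ := layerConst_ne_top hε hq _
  have hW4 : 4 * waveletLayerConst n q A β κ ^ m ≠ ∞ :=
    ENNReal.mul_ne_top (by simp) (ENNReal.pow_ne_top hW)
  have hD : deformConst n m q A β κ ≠ ∞ := by
    refine ENNReal.add_ne_top.2 ⟨ENNReal.mul_ne_top (by simp) (ENNReal.mul_ne_top
      (layerConst_ne_top hε hq _) (cascadeDiffConst_ne_top hW m)), ENNReal.mul_ne_top (by simp)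
      (ENNReal.mul_ne_top (ENNReal.pow_ne_top ENNReal.ofReal_ne_top) (ENNReal.pow_ne_top hW))⟩
  refine ENNReal.mul_ne_top (ENNReal.add_ne_top.2
    ⟨ENNReal.rpow_ne_top_of_nonneg (by norm_num) hD, ENNReal.mul_ne_top (by simp)
      (ENNReal.rpow_ne_top_of_nonneg (by norm_num) hW4)⟩)
    (ENNReal.rpow_ne_top_of_nonneg (by linarith) hW4)

theorem layerConst_mul_sq {ε q : ℝ} {D t : ℝ} (ht : 0 ≤ t) :
    layerConst n ε q (D * t) = ENNReal.ofReal t ^ 2 * layerConst n ε q D := by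
  rw [layerConst, layerConst, mul_comm D, ENNReal.ofReal_mul ht]
  ring

theorem layerConst_mono {ε q : ℝ} {B B' : ℝ} (h : B ≤ B') :
    layerConst n ε q B ≤ layerConst n ε q B' := by
  rw [layerConst, layerConst]
  gcongr

theorem rpow_half_mul_rpow_half {q : ℝ} (hq : 1 < q) (F : ℝ≥0∞) :
    (F ^ 2) ^ (1 / 2 : ℝ) * (F ^ 2) ^ ((q - 1) / 2) = F ^ q := by
  rw [← ENNReal.rpow_add_of_nonneg _ _ (by norm_num) (by linarith), ← ENNReal.rpow_natCast,
    ← ENNReal.rpow_mul]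
  congr 1
  push_cast
  ring

section

variable {p q A α β κ : ℝ} {ψ : Euc n → ℂ} {f : Euc n → ℂ} {c : ℝ}

theorem HasDecay.isLPKernel_kernelConst (hα : 0 < α) (hβ : 0 < β) (hκ : 0 < κ)
    (h : HasDecay A α β κ ψ) (h0 : ∫ x, ψ x = 0) :
    IsLPKernel (exponent β κ) (kernelConst n A β κ) ψ := by
  refine (h.isLPKernel hα hβ hκ h0).mono ?_
  have hA := h.const_nonneg
  rw [kernelConst, diffConst]
  linarith [show 0 ≤ 2 ^ ((n : ℝ) + exponent β κ) *
    ((n + 3) * 2 ^ (n + 1) * (((n : ℝ) ^ 2 + 1) * A) * 2 ^ ((n : ℝ) + exponent β κ)) by positivity]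

theorem diffConst_nonneg (hA : 0 ≤ A) : 0 ≤ diffConst n A β κ := by
  rw [diffConst]
  positivity

/-- Written as $\psi-(\psi-\psi_\mu)$, the rescaled wavelet inherits its bounds from two known
kernels, and $|\mu-1|\le1$ makes the constant uniform in $\mu$. -/
theorem HasDecay.isLPKernel_rescale (hα : 0 < α) (hβ : 0 < β) (hκ : 0 < κ)
    (h : HasDecay A α β κ ψ) (hi : Integrable ψ) (h0 : ∫ x, ψ x = 0) {μ : ℝ}
    (hμ : μ ∈ Icc (1 / 2 : ℝ) 2) :
    IsLPKernel (exponent β κ) (kernelConst n A β κ) (rescale μ ψ) := by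
  have h1 := (h.isLPKernel hα hβ hκ h0).sub (exponent_pos hβ hκ)
    (h.isLPKernel_sub_rescale hα hβ hκ hi h0 hμ)
  simp only [sub_sub_cancel] at h1
  refine h1.mono ?_
  have h2 : |μ - 1| ≤ 1 := abs_le.2 ⟨by linarith [hμ.1], by linarith [hμ.2]⟩
  have h3 := mul_le_mul_of_nonneg_left h2 (diffConst_nonneg (n := n) (β := β) (κ := κ)
    h.const_nonneg)
  rw [kernelConst]
  linarith

/-- Stability under small linear deformations. -/
theorem eLpNorm_scattering_sub_le_of_small (hq₁ : 1 < q) (hq₂ : q < 2) (hpq : p * q = 2)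
    (hα : 0 < α) (hβ : 0 < β) (hκ : 0 < κ) (h : HasDecay A α β κ ψ) (hi : Integrable ψ)
    (h0 : ∫ x, ψ x = 0) (hc : |c| ≤ 1 / 2) (hf : Measurable f)
    (hfq : MemLp f (ENNReal.ofReal q)) (m : ℕ) :
    eLpNorm (fun lam => scattering ψ q m f lam - scattering ψ q m (fun x => f ((1 - c) • x)) lam)
      (ENNReal.ofReal p) (scaleMeasurePi n m)
      ≤ ENNReal.ofReal |c| * (deformConst n m q A β κ ^ (1 / 2 : ℝ)
          * (4 * waveletLayerConst n q A β κ ^ m) ^ ((q - 1) / 2))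
        * eLpNorm f (ENNReal.ofReal q) volume ^ q := by
  have hq0 : 0 < q := by linarith
  obtain ⟨hc1, hc2⟩ := abs_le.1 hc
  have hs : 0 < 1 - c := by linarith
  set μ := (1 - c)⁻¹ with hμdef
  have hμ : μ ∈ Icc (1 / 2 : ℝ) 2 := by
    rw [hμdef]
    constructor
    · rw [one_div]
      exact inv_anti₀ hs (by linarith)
    · rw [inv_le_comm₀ hs (by norm_num)]
      linarith
  have hμ1 : |μ - 1| ≤ 2 * |c| := by
    have : μ - 1 = μ * c := by
      rw [hμdef]
      field_simp
      ring
    rw [this, abs_mul, abs_of_pos (by linarith [hμ.1] : 0 < μ)]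
    gcongr
    exact hμ.2
  -- The Jacobian $\mu^n$ of the outermost integral differs from 1 by $O(|c|)$.
  have hw : |1 - μ ^ n| ≤ |c| * (n * 2 ^ (n + 1)) := by
    have h1 := abs_pow_sub_pow_le (1 : ℝ) μ n
    rw [one_pow, abs_one, abs_of_pos (by linarith [hμ.1] : 0 < μ), abs_sub_comm 1 μ] at h1
    refine h1.trans ?_
    have h2 : max 1 μ ≤ 2 := max_le (by norm_num) hμ.2
    have h3 : max 1 μ ^ (n - 1) ≤ 2 ^ n :=
      (pow_le_pow_left₀ (by positivity) h2 _).trans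
        (pow_le_pow_right₀ (by norm_num) (Nat.sub_le n 1))
    calc |μ - 1| * n * max 1 μ ^ (n - 1) ≤ 2 * |c| * n * 2 ^ n := by gcongr
      _ = _ := by ring
  set ε := exponent β κ with hεdef
  have hε : 0 < ε := exponent_pos hβ hκ
  have hε1 : ε ≤ 1 := exponent_le_one β κ
  have hk := h.isLPKernel_kernelConst hα hβ hκ h0
  have hk' := h.isLPKernel_rescale hα hβ hκ hi h0 hμ
  have hkd := h.isLPKernel_sub_rescale hα hβ hκ hi h0 hμ
  have hψ := hk.continuous.measurable
  have hψ' := hk'.continuous.measurable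
  set W := waveletLayerConst n q A β κ with hW
  set F := eLpNorm f (ENNReal.ofReal q) volume with hF
  set a : (Fin m → ℝ) → ℝ≥0∞ := fun lam =>
    eLpNorm (cascade ψ m lam f) (ENNReal.ofReal q) volume with ha
  set b : (Fin m → ℝ) → ℝ≥0∞ := fun lam =>
    eLpNorm (cascade (rescale μ ψ) m lam f) (ENNReal.ofReal q) volume with hb
  set d : (Fin m → ℝ) → ℝ≥0∞ := fun lam =>
    eLpNorm (fun x => cascade ψ m lam f x - cascade (rescale μ ψ) m lam f x)
      (ENNReal.ofReal q) volume with hd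
  have hU := measurable_uncurry_cascade hψ hf m
  have hU' := measurable_uncurry_cascade hψ' hf m
  have ham : Measurable a := measurable_eLpNorm_ofReal hq0 hU
  have hbm : Measurable b := measurable_eLpNorm_ofReal hq0 hU'
  have hdm : Measurable d := measurable_eLpNorm_ofReal hq0
    (u := fun lam x => cascade ψ m lam f x - cascade (rescale μ ψ) m lam f x) (hU.sub hU')
  have ia : ∫⁻ lam, a lam ^ 2 ∂scaleMeasurePi n m ≤ W ^ m * F ^ 2 :=
    hk.lintegral_eLpNorm_cascade_sq_le hq₁ hq₂ hε hε1 hf hfq m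
  have ib : ∫⁻ lam, b lam ^ 2 ∂scaleMeasurePi n m ≤ W ^ m * F ^ 2 :=
    hk'.lintegral_eLpNorm_cascade_sq_le hq₁ hq₂ hε hε1 hf hfq m
  have id : ∫⁻ lam, d lam ^ 2 ∂scaleMeasurePi n m
      ≤ ENNReal.ofReal |c| ^ 2 * layerConst n ε q (2 * diffConst n A β κ)
        * cascadeDiffConst W m * F ^ 2 := by
    refine (hk.lintegral_eLpNorm_cascade_sub_sq_le hq₁ hq₂ hε hε1 hk' hkd hf hfq m).trans ?_
    rw [← layerConst_mul_sq (abs_nonneg c)]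
    have : diffConst n A β κ * |μ - 1| ≤ 2 * diffConst n A β κ * |c| := by
      have := mul_le_mul_of_nonneg_left hμ1 (diffConst_nonneg (n := n) (β := β) (κ := κ)
        h.const_nonneg)
      linarith
    gcongr
    · exact layerConst_mono this
    · exact le_rfl
  have hle : ∀ᵐ lam ∂scaleMeasurePi n m,
      ‖scattering ψ q m f lam - scattering ψ q m (fun x => f ((1 - c) • x)) lam‖ₑ
        ≤ (2 * d lam + ENNReal.ofReal |1 - μ ^ n| * b lam) * (a lam + b lam) ^ (q - 1) := by
    filter_upwards [ae_scaleMeasurePi_pos m] with lam hlam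
    rw [scattering_comp_smul hs, scattering_eq_toReal hψ hq0 m hf,
      scattering_eq_toReal hψ' hq0 m hf]
    exact enorm_rpow_sub_mul_rpow_le hq₁.le hq₂.le _ (hk.memLp_cascade hq₁.le hε hlam hf hfq)
      (hk'.memLp_cascade hq₁.le hε hlam hf hfq)
  refine (eLpNorm_le_of_le_mul_rpow hq₁ hpq ((hdm.const_mul 2).add (hbm.const_mul _))
    (ham.add hbm) hle).trans ?_
  have e1 : ∫⁻ lam, (2 * d lam + ENNReal.ofReal |1 - μ ^ n| * b lam) ^ 2 ∂scaleMeasurePi n m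
      ≤ ENNReal.ofReal |c| ^ 2 * deformConst n m q A β κ * F ^ 2 := by
    have hw' : ENNReal.ofReal |1 - μ ^ n| ≤ ENNReal.ofReal |c| * ENNReal.ofReal (n * 2 ^ (n + 1)) := by
      rw [← ENNReal.ofReal_mul (abs_nonneg c)]
      exact ENNReal.ofReal_le_ofReal hw
    -- The 8 is $2\cdot2^2$: the 2 in front of `d` is squared, and $(x+y)^2\le2x^2+2y^2$.
    calc _ ≤ ∫⁻ lam, (8 * d lam ^ 2 + 2 * ENNReal.ofReal |1 - μ ^ n| ^ 2 * b lam ^ 2)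
          ∂scaleMeasurePi n m := by
          refine lintegral_mono fun lam => (add_sq_le_two_mul _ _).trans (le_of_eq ?_)
          ring
      _ = 8 * (∫⁻ lam, d lam ^ 2 ∂scaleMeasurePi n m)
          + 2 * ENNReal.ofReal |1 - μ ^ n| ^ 2 * ∫⁻ lam, b lam ^ 2 ∂scaleMeasurePi n m := by
          rw [lintegral_add_left (by fun_prop), lintegral_const_mul _ (by fun_prop),
            lintegral_const_mul _ (by fun_prop)]
      _ ≤ 8 * (ENNReal.ofReal |c| ^ 2 * layerConst n ε q (2 * diffConst n A β κ)
            * cascadeDiffConst W m * F ^ 2)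
          + 2 * (ENNReal.ofReal |c| * ENNReal.ofReal (n * 2 ^ (n + 1))) ^ 2 * (W ^ m * F ^ 2) := by
          gcongr
      _ = _ := by
          rw [deformConst]
          ring
  have e2 : ∫⁻ lam, (a lam + b lam) ^ 2 ∂scaleMeasurePi n m ≤ 4 * W ^ m * F ^ 2 := by
    calc _ ≤ ∫⁻ lam, (2 * a lam ^ 2 + 2 * b lam ^ 2) ∂scaleMeasurePi n m :=
          lintegral_mono fun lam => add_sq_le_two_mul _ _
      _ = 2 * (∫⁻ lam, a lam ^ 2 ∂scaleMeasurePi n m)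
          + 2 * ∫⁻ lam, b lam ^ 2 ∂scaleMeasurePi n m := by
          rw [lintegral_add_left (by fun_prop), lintegral_const_mul _ (by fun_prop),
            lintegral_const_mul _ (by fun_prop)]
      _ ≤ 2 * (W ^ m * F ^ 2) + 2 * (W ^ m * F ^ 2) := by gcongr
      _ = _ := by ring
  have hq3 : 0 ≤ (q - 1) / 2 := by linarith
  calc _ ≤ (ENNReal.ofReal |c| ^ 2 * deformConst n m q A β κ * F ^ 2) ^ (1 / 2 : ℝ)
        * (4 * W ^ m * F ^ 2) ^ ((q - 1) / 2) := by
        gcongr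
        · exact e1
        · exact e2
    _ = ENNReal.ofReal |c| * (deformConst n m q A β κ ^ (1 / 2 : ℝ)
          * (4 * W ^ m) ^ ((q - 1) / 2)) * ((F ^ 2) ^ (1 / 2 : ℝ) * (F ^ 2) ^ ((q - 1) / 2)) := by
        rw [ENNReal.mul_rpow_of_nonneg _ _ (by norm_num), ENNReal.mul_rpow_of_nonneg _ _
          (by norm_num), ENNReal.mul_rpow_of_nonneg (4 * W ^ m) _ hq3, ← ENNReal.rpow_natCast
          (ENNReal.ofReal |c|), ← ENNReal.rpow_mul, show ((2 : ℕ) : ℝ) * (1 / 2) = 1 by norm_num,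
          ENNReal.rpow_one]
        ring
    _ = _ := by rw [rpow_half_mul_rpow_half hq₁]

/-- The estimate for large deformations follows from the boundedness of the transform. -/
theorem eLpNorm_scattering_sub_le_of_large (hq₁ : 1 < q) (hq₂ : q < 2) (hpq : p * q = 2)
    (hα : 0 < α) (hβ : 0 < β) (hκ : 0 < κ) (h : HasDecay A α β κ ψ)
    (h0 : ∫ x, ψ x = 0) (hc : c ≤ -(1 / 2)) (hf : Measurable f)
    (hfq : MemLp f (ENNReal.ofReal q)) (m : ℕ) :
    eLpNorm (fun lam => scattering ψ q m f lam - scattering ψ q m (fun x => f ((1 - c) • x)) lam)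
      (ENNReal.ofReal p) (scaleMeasurePi n m)
      ≤ ENNReal.ofReal |c| * (2 * (4 * waveletLayerConst n q A β κ ^ m) ^ (1 / 2 : ℝ)
          * (4 * waveletLayerConst n q A β κ ^ m) ^ ((q - 1) / 2))
        * eLpNorm f (ENNReal.ofReal q) volume ^ q := by
  have hq0 : 0 < q := by linarith
  have hs : 0 < 1 - c := by linarith
  set ε := exponent β κ with hεdef
  have hε : 0 < ε := exponent_pos hβ hκ
  have hε1 : ε ≤ 1 := exponent_le_one β κ
  have hk := h.isLPKernel_kernelConst hα hβ hκ h0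
  have hψ := hk.continuous.measurable
  set g : Euc n → ℂ := fun x => f ((1 - c) • x) with hg
  have hgm : Measurable g := hf.comp (measurable_const_smul (1 - c))
  have hgq : MemLp g (ENNReal.ofReal q) := memLp_comp_smul hs hq0 hf hfq
  set W := waveletLayerConst n q A β κ with hW
  set F := eLpNorm f (ENNReal.ofReal q) volume with hF
  -- Here $1-c\ge1$, so the dilation does not increase the $L^q$ norm.
  have hgF : eLpNorm g (ENNReal.ofReal q) volume ≤ F := by
    rw [hg, eLpNorm_comp_smul hs hq0 hf]
    refine mul_le_of_le_one_left zero_le (ENNReal.rpow_le_one (pow_le_one₀ zero_le ?_)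
      (by positivity))
    rw [ENNReal.ofReal_le_one]
    exact inv_le_one_of_one_le₀ (by linarith)
  set a : (Fin m → ℝ) → ℝ≥0∞ := fun lam =>
    eLpNorm (cascade ψ m lam f) (ENNReal.ofReal q) volume with ha
  set b : (Fin m → ℝ) → ℝ≥0∞ := fun lam =>
    eLpNorm (cascade ψ m lam g) (ENNReal.ofReal q) volume with hb
  have ham : Measurable a := measurable_eLpNorm_ofReal hq0 (measurable_uncurry_cascade hψ hf m)
  have hbm : Measurable b := measurable_eLpNorm_ofReal hq0 (measurable_uncurry_cascade hψ hgm m)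
  have ia : ∫⁻ lam, a lam ^ 2 ∂scaleMeasurePi n m ≤ W ^ m * F ^ 2 :=
    hk.lintegral_eLpNorm_cascade_sq_le hq₁ hq₂ hε hε1 hf hfq m
  have ib : ∫⁻ lam, b lam ^ 2 ∂scaleMeasurePi n m ≤ W ^ m * F ^ 2 :=
    (hk.lintegral_eLpNorm_cascade_sq_le hq₁ hq₂ hε hε1 hgm hgq m).trans (by gcongr; exact le_rfl)
  have hle : ∀ᵐ lam ∂scaleMeasurePi n m,
      ‖scattering ψ q m f lam - scattering ψ q m g lam‖ₑ
        ≤ (a lam + b lam) * (a lam + b lam) ^ (q - 1) := by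
    filter_upwards [ae_scaleMeasurePi_pos m] with lam hlam
    have ha' : a lam ≠ ∞ := (hk.memLp_cascade hq₁.le hε hlam hf hfq).2.ne
    have hb' : b lam ≠ ∞ := (hk.memLp_cascade hq₁.le hε hlam hgm hgq).2.ne
    rw [scattering_eq_toReal hψ hq0 m hf, scattering_eq_toReal hψ hq0 m hgm]
    have hp : (a lam + b lam) * (a lam + b lam) ^ (q - 1) = (a lam + b lam) ^ q := by
      nth_rw 1 [← ENNReal.rpow_one (a lam + b lam)]
      rw [← ENNReal.rpow_add_of_nonneg _ _ zero_le_one (by linarith), add_sub_cancel]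
    rw [hp]
    refine le_trans ?_ (ENNReal.add_rpow_le_rpow_add _ _ hq₁.le)
    refine enorm_sub_le.trans (le_of_eq ?_)
    have he (t : ℝ≥0∞) (ht : t ≠ ∞) : ‖t.toReal ^ q‖ₑ = t ^ q := by
      rw [← ofReal_norm, Real.norm_of_nonneg (by positivity),
        ← ENNReal.ofReal_rpow_of_nonneg ENNReal.toReal_nonneg hq0.le, ENNReal.ofReal_toReal ht]
    rw [he _ ha', he _ hb']
  refine (eLpNorm_le_of_le_mul_rpow hq₁ hpq (ham.add hbm) (ham.add hbm) hle).trans ?_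
  have e2 : ∫⁻ lam, (a lam + b lam) ^ 2 ∂scaleMeasurePi n m ≤ 4 * W ^ m * F ^ 2 := by
    calc _ ≤ ∫⁻ lam, (2 * a lam ^ 2 + 2 * b lam ^ 2) ∂scaleMeasurePi n m :=
          lintegral_mono fun lam => add_sq_le_two_mul _ _
      _ = 2 * (∫⁻ lam, a lam ^ 2 ∂scaleMeasurePi n m)
          + 2 * ∫⁻ lam, b lam ^ 2 ∂scaleMeasurePi n m := by
          rw [lintegral_add_left (by fun_prop), lintegral_const_mul _ (by fun_prop),
            lintegral_const_mul _ (by fun_prop)]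
      _ ≤ 2 * (W ^ m * F ^ 2) + 2 * (W ^ m * F ^ 2) := by gcongr
      _ = _ := by ring
  have hq3 : 0 ≤ (q - 1) / 2 := by linarith
  -- Since $|c|\ge1/2$, a bound that does not involve $c$ may be multiplied by $2|c|$.
  have hc1 : (1 : ℝ≥0∞) ≤ ENNReal.ofReal |c| * 2 := by
    rw [← ENNReal.ofReal_ofNat 2, ← ENNReal.ofReal_mul (abs_nonneg c), ENNReal.one_le_ofReal,
      abs_of_neg (by linarith)]
    linarith
  calc _ ≤ (4 * W ^ m * F ^ 2) ^ (1 / 2 : ℝ) * (4 * W ^ m * F ^ 2) ^ ((q - 1) / 2) := by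
        gcongr <;> exact e2
    _ = 1 * ((4 * W ^ m) ^ (1 / 2 : ℝ) * (4 * W ^ m) ^ ((q - 1) / 2)
          * ((F ^ 2) ^ (1 / 2 : ℝ) * (F ^ 2) ^ ((q - 1) / 2))) := by
        rw [ENNReal.mul_rpow_of_nonneg (4 * W ^ m) _ (by norm_num),
          ENNReal.mul_rpow_of_nonneg (4 * W ^ m) _ hq3]
        ring
    _ ≤ ENNReal.ofReal |c| * 2 * ((4 * W ^ m) ^ (1 / 2 : ℝ) * (4 * W ^ m) ^ ((q - 1) / 2)
          * ((F ^ 2) ^ (1 / 2 : ℝ) * (F ^ 2) ^ ((q - 1) / 2))) := by gcongr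
    _ = _ := by
        rw [rpow_half_mul_rpow_half hq₁]
        ring

theorem eLpNorm_scattering_sub_le (hq₁ : 1 < q) (hq₂ : q < 2) (hpq : p * q = 2)
    (hα : 0 < α) (hβ : 0 < β) (hκ : 0 < κ) (h : HasDecay A α β κ ψ) (hi : Integrable ψ)
    (h0 : ∫ x, ψ x = 0) (hc : c ≤ 1 / 2) (hf : Measurable f)
    (hfq : MemLp f (ENNReal.ofReal q)) (m : ℕ) :
    eLpNorm (fun lam => scattering ψ q m f lam - scattering ψ q m (fun x => f ((1 - c) • x)) lam)
      (ENNReal.ofReal p) (scaleMeasurePi n m)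
      ≤ ENNReal.ofReal |c| * stabilityConst n m q A β κ
        * eLpNorm f (ENNReal.ofReal q) volume ^ q := by
  rw [stabilityConst]
  rcases le_total c (-(1 / 2)) with hc' | hc'
  · refine (eLpNorm_scattering_sub_le_of_large hq₁ hq₂ hpq hα hβ hκ h h0 hc' hf hfq m).trans ?_
    gcongr
    exact le_add_self
  · refine (eLpNorm_scattering_sub_le_of_small hq₁ hq₂ hpq hα hβ hκ h hi h0
      (abs_le.2 ⟨hc', hc⟩) hf hfq m).trans ?_
    gcongr
    exact le_self_add

end

end WaveletScattering

end

/-! ### The theorem for arbitrary representatives of $L^q$ classes. -/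

theorem mainTheorem9 (n m : ℕ) (hn : 1 ≤ n) (hm : 1 ≤ m)
    (p q : ℝ) (hq₁ : 1 < q) (hq₂ : q < 2) (hpq : p * q = 2)
    (A α β κ : ℝ) (hα : 0 < α) (hβ : 0 < β) (hκ : 0 < κ) :
    ∃ K : ℝ, 0 < K ∧
      ∀ ψ : EuclideanSpace ℝ (Fin n) → ℂ,
        WaveletScattering.IsWavelet ψ → WaveletScattering.HasDecay A α β κ ψ →
      ∀ c : ℝ, c < 1 / (2 * (n : ℝ)) →
      ∀ f : EuclideanSpace ℝ (Fin n) → ℂ,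
        MeasureTheory.MemLp f (ENNReal.ofReal q) MeasureTheory.volume →
        (∀ lam : Fin m → ℝ, (∀ i, 0 < lam i) →
          MeasureTheory.MemLp (WaveletScattering.cascade ψ m lam f)
            (ENNReal.ofReal q) MeasureTheory.volume ∧
          MeasureTheory.MemLp
            (WaveletScattering.cascade ψ m lam (WaveletScattering.deform (fun x => c • x) f))
            (ENNReal.ofReal q) MeasureTheory.volume) ∧
        MeasureTheory.MemLp
          (fun lam => WaveletScattering.scattering ψ q m f lam -
            WaveletScattering.scattering ψ q m (WaveletScattering.deform (fun x => c • x) f) lam)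
          (ENNReal.ofReal p) (WaveletScattering.scaleMeasurePi n m) ∧
        MeasureTheory.eLpNorm
          (fun lam => WaveletScattering.scattering ψ q m f lam -
            WaveletScattering.scattering ψ q m (WaveletScattering.deform (fun x => c • x) f) lam)
          (ENNReal.ofReal p) (WaveletScattering.scaleMeasurePi n m)
          ≤ ENNReal.ofReal (|c| * K) *
            MeasureTheory.eLpNorm f (ENNReal.ofReal q) MeasureTheory.volume ^ q := by
  have hC := WaveletScattering.stabilityConst_ne_top (n := n) (A := A) hq₁ hβ hκ m
  -- The constant is fixed before `ψ`; adding 1 only ensures that it is positive.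
  refine ⟨(WaveletScattering.stabilityConst n m q A β κ).toReal + 1, by positivity,
    fun ψ hψ hdec c hc f₀ hf₀ => ?_⟩
  have hq0 : 0 < q := by linarith
  -- The upper bound on $c$ enters only through $1/(2n)\le1/2$: it keeps $1-c$ away from 0.
  have hc2 : c ≤ 1 / 2 := by
    refine hc.le.trans (one_div_le_one_div_of_le (by norm_num) ?_)
    have : (1 : ℝ) ≤ n := by exact_mod_cast hn
    linarith
  have hs : 0 < 1 - c := by linarith
  have hi : MeasureTheory.Integrable ψ := MeasureTheory.memLp_one_iff_integrable.1 hψ.memLp_one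
  have hε := WaveletScattering.HasDecay.exponent_pos hβ hκ
  have hk := hdec.isLPKernel hα hβ hκ hψ.integral_eq_zero
  have hψm := hk.continuous.measurable
  -- The estimates are stated for measurable functions. Passing to a measurable representative is
  -- harmless because scattering values depend only on the almost-everywhere class, and the dilation
  -- by $1-c\ne0$ preserves null sets.
  set f := hf₀.1.mk f₀ with hfdef
  have hff : f₀ =ᵐ[MeasureTheory.volume] f := hf₀.1.ae_eq_mk
  have hfm : Measurable f := hf₀.1.stronglyMeasurable_mk.measurable
  have hfq : MeasureTheory.MemLp f (ENNReal.ofReal q) MeasureTheory.volume :=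
    (MeasureTheory.memLp_congr_ae hff).1 hf₀
  have hgg : WaveletScattering.deform (fun x => c • x) f₀
      =ᵐ[MeasureTheory.volume] fun x => f ((1 - c) • x) := by
    rw [WaveletScattering.deform_smul]
    exact (MeasureTheory.Measure.quasiMeasurePreserving_smul MeasureTheory.volume
      hs.ne').ae_eq_comp hff
  have hgm : Measurable fun x => f ((1 - c) • x) := hfm.comp (measurable_const_smul (1 - c))
  have hgq := WaveletScattering.memLp_comp_smul hs hq0 hfm hfq
  have hS : (fun lam => WaveletScattering.scattering ψ q m f₀ lam -
      WaveletScattering.scattering ψ q m (WaveletScattering.deform (fun x => c • x) f₀) lam)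
      = fun lam => WaveletScattering.scattering ψ q m f lam -
        WaveletScattering.scattering ψ q m (fun x => f ((1 - c) • x)) lam := by
    funext lam
    rw [WaveletScattering.scattering_congr_ae ψ q m hff,
      WaveletScattering.scattering_congr_ae ψ q m hgg]
  have hbound := WaveletScattering.eLpNorm_scattering_sub_le hq₁ hq₂ hpq hα hβ hκ hdec hi
    hψ.integral_eq_zero hc2 hfm hfq m
  refine ⟨fun lam hlam => ⟨?_, ?_⟩, ?_, ?_⟩
  · exact (MeasureTheory.memLp_congr_ae (WaveletScattering.cascade_congr_ae ψ hff m lam)).2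
      (hk.memLp_cascade hq₁.le hε hlam hfm hfq)
  · exact (MeasureTheory.memLp_congr_ae (WaveletScattering.cascade_congr_ae ψ hgg m lam)).2
      (hk.memLp_cascade hq₁.le hε hlam hgm hgq)
  · rw [hS]
    refine ⟨((WaveletScattering.measurable_scattering hψm hq0 m hfm).sub
      (WaveletScattering.measurable_scattering hψm hq0 m hgm)).aestronglyMeasurable,
      hbound.trans_lt ?_⟩
    exact ENNReal.mul_lt_top (ENNReal.mul_lt_top ENNReal.ofReal_lt_top hC.lt_top)
      (ENNReal.rpow_lt_top_of_nonneg hq0.le hfq.2.ne)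
  · rw [hS, MeasureTheory.eLpNorm_congr_ae hff]
    refine hbound.trans ?_
    rw [ENNReal.ofReal_mul (abs_nonneg c)]
    gcongr
    rw [ENNReal.ofReal_add ENNReal.toReal_nonneg zero_le_one, ENNReal.ofReal_toReal hC]
    exact le_self_add
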